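/- \textbf{Setting.} Let $d\in\{2,3\}$, let $\Omega\subset\mathbb R^d$ be an open, bounded polytopic domain with Lipschitz boundary (only $\Omega=\operatorname{int}\overline\Omega$ is used), $\mathcal T_h$ a conforming simplicial mesh of $\Omega$, $T>0$, $c>0$, $\delta\ge 0$, $k\in\mathbb R$, $p\in\mathbb N_0$. Let $\mathcal S_p=\prod_K \mathbb P_p(K)$, $\mathcal Q_p=\prod_K\mathbb P_p(K)^d$, $\mathcal M_p=\prod_F\mathbb P_p(F)$ ($F$ running over the internal facets), and let $\tau|_{\partial K}$ be equal to a constant $\bar\tau>0$ on one fixed facet of $K$ and $0$ on the other facets. $(\partial\mathcal T_h)^{\mathcal I}$, $(\partial\mathcal T_h)^{\mathcal D}$ denote the element boundaries lying on internal, respectively boundary, facets. Let $(\psi,v)$ be a solution of the Westervelt equation $(1+2k\psi_t)\psi_{tt}-c^2\nabla\cdot v-\delta\nabla\cdot v_t=0$, $v=\nabla\psi$ in $\Omega\times(0,T)$, $\psi=0$ on $\partial\Omega$, $\psi(0)=\psi_0$, $\psi_t(0)=\psi_1$, with $\psi\in W^{3,1}(0,T;H^1_0(\Omega))$, $v\in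 W^{3,1}(0,T;H(\mathrm{div};\Omega))$ and $v(t)\in H^1(\mathcal T_h)^d$ for all $t\in[0,T]$. For $\alpha_h\in H^1(0,T;\mathcal S_p)$ let $(\psi_h,v_h,\lambda_h)\in W^{3,1}(0,T;\mathcal S_p\times\mathcal Q_p\times\mathcal M_p)$ satisfy, for all $t\in(0,T]$ and all $(w,r,\mu)\in \mathcal S_p\times\mathcal Q_p\times\mathcal M_p$, with $\tilde u=u+\frac{\delta}{c^2}u_t$, \begin{align*} (v_h,r)_{\mathcal T_h}+(\psi_h,\nabla\cdot r)_{\mathcal T_h}-(\lambda_h,[\![r]\!])_{\mathcal F_h^{\mathcal I}}&=0,\\ ((1+2k\alpha_h)\psi_{h,tt},w)_{\mathcal T_h}-c^2(w,\nabla\cdot\tilde v_h)_{\mathcal T_h}+c^2(\tau\tilde\psi_h,w)_{\partial\mathcal T_h}-c^2(\tau\tilde\lambda_h,w)_{(\partial\mathcal T_h)^{\mathcal I}}&=0,\\ (\mu,[\![v_h]\!])_{\mathcal F_h^{\mathcal I}}-(\tau\mu,\psi_h)_{(\partial\mathcal T_h)^{\mathcal I}}+(\tau\lambda_h,\mu)_{(\partial\mathcal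 T_h)^{\mathcal I}}&=0 \end{align*} (no particular discrete initial data are prescribed). Let $(\Pi_{\mathcal S}\psi,\Pi_{\mathcal Q}v)(t)\in\mathcal S_p\times\mathcal Q_p$ be the HDG projection of $(\psi,v)(t)$: on every element $K$, $\Pi_{\mathcal Q}v-v\perp\mathbb P_{p-1}(K)^d$ and $\Pi_{\mathcal S}\psi-\psi\perp\mathbb P_{p-1}(K)$ in $L^2(K)$, and $\Pi_{\mathcal Q}v\cdot n_K-\tau(\Pi_{\mathcal S}\psi-\Pi_{\mathcal M}\psi)-v\cdot n_K\perp\mathbb P_p(F)$ in $L^2(F)$ for every facet $F$ of $K$, where $\Pi_{\mathcal M}$ is the facetwise $L^2$-projection of traces. Let $\Pi_0$ be the $L^2(\Omega)$-projection onto $\mathcal S_p$. Set $$\delta_\psi=\Pi_{\mathcal S}\psi-\psi,\quad \delta_v=\Pi_{\mathcal Q}v-v,\quad e_\psi=\psi-\psi_h,\quad e_v=v-v_h,$$ $$\eta_\psi=\Pi_{\mathcal S}\psi-\psi_h,\quad \eta_v=\Pi_{\mathcal Q}v-v_h,\quad \eta_\lambda=\Pi_{\mathcal M}\psi-\lambda_h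 ,$$ $$\hat\varphi=\Pi_0\big[(1+2k\alpha_h)\partial_{tt}\delta_\psi-2k(\psi_t-\alpha_h)\psi_{tt}\big],$$ and, for $i=0,1$, $$\mathcal E_h^{(i)}(t)=\tfrac12\|\sqrt{1+2k\alpha_h}\,\partial_t^{i+1}\eta_\psi\|_{L^2(\Omega)}^2+\tfrac{c^2}{2}\Big(\|\partial_t^i\eta_v\|_{L^2(\Omega)}^2+\|\tau^{1/2}\partial_t^i(\eta_\lambda-\eta_\psi)\|^2_{L^2((\partial\mathcal T_h)^{\mathcal I})}+\|\tau^{1/2}\partial_t^i\eta_\psi\|^2_{L^2((\partial\mathcal T_h)^{\mathcal D})}\Big).$$ \textbf{Theorem.} Assume that there are $\underline\alpha,\overline\alpha>0$ and $0<\gamma_0<\sigma_0<1$ with $$0<1-2|k|\underline\alpha\le 1+2k\alpha_h\le 1+2|k|\overline\alpha\ \text{ in }\Omega\times(0,T),\qquad \frac{|k|}{1-2|k|\underline\alpha}\|\partial_t\alpha_h\|_{L^1(0,T;L^\infty(\Omega))}+\frac{\gamma_0}{2}\le\frac{\sigma_0}{2},$$ that $\delta_v\in W^{3,1}(0,T;L^2(\Omega)^d)$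 and that $\hat\varphi\in H^1(0,T;\mathcal S_p)$. Then, for $i=0$ and for $i=1$, \begin{align*} \sup_{t\in(0,T)}\Big(\tfrac{c^2}{2}\|\partial_t^i e_v\|_{L^2(\Omega)}^2+\tfrac12\|\sqrt{1+2k\alpha_h}\,\partial_t^{i+1}e_\psi\|_{L^2(\Omega)}^2\Big) \le{}&\sup_{t\in(0,T)}\Big(c^2\|\partial_t^i\delta_v\|_{L^2(\Omega)}^2+\|\sqrt{1+2k\alpha_h}\,\partial_t^{i+1}\delta_\psi\|_{L^2(\Omega)}^2\Big)\\ &+\frac{2}{1-\sigma_0}\Big(\mathcal E_h^{(i)}(0)+\frac{T}{2\gamma_0(1-2|k|\underline\alpha)}\|\partial_t^i\hat\varphi\|_{L^2(0,T;L^2(\Omega))}^2\\ &\qquad+\Big(\frac{\delta}{4}+\frac{c^2T}{2\gamma_0}\Big)\|\partial_t^{i+1}\delta_v\|_{L^2(0,T;L^2(\Omega))}^2\Big), \end{align*} and both suprema are finite. -/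

import Mathlib

open MeasureTheory Set
open scoped ENNReal ContDiff RealInnerProductSpace

noncomputable section

namespace HDG

/-! ### Function spaces in space and time -/

/-- The physical space `ℝ^d` with its Euclidean norm. -/
abbrev Sp (d : ℕ) : Type := EuclideanSpace ℝ (Fin d)

/-- The Lebesgue space `L²(Ω; F)`. -/
abbrev L2 {d : ℕ} (Ω : Set (Sp d)) (F : Type) [NormedAddCommGroup F] : Type :=
  Lp F 2 (volume.restrict Ω)

/-- The Bochner-Sobolev space `W^{n,q}(0,T;X)`. An element is given by its continuous
representative on `[0,T]` as soon as `n ≥ 1`: membership in `W^{n+1,q}` means that `u` is the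
primitive of a function (its weak derivative) which lies in `W^{n,q}`. -/
def MemW {X : Type} [NormedAddCommGroup X] [NormedSpace ℝ X] (q : ℝ≥0∞) (T : ℝ) :
    ℕ → (ℝ → X) → Prop
  | 0, u => MemLp u q (volume.restrict (Ioc 0 T))
  | n + 1, u => MemLp u q (volume.restrict (Ioc 0 T)) ∧
      ∃ u' : ℝ → X, MemW q T n u' ∧ ∀ t ∈ Icc 0 T, u t = u 0 + ∫ s in (0 : ℝ)..t, u' s

/-- `W^{n,q}(0,T;V)` for a finite-dimensional space `V` on which no norm is singled out. -/
def MemWFin {V : Type} [AddCommGroup V] [Module ℝ V] (q : ℝ≥0∞) (T : ℝ) (n : ℕ)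
    (u : ℝ → V) : Prop :=
  ∀ l : V →ₗ[ℝ] ℝ, MemW q T n (fun t => l (u t))

/-- Time derivative on `[0,T]` (one-sided at the end points) of a function with values in a
normed space. -/
def timeDeriv {X : Type} [NormedAddCommGroup X] [NormedSpace ℝ X] (T : ℝ) (u : ℝ → X) (t : ℝ) : X :=
  derivWithin u (Icc 0 T) t

/-- Time derivative on `[0,T]` of a family of functions, taken pointwise in space. It is used for
piecewise polynomial functions only. -/
def pwTimeDeriv {I A X : Type} [NormedAddCommGroup X] [NormedSpace ℝ X] (T : ℝ)
    (u : ℝ → I → A → X) (t : ℝ) : I → A → X :=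
  fun i x => derivWithin (fun s => u s i x) (Icc 0 T) t

/-- The divergence of a (differentiable) vector field. -/
def divergence {d : ℕ} (r : Sp d → Sp d) (x : Sp d) : ℝ :=
  ∑ i : Fin d, (fderiv ℝ r x (EuclideanSpace.single i 1)) i

/-- Test functions: smooth with compact support contained in `Ω`. -/
def IsTest {d : ℕ} (Ω : Set (Sp d)) (w : Sp d → ℝ) : Prop :=
  ContDiff ℝ ∞ w ∧ HasCompactSupport w ∧ tsupport w ⊆ Ω

/-- `u ∈ H¹₀(Ω)` and `∇u = G`: the pair `(u, G)` is a limit in `L²(Ω) × L²(Ω)^d` of pairs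
`(w, ∇w)` with test functions `w`. -/
def MemH10 {d : ℕ} (Ω : Set (Sp d)) (u : Sp d → ℝ) (G : Sp d → Sp d) : Prop :=
  MemLp u 2 (volume.restrict Ω) ∧ MemLp G 2 (volume.restrict Ω) ∧
  ∀ ε : ℝ≥0∞, 0 < ε → ∃ w : Sp d → ℝ, IsTest Ω w ∧
    eLpNorm (fun x => u x - w x) 2 (volume.restrict Ω) < ε ∧
    eLpNorm (fun x => G x - gradient w x) 2 (volume.restrict Ω) < ε

/-- `g` is the weak divergence of `v` in `Ω`. -/
def HasWeakDiv {d : ℕ} (Ω : Set (Sp d)) (v : Sp d → Sp d) (g : Sp d → ℝ) : Prop :=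
  ∀ w : Sp d → ℝ, IsTest Ω w →
    ∫ x in Ω, ⟪v x, gradient w x⟫ = - ∫ x in Ω, g x * w x

/-- `(ψ, v)` is a solution on `Ω × (0,T)` of the Westervelt equation in mixed form
`(1 + 2k ψ_t) ψ_tt - c² ∇·v - δ ∇·v_t = 0`, `v = ∇ψ`, `ψ = 0` on `∂Ω`, `ψ(0) = ψ₀`, `ψ_t(0) = ψ₁`,
with `ψ ∈ W^{3,1}(0,T;H¹₀(Ω))` and `v ∈ W^{3,1}(0,T;H(div;Ω))`. -/
structure IsWesterveltSolution {d : ℕ} (Ω : Set (Sp d)) (k c δ T : ℝ) (ψ₀ ψ₁ : L2 Ω ℝ)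
    (ψ : ℝ → L2 Ω ℝ) (v : ℝ → L2 Ω (Sp d)) : Prop where
  reg_psi : MemW 1 T 3 ψ
  reg_v : MemW 1 T 3 v
  grad : ∀ t ∈ Icc 0 T, MemH10 Ω (ψ t) (v t)
  eqn : ∃ D : ℝ → L2 Ω ℝ, MemW 1 T 3 D ∧ (∀ t ∈ Icc 0 T, HasWeakDiv Ω (v t) (D t)) ∧
    ∀ t ∈ Ioo 0 T, ∀ᵐ x ∂(volume.restrict Ω),
      (1 + 2 * k * timeDeriv T ψ t x) * timeDeriv T (timeDeriv T ψ) t x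
        - c ^ 2 * D t x - δ * timeDeriv T D t x = 0
  init_psi : ψ 0 = ψ₀
  init_psi_t : timeDeriv T ψ 0 = ψ₁

/-! ### Meshes and polynomial spaces -/

/-- Polynomial functions on `ℝ^d` of total degree `< n`. Thus `P_p = polySpace d (p + 1)` and
`P_{p-1} = polySpace d p`, which is zero for `p = 0`. -/
def polySpace (d : ℕ) : ℕ → Submodule ℝ (Sp d → ℝ)
  | 0 => ⊥
  | n + 1 => (MvPolynomial.restrictTotalDegree (Fin d) ℝ n).map
      (LinearMap.pi fun x : Sp d => (MvPolynomial.aeval fun i => x i).toLinearMap)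

/-- Restriction of functions to a set, with extension by zero. -/
def restrictTo {d : ℕ} (S : Set (Sp d)) : (Sp d → ℝ) →ₗ[ℝ] (Sp d → ℝ) where
  toFun f := S.indicator f
  map_add' f g := Set.indicator_add S f g
  map_smul' a f := Set.indicator_const_smul S a f

/-- The closed simplex with the given vertices. -/
abbrev hull {d : ℕ} (s : Finset (Sp d)) : Set (Sp d) := convexHull ℝ (s : Set (Sp d))

/-- A conforming simplicial mesh of the polytopic set `Ω`: a finite simplicial complex whose union is the closure
of `Ω` and all of whose faces are faces of `d`-simplices. -/
structure Mesh {d : ℕ} (Ω : Set (Sp d)) where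
  complex : Geometry.SimplicialComplex ℝ (Sp d)
  finite : complex.faces.Finite
  space_eq : complex.space = closure Ω
  pure : ∀ s ∈ complex.faces, ∃ K ∈ complex.faces, s ⊆ K ∧ K.card = d + 1

/-- Outward unit normal of the simplex with vertices `K` on its facet with vertices `F`: the
normalized component, orthogonal to the facet, of the vector which joins the barycentre of `K` to
the barycentre of `F`. -/
def outwardNormal {d : ℕ} (K F : Finset (Sp d)) : Sp d :=
  let w := (vectorSpan ℝ (F : Set (Sp d)))ᗮ.starProjection
    (F.centroid ℝ id - K.centroid ℝ id)
  ‖w‖⁻¹ • w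

/-- Integral over a mesh facet with respect to the `(d-1)`-dimensional surface measure. -/
def facetIntegral {d : ℕ} (F : Finset (Sp d)) (g : Sp d → ℝ) : ℝ :=
  ∫ x in hull F, g x ∂(Measure.euclideanHausdorffMeasure (d - 1))

namespace Mesh

variable {d : ℕ} {Ω : Set (Sp d)} (M : Mesh Ω)

/-- The elements `K ∈ 𝒯_h`, given by their vertices. -/
def Elem : Type := {s : Finset (Sp d) // s ∈ M.complex.faces ∧ s.card = d + 1}

/-- The mesh facets `F ∈ ℱ_h`, given by their vertices. -/
def Facet : Type := {s : Finset (Sp d) // s ∈ M.complex.faces ∧ s.card = d}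

/-- Internal facets: those shared by two elements. All other facets lie on the boundary. -/
def IsInternal (F : M.Facet) : Prop :=
  ∃ K₁ K₂ : M.Elem, K₁ ≠ K₂ ∧ F.1 ⊆ K₁.1 ∧ F.1 ⊆ K₂.1

/-- The internal facets `F ∈ ℱ_h^ℐ`. -/
def IFacet : Type := {F : M.Facet // M.IsInternal F}

instance : Fintype M.Elem :=
  (M.finite.subset (fun _ hs => hs.1 : {s | s ∈ M.complex.faces ∧ s.card = d + 1} ⊆ _)).fintype

instance : Fintype M.Facet :=
  (M.finite.subset (fun _ hs => hs.1 : {s | s ∈ M.complex.faces ∧ s.card = d} ⊆ _)).fintype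

instance : Fintype M.IFacet := by
  classical
  exact inferInstanceAs (Fintype {F : M.Facet // M.IsInternal F})

open Classical in
/-- The facets of an element. -/
def facetsOf (K : M.Elem) : Finset M.Facet := {F | F.1 ⊆ K.1}

open Classical in
/-- The internal facets of an element; their union is `(∂K)^ℐ`. -/
def iFacetsOf (K : M.Elem) : Finset M.IFacet := {F | F.1.1 ⊆ K.1}

open Classical in
/-- The boundary facets of an element; their union is `(∂K)^𝒟`. -/
def bFacetsOf (K : M.Elem) : Finset M.Facet := {F | F.1 ⊆ K.1 ∧ ¬ M.IsInternal F}

open Classical in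
/-- The elements which contain an internal facet. -/
def elemsOf (F : M.IFacet) : Finset M.Elem := {K | F.1.1 ⊆ K.1}

/-- The space `S_p = ∏_K P_p(K)`. A polynomial on `K` is identified with the polynomial function
on `ℝ^d` that extends it. -/
abbrev SSpace (p : ℕ) : Type := M.Elem → polySpace d (p + 1)

/-- The space `Q_p = ∏_K P_p(K)^d`. -/
abbrev QSpace (p : ℕ) : Type := M.Elem → Fin d → polySpace d (p + 1)

/-- The space `M_p = ∏_{F internal} P_p(F)`; functions on a facet are extended by zero. -/
abbrev MSpace (p : ℕ) : Type :=
  (F : M.IFacet) → (polySpace d (p + 1)).map (restrictTo (hull F.1.1))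

variable {M}

/-- The broken function that is given by an element of `S_p`. -/
def sFun {p : ℕ} (w : M.SSpace p) : M.Elem → Sp d → ℝ :=
  fun K x => (w K : Sp d → ℝ) x

/-- The broken vector field that is given by an element of `Q_p`. -/
def qFun {p : ℕ} (r : M.QSpace p) : M.Elem → Sp d → Sp d :=
  fun K x => WithLp.toLp 2 fun i => (r K i : Sp d → ℝ) x

/-- The function on the internal skeleton that is given by an element of `M_p`. -/
def mFun {p : ℕ} (l : M.MSpace p) : M.IFacet → Sp d → ℝ :=
  fun F x => (l F : Sp d → ℝ) x

/-- The function on `Ω` with given restrictions to the (open) elements. -/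
def glue {X : Type} [AddCommMonoid X] (u : M.Elem → Sp d → X) (x : Sp d) : X :=
  ∑ K : M.Elem, (interior (hull K.1)).indicator (u K) x

open Classical in
/-- The class in `L²(Ω)` of a broken function. The default value is never used for
piecewise polynomial functions, since `Ω` is bounded. -/
def toL2 {X : Type} [NormedAddCommGroup X] (u : M.Elem → Sp d → X) : L2 Ω X :=
  if h : MemLp (glue u) 2 (volume.restrict Ω) then h.toLp (glue u) else 0

/-! ### Bilinear forms -/

/-- `m_h(ψ, w) = (ψ, w)_{𝒯_h}` -/
def mForm (ψ w : M.Elem → Sp d → ℝ) : ℝ :=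
  ∑ K : M.Elem, ∫ x in hull K.1, ψ K x * w K x

/-- `𝐦_h(v, r) = (v, r)_{𝒯_h}` -/
def mvForm (v r : M.Elem → Sp d → Sp d) : ℝ :=
  ∑ K : M.Elem, ∫ x in hull K.1, ⟪v K x, r K x⟫

/-- `b_h(ψ, r) = (ψ, ∇·r)_{𝒯_h}` -/
def bForm (ψ : M.Elem → Sp d → ℝ) (r : M.Elem → Sp d → Sp d) : ℝ :=
  ∑ K : M.Elem, ∫ x in hull K.1, ψ K x * divergence (r K) x

/-- `s_h(ψ, w) = (τ ψ, w)_{∂𝒯_h}` -/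
def sForm (τ : M.Elem → M.Facet → ℝ) (ψ w : M.Elem → Sp d → ℝ) : ℝ :=
  ∑ K : M.Elem, ∑ F ∈ M.facetsOf K, facetIntegral F.1 fun x => τ K F * ψ K x * w K x

/-- The normal jump `[r]` on an internal facet. -/
def jump (r : M.Elem → Sp d → Sp d) (F : M.IFacet) (x : Sp d) : ℝ :=
  ∑ K ∈ M.elemsOf F, ⟪r K x, outwardNormal K.1 F.1.1⟫

/-- `e_h(λ, r) = -(λ, [r])_{ℱ_h^ℐ}` -/
def eForm (l : M.IFacet → Sp d → ℝ) (r : M.Elem → Sp d → Sp d) : ℝ :=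
  - ∑ F : M.IFacet, facetIntegral F.1.1 fun x => l F x * jump r F x

/-- `f_h(λ, w) = -(τ λ, w)_{(∂𝒯_h)^ℐ}` -/
def fForm (τ : M.Elem → M.Facet → ℝ) (l : M.IFacet → Sp d → ℝ) (w : M.Elem → Sp d → ℝ) : ℝ :=
  - ∑ K : M.Elem, ∑ F ∈ M.iFacetsOf K, facetIntegral F.1.1 fun x => τ K F.1 * l F x * w K x

/-- `g_h(λ, μ) = (τ λ, μ)_{(∂𝒯_h)^ℐ}` -/
def gForm (τ : M.Elem → M.Facet → ℝ) (l μ : M.IFacet → Sp d → ℝ) : ℝ :=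
  ∑ K : M.Elem, ∑ F ∈ M.iFacetsOf K, facetIntegral F.1.1 fun x => τ K F.1 * l F x * μ F x

open Classical in
variable (M) in
/-- The single-facet stabilization function: `τ̄` on the facet `Fτ K` of `K`, zero on the other
facets of `K`. -/
def singleFacet (τbar : ℝ) (Fτ : M.Elem → M.Facet) (K : M.Elem) (F : M.Facet) : ℝ :=
  if F = Fτ K then τbar else 0

/-! ### The linearized semidiscrete formulation -/

/-- `(ψ_h, v_h, λ_h)` solves the linearized semidiscrete HDG formulation with coefficient `α_h`,
without forcing and without perturbation. Here `ũ = u + (δ/c²) u_t`. -/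
structure IsSemidiscreteSolution {p : ℕ} (τ : M.Elem → M.Facet → ℝ) (k c δ T : ℝ)
    (αh : ℝ → M.SSpace p) (ψh : ℝ → M.SSpace p) (vh : ℝ → M.QSpace p) (lh : ℝ → M.MSpace p) :
    Prop where
  reg_psi : MemWFin 1 T 3 ψh
  reg_v : MemWFin 1 T 3 vh
  reg_l : MemWFin 1 T 3 lh
  eq₁ : ∀ t ∈ Ioc 0 T, ∀ r : M.QSpace p,
    mvForm (qFun (vh t)) (qFun r) + bForm (sFun (ψh t)) (qFun r) + eForm (mFun (lh t)) (qFun r) = 0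
  eq₂ : ∀ t ∈ Ioc 0 T, ∀ w : M.SSpace p,
    mForm (fun K x => (1 + 2 * k * sFun (αh t) K x)
        * pwTimeDeriv T (pwTimeDeriv T fun s => sFun (ψh s)) t K x) (sFun w)
      - c ^ 2 * bForm (sFun w)
          (fun K x => qFun (vh t) K x + (δ / c ^ 2) • pwTimeDeriv T (fun s => qFun (vh s)) t K x)
      + c ^ 2 * sForm τ
          (fun K x => sFun (ψh t) K x + δ / c ^ 2 * pwTimeDeriv T (fun s => sFun (ψh s)) t K x)
          (sFun w)
      + c ^ 2 * fForm τ
          (fun F x => mFun (lh t) F x + δ / c ^ 2 * pwTimeDeriv T (fun s => mFun (lh s)) t F x)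
          (sFun w) = 0
  eq₃ : ∀ t ∈ Ioc 0 T, ∀ μ : M.MSpace p,
    - eForm (mFun μ) (qFun (vh t)) + fForm τ (mFun μ) (sFun (ψh t))
      + gForm τ (mFun (lh t)) (mFun μ) = 0

/-- The common form of the discrete energies:
`½ ‖√(1+2kα) ζ‖² + (c²/2) (‖v‖² + ‖√τ (λ - ψ)‖²_{(∂𝒯_h)^ℐ} + ‖√τ ψ‖²_{(∂𝒯_h)^𝒟})`. -/
def energy (τ : M.Elem → M.Facet → ℝ) (k c : ℝ) (α ζ ψ : M.Elem → Sp d → ℝ)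
    (v : M.Elem → Sp d → Sp d) (l : M.IFacet → Sp d → ℝ) : ℝ :=
  1 / 2 * (∑ K : M.Elem, ∫ x in hull K.1, (√(1 + 2 * k * α K x) * ζ K x) ^ 2)
    + c ^ 2 / 2 * ((∑ K : M.Elem, ∫ x in hull K.1, ‖v K x‖ ^ 2)
      + (∑ K : M.Elem, ∑ F ∈ M.iFacetsOf K,
          facetIntegral F.1.1 fun x => (√(τ K F.1) * (l F x - ψ K x)) ^ 2)
      + ∑ K : M.Elem, ∑ F ∈ M.bFacetsOf K,
          facetIntegral F.1 fun x => (√(τ K F) * ψ K x) ^ 2)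

/-- The low-order energy `ℰ_h^{(0)}[ψ, v, λ](t)`. -/
def energy₀ (τ : M.Elem → M.Facet → ℝ) (k c T : ℝ) (α ψ : ℝ → M.Elem → Sp d → ℝ)
    (v : ℝ → M.Elem → Sp d → Sp d) (l : ℝ → M.IFacet → Sp d → ℝ) (t : ℝ) : ℝ :=
  energy τ k c (α t) (pwTimeDeriv T ψ t) (ψ t) (v t) (l t)

/-- The high-order energy `ℰ_h^{(1)}[ψ, v, λ](t)`. -/
def energy₁ (τ : M.Elem → M.Facet → ℝ) (k c T : ℝ) (α ψ : ℝ → M.Elem → Sp d → ℝ)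
    (v : ℝ → M.Elem → Sp d → Sp d) (l : ℝ → M.IFacet → Sp d → ℝ) (t : ℝ) : ℝ :=
  energy τ k c (α t) (pwTimeDeriv T (pwTimeDeriv T ψ) t) (pwTimeDeriv T ψ t)
    (pwTimeDeriv T v t) (pwTimeDeriv T l t)

/-! ### Traces and projections -/

/-- `u ∈ H¹(K)` with trace `γ ∈ L²(∂K)`: the integration by parts formula
`∫_K u ∇·φ + ∇u·φ = ∫_{∂K} γ φ·n_K` holds for all smooth vector fields `φ`. -/
def HasTrace (K : M.Elem) (u γ : Sp d → ℝ) : Prop :=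
  MemLp u 2 (volume.restrict (hull K.1)) ∧
  (∀ F ∈ M.facetsOf K,
    MemLp γ 2 ((Measure.euclideanHausdorffMeasure (d - 1)).restrict (hull F.1))) ∧
  ∃ G : Sp d → Sp d, MemLp G 2 (volume.restrict (hull K.1)) ∧
    ∀ φ : Sp d → Sp d, ContDiff ℝ ∞ φ →
      ∫ x in hull K.1, (u x * divergence φ x + ⟪G x, φ x⟫)
        = ∑ F ∈ M.facetsOf K, facetIntegral F.1 fun x => γ x * ⟪φ x, outwardNormal K.1 F.1⟫

/-- `m = Π_M ψ ∈ M_p`: the `L²`-orthogonal projection on the internal skeleton. -/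
def IsSkeletonProjection {p : ℕ} (ψ : Sp d → ℝ) (m : M.MSpace p) : Prop :=
  ∃ γ : M.Elem → Sp d → ℝ, (∀ K, HasTrace K ψ (γ K)) ∧
    ∀ μ : M.MSpace p, ∑ K : M.Elem, ∑ F ∈ M.iFacetsOf K,
      facetIntegral F.1.1 (fun x => (mFun m F x - γ K x) * mFun μ F x) = 0

/-- `(ρ, q) = (Π_S ψ, Π_Q v) ∈ S_p × Q_p`: the HDG projection of `(ψ, v) ∈ H¹(𝒯_h) × H¹(𝒯_h)^d`.
On every facet `F` of `K` the polynomial `m F` is the `L²(F)`-projection of the trace of `ψ`. -/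
def IsHDGProjection {p : ℕ} (τ : M.Elem → M.Facet → ℝ) (ψ : Sp d → ℝ) (v : Sp d → Sp d)
    (ρ : M.SSpace p) (q : M.QSpace p) : Prop :=
  ∀ K : M.Elem, ∃ (γψ : Sp d → ℝ) (γv : Sp d → Sp d) (m : M.Facet → Sp d → ℝ),
    HasTrace K ψ γψ ∧ (∀ i, HasTrace K (fun x => v x i) (fun x => γv x i)) ∧
    (∀ F ∈ M.facetsOf K, m F ∈ polySpace d (p + 1) ∧
      ∀ μ ∈ polySpace d (p + 1), facetIntegral F.1 (fun x => (m F x - γψ x) * μ x) = 0) ∧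
    (∀ i, ∀ r ∈ polySpace d p, ∫ x in hull K.1, (qFun q K x i - v x i) * r x = 0) ∧
    (∀ w ∈ polySpace d p, ∫ x in hull K.1, (sFun ρ K x - ψ x) * w x = 0) ∧
    ∀ F ∈ M.facetsOf K, ∀ μ ∈ polySpace d (p + 1),
      facetIntegral F.1 (fun x =>
        (⟪qFun q K x, outwardNormal K.1 F.1⟫ - τ K F * (sFun ρ K x - m F x)
          - ⟪γv x, outwardNormal K.1 F.1⟫) * μ x) = 0

/-- `z = Π₀ f ∈ S_p`: the `L²(Ω)`-orthogonal projection. -/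
def IsL2Projection {p : ℕ} (f : Sp d → ℝ) (z : M.SSpace p) : Prop :=
  ∀ w : M.SSpace p, mForm (sFun z) (sFun w) = mForm (fun _ => f) (sFun w)

/-- The weighted norm `‖√(1+2kα) g‖²` in `L²(Ω)`. -/
def weightedSq (k : ℝ) (α : M.Elem → Sp d → ℝ) (g : L2 Ω ℝ) : ℝ :=
  ∫ x in Ω, (√(1 + 2 * k * glue α x) * g x) ^ 2

end Mesh

end HDG

end

/-!
The errors split as `e = η - δ`, where `η` is the discrete error (projection minus discrete
solution) and `δ` the projection error. As `(a - b)² ≤ 2 a² + 2 b²` (`error_le`), it suffices to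
bound the energy of `η` on the whole time interval.

*Error equations.* The HDG projection is made for the method: it satisfies the discrete equations,
up to the term `(δ_v, r)` in the equation for the flux (`flux_projection_eq`,
`divergence_projection_eq`, `skeleton_projection_eq`). This needs integration by parts on each
element, the vanishing of the trace of an `H¹₀` function on boundary facets, and the cancellation
of the normal traces of an `H(div)` field on the two sides of an internal facet. All three are
drawn from the divergence theorem for polynomials and smooth fields on a simplex
(`integral_divergence_simplex`). There the field is decomposed along the directions `x - a`, `a` a
vertex, and for `u • (x - a)` the theorem is the computation of an integral over the cone with
apex `a` on the opposite facet. The differences `η` then solve the equations of the method with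
data `δ_v` and `φ̂` (`isErrorSolution`).

*Regularity in time.* The projections are only given at each time, but the equations are
differentiated in time. A polynomial is determined by its moments of lower degree and by its
moments on the one facet where the stabilization is positive (`eq_zero_of_moments`), so
`Π_S ψ` solves an injective linear system with data that are bounded functionals of the exact
solution. Hence it inherits its regularity (`memWFin_potential_projection`), and so do the other
projections.

*Energy estimate.* Testing the error equations gives at almost every time an inequality
`E' ≤ β E + H` for the energy `E` of `η` or of its time derivative, where `β` is controlled by
`∂ₜ α_h` and `H` by the data (`energy_rate_le`). The constants are those of Young's inequality
with weight `γ₀ / T`. The smallness assumption says that `∫ β ≤ σ₀ < 1`, so integrating up to a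
time at which `E` is maximal allows `max E · ∫ β` to be absorbed, without Grönwall's inequality
(`le_of_ae_deriv_le`, `discreteEnergy_le`).
-/

noncomputable section

namespace HDG

set_option linter.unusedSectionVars false

/-! ### The divergence theorem on simplices -/

section Cone
open scoped Pointwise
variable {E : Type*} [NormedAddCommGroup E] [InnerProductSpace ℝ E] [FiniteDimensional ℝ E]
  [MeasurableSpace E] [BorelSpace E]

/-- Coordinates on `E` with origin `a`: the component along the unit vector `ν` and the component
in the hyperplane orthogonal to it. -/
def normalCoord (a ν : E) (hν : ‖ν‖ = 1) : ℝ × (ℝ ∙ ν)ᗮ ≃ᵐ E :=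
  (MeasurableEquiv.prodCongr
    (LinearIsometryEquiv.toSpanUnitSingleton ν hν).toHomeomorph.toMeasurableEquiv
    (MeasurableEquiv.refl _)).trans ((ℝ ∙ ν).measurableEquivProd a).symm

lemma normalCoord_apply (a ν : E) (hν : ‖ν‖ = 1) (q : ℝ × (ℝ ∙ ν)ᗮ) :
    normalCoord a ν hν q = q.1 • ν + q.2 + a := by
  simp [normalCoord, MeasurableEquiv.prodCongr]

lemma continuous_normalCoord (a ν : E) (hν : ‖ν‖ = 1) : Continuous (normalCoord a ν hν) := by
  have : (normalCoord a ν hν : ℝ × (ℝ ∙ ν)ᗮ → E) = fun q => q.1 • ν + (q.2 : E) + a :=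
    funext fun q => normalCoord_apply a ν hν q
  rw [this]
  fun_prop

lemma isometry_normalCoord (a ν : E) (hν : ‖ν‖ = 1) (h : ℝ) :
    Isometry (fun y : (ℝ ∙ ν)ᗮ => normalCoord a ν hν (h, y)) := by
  refine Isometry.of_dist_eq fun y z => ?_
  simp only [normalCoord_apply, dist_add_right, dist_add_left]
  rfl

lemma measurePreserving_normalCoord (a ν : E) (hν : ‖ν‖ = 1) :
    MeasurePreserving (normalCoord a ν hν) volume volume := by
  have h1 := ((ℝ ∙ ν).measurePreserving_measurableEquivProd a).symm
  rw [InnerProductSpace.euclideanHausdorffMeasure_eq_volume] at h1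
  have h2 := (LinearIsometryEquiv.toSpanUnitSingleton ν hν).measurePreserving
  exact h1.comp (h2.prod (MeasurePreserving.id (volume : Measure (ℝ ∙ ν)ᗮ)))

lemma finrank_orthogonal_unit {n : ℕ} (hn : Module.finrank ℝ E = n + 1) (ν : E) (hν : ‖ν‖ = 1) :
    Module.finrank ℝ (ℝ ∙ ν)ᗮ = n := by
  have : ν ≠ 0 := by rintro rfl; simp at hν
  have h1 := finrank_span_singleton (K := ℝ) this
  have h2 := (ℝ ∙ ν).finrank_add_finrank_orthogonal
  omega

lemma inner_orthogonal_unit (ν : E) (y : (ℝ ∙ ν)ᗮ) : ⟪ν, (y : E)⟫ = 0 :=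
  Submodule.mem_orthogonal_singleton_iff_inner_right.1 y.2

lemma inner_normalCoord (a ν : E) (hν : ‖ν‖ = 1) (q : ℝ × (ℝ ∙ ν)ᗮ) :
    ⟪ν, normalCoord a ν hν q - a⟫ = q.1 := by
  rw [normalCoord_apply, add_sub_cancel_right, inner_add_right, inner_orthogonal_unit,
    inner_smul_right, real_inner_self_eq_norm_sq, hν]
  simp

/-- On a hyperplane the surface measure is the Lebesgue measure of the hyperplane. -/
lemma setIntegral_hyperplane {n : ℕ} (hn : Module.finrank ℝ E = n + 1) (a ν : E) (hν : ‖ν‖ = 1)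
    (h : ℝ) (F : Set E) (hF : ∀ x ∈ F, ⟪ν, x - a⟫ = h) (u : E → ℝ) :
    ∫ x in F, u x ∂(μHE[n] : Measure E) =
      ∫ y in (fun y => normalCoord a ν hν (h, y)) ⁻¹' F, u (normalCoord a ν hν (h, y)) := by
  have hi := isometry_normalCoord a ν hν h
  have hmap := hi.map_euclideanHausdorffMeasure (d := n)
  have hvol : (μHE[n] : Measure (ℝ ∙ ν)ᗮ) = volume := by
    have := InnerProductSpace.euclideanHausdorffMeasure_eq_volume (V := (ℝ ∙ ν)ᗮ)
    rwa [finrank_orthogonal_unit hn ν hν] at this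
  have hsub : F ⊆ range (fun y : (ℝ ∙ ν)ᗮ => normalCoord a ν hν (h, y)) := by
    intro x hx
    refine ⟨((normalCoord a ν hν).symm x).2, ?_⟩
    have h1 := inner_normalCoord a ν hν ((normalCoord a ν hν).symm x)
    rw [MeasurableEquiv.apply_symm_apply, hF x hx] at h1
    simp [h1]
  rw [← hvol, ← hi.isClosedEmbedding.measurableEmbedding.setIntegral_map, hmap,
    Measure.restrict_restrict_of_subset hsub]

/-- The divergence theorem for the field `u • (x - a)` on a cone with apex `a`, height `h` and base
`F`: this field is tangential to the lateral surface, and its normal component on the base is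
`h * u`. -/
theorem integral_cone {n : ℕ} (hn : Module.finrank ℝ E = n + 1) (a ν : E) (hν : ‖ν‖ = 1)
    {h : ℝ} (hh : 0 < h) {F K : Set E} (hFc : IsCompact F) (hF : ∀ x ∈ F, ⟪ν, x - a⟫ = h)
    (hKc : IsCompact K) (hK : ∀ x, x ∈ K ↔ ∃ s ∈ Icc (0 : ℝ) 1, ∃ y ∈ F, x = a + s • (y - a))
    {u : E → ℝ} (hu : ContDiff ℝ 1 u) :
    ∫ x in K, ((n + 1) * u x + fderiv ℝ u x (x - a)) = h * ∫ x in F, u x ∂(μHE[n] : Measure E) := by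
  set J := normalCoord a ν hν with hJ
  set f : E → ℝ := fun x => (n + 1) * u x + fderiv ℝ u x (x - a) with hf
  set F' : Set (ℝ ∙ ν)ᗮ := (fun y => J (h, y)) ⁻¹' F with hF'
  have hJc : Continuous J := continuous_normalCoord a ν hν
  have hfc : Continuous f := by
    have := hu.continuous_fderiv one_ne_zero
    have := hu.continuous
    fun_prop
  have hi : Isometry (fun y : (ℝ ∙ ν)ᗮ => J (h, y)) := isometry_normalCoord a ν hν h
  have hF'c : IsCompact F' := hi.isClosedEmbedding.isCompact_preimage hFc
  -- the slices of the cone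
  have hslice : ∀ s ∈ Ioc 0 h, {y | J (s, y) ∈ K} = (s / h) • F' := by
    intro s hs
    have hsh : 0 < s / h := div_pos hs.1 hh
    ext y
    rw [mem_smul_set_iff_inv_smul_mem₀ hsh.ne']
    simp only [mem_ofPred_eq, hF', mem_preimage, hK]
    have key : J (s, y) = a + (s / h) • (J (h, (s / h)⁻¹ • y) - a) := by
      simp only [hJ, normalCoord_apply, Submodule.coe_smul, smul_add, add_sub_cancel_right, smul_smul]
      rw [mul_inv_cancel₀ hsh.ne', div_mul_cancel₀ _ hh.ne', one_smul, add_comm]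
    constructor
    · rintro ⟨r, hr, z, hz, hzy⟩
      have h1 : s = r * h := by
        have := inner_normalCoord a ν hν (s, y)
        rw [← hJ, hzy, add_sub_cancel_left, inner_smul_right, hF z hz] at this
        exact this.symm
      have hr' : r = s / h := by rw [h1]; field_simp
      rw [key, hr'] at hzy
      have := smul_right_injective E hsh.ne' (add_left_cancel hzy)
      rw [sub_left_inj] at this
      rwa [this]
    · intro hy
      exact ⟨s / h, ⟨hsh.le, (div_le_one hh).2 hs.2⟩, _, hy, key⟩
  have hout : ∀ s, s ∉ Icc 0 h → {y | J (s, y) ∈ K} = ∅ := by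
    intro s hs
    rw [eq_empty_iff_forall_notMem]
    intro y hy
    obtain ⟨r, hr, z, hz, hzy⟩ := (hK _).1 hy
    apply hs
    have := inner_normalCoord a ν hν (s, y)
    rw [← hJ, hzy, add_sub_cancel_left, inner_smul_right, hF z hz] at this
    simp only at this
    rw [← this]
    exact ⟨by nlinarith [hr.1], by nlinarith [hr.2]⟩
  have hmp := measurePreserving_normalCoord a ν hν
  rw [← hJ] at hmp
  have hint : IntegrableOn f K := hfc.continuousOn.integrableOn_compact hKc
  have hint' : IntegrableOn (fun q => f (J q)) (J ⁻¹' K) (volume.prod volume) :=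
    (hmp.integrableOn_comp_preimage J.measurableEmbedding).2 hint
  have hKm : MeasurableSet (J ⁻¹' K) := J.measurable hKc.measurableSet
  -- the slice at height `s` is scaled to the base, with Jacobian `(s / h) ^ n`
  have step1 : ∫ x in K, f x = ∫ s in Ioc 0 h, ∫ y in F', (s / h) ^ n * f (J (s, (s / h) • y)) := by
    rw [← hmp.setIntegral_preimage_emb J.measurableEmbedding, ← integral_indicator hKm]
    rw [Measure.volume_eq_prod, integral_prod _ ((integrable_indicator_iff hKm).2 hint')]
    rw [← integral_indicator measurableSet_Ioc]
    have h0 : ∀ᵐ s : ℝ, s ≠ 0 := by simp [ae_iff, measure_singleton]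
    refine integral_congr_ae (h0.mono fun s hs0 => ?_)
    dsimp only
    have e1 : ∀ y, (J ⁻¹' K).indicator (fun q => f (J q)) (s, y)
        = {y | J (s, y) ∈ K}.indicator (fun y => f (J (s, y))) y := fun y => rfl
    simp only [e1]
    by_cases hs : s ∈ Ioc 0 h
    · rw [indicator_of_mem hs, hslice s hs]
      have hsh : 0 < s / h := div_pos hs.1 hh
      have hmeas : MeasurableSet ((s / h) • F') := (hF'c.smul (s / h)).measurableSet
      rw [integral_indicator hmeas]
      have := Measure.setIntegral_comp_smul (volume : Measure (ℝ ∙ ν)ᗮ)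
        (fun y => f (J (s, y))) F' hsh.ne'
      rw [finrank_orthogonal_unit hn ν hν] at this
      rw [integral_const_mul, this, abs_of_pos (by positivity), smul_eq_mul, ← mul_assoc,
        mul_inv_cancel₀ (by positivity), one_mul]
    · rw [indicator_of_notMem hs, hout s, indicator_empty, integral_zero]
      exact fun h' => hs ⟨lt_of_le_of_ne h'.1 hs0.symm, h'.2⟩
  have hH : Continuous fun q : ℝ × (ℝ ∙ ν)ᗮ => (q.1 / h) ^ n * f (J (q.1, (q.1 / h) • q.2)) := by
    fun_prop
  have hHint : Integrable (Function.uncurry fun (s : ℝ) (y : (ℝ ∙ ν)ᗮ) =>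
      (s / h) ^ n * f (J (s, (s / h) • y)))
      ((volume.restrict (Ioc 0 h)).prod (volume.restrict F')) := by
    rw [Measure.prod_restrict]
    exact (hH.continuousOn.integrableOn_compact (isCompact_Icc.prod hF'c)).mono_set
      (prod_mono Ioc_subset_Icc_self subset_rfl)
  -- along the ray through a point of the base the integrand is the derivative of
  -- `h * (s / h) ^ (n + 1) * u`
  have step2 : ∀ y, ∫ s in Ioc 0 h, (s / h) ^ n * f (J (s, (s / h) • y)) = h * u (J (h, y)) := by
    intro y
    set w : E := h • ν + y with hw
    have hJw : ∀ s, J (s, (s / h) • y) = a + (s / h) • w := by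
      intro s
      simp only [hJ, normalCoord_apply, Submodule.coe_smul, hw, smul_add, smul_smul]
      rw [div_mul_cancel₀ _ hh.ne']
      abel
    have hder : ∀ s ∈ uIcc 0 h, HasDerivAt (fun s => h * ((s / h) ^ (n + 1) * u (a + (s / h) • w)))
        ((s / h) ^ n * f (J (s, (s / h) • y))) s := by
      intro s _
      have d1 : HasDerivAt (fun s : ℝ => s / h) (1 / h) s := (hasDerivAt_id s).div_const h
      have d2 : HasDerivAt (fun s : ℝ => a + (s / h) • w) ((1 / h) • w) s :=
        (d1.smul_const w).const_add a
      have d3 := (hu.differentiable one_ne_zero (a + (s / h) • w)).hasFDerivAt.comp_hasDerivAt s d2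
      have d4 := ((d1.fun_pow (n + 1)).mul d3).const_mul h
      convert! d4 using 1
      simp only [hJw, hf, add_sub_cancel_left, map_smul, smul_eq_mul, Function.comp_apply]
      push_cast
      generalize s / h = r
      rw [pow_succ]
      field_simp
    rw [← intervalIntegral.integral_of_le hh.le,
      intervalIntegral.integral_eq_sub_of_hasDerivAt hder]
    · rw [← hJw h, div_self hh.ne']; simp
    · refine Continuous.intervalIntegrable ?_ _ _
      fun_prop
  rw [step1, integral_integral_swap hHint]
  simp only [step2]
  rw [integral_const_mul, setIntegral_hyperplane hn a ν hν h F hF]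

end Cone

section Simplex
variable {n : ℕ}

/-- For a simplex `K` with a vertex `a`, the outward unit normal of the opposite facet is a unit
vector, and the height of `a` over that facet is positive. -/
lemma outwardNormal_spec {K : Finset (Sp (n + 1))}
    (hK : AffineIndependent ℝ ((↑) : K → Sp (n + 1))) (hc : K.card = n + 2) {a : Sp (n + 1)}
    (ha : a ∈ K) :
    ‖outwardNormal K (K.erase a)‖ = 1 ∧
      ∃ h : ℝ, 0 < h ∧ ∀ x ∈ hull (K.erase a), ⟪outwardNormal K (K.erase a), x - a⟫ = h := by
  classical
  set F := K.erase a with hF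
  have hFc : F.card = n + 1 := by rw [hF, Finset.card_erase_of_mem ha, hc]; rfl
  set V := vectorSpan ℝ (F : Set (Sp (n + 1))) with hV
  set w : Sp (n + 1) := Vᗮ.starProjection (F.centroid ℝ id - K.centroid ℝ id) with hw
  have hν : outwardNormal K F = ‖w‖⁻¹ • w := rfl
  have hcen : ∀ S : Finset (Sp (n + 1)), S.Nonempty →
      S.centroid ℝ id = (S.card : ℝ)⁻¹ • ∑ x ∈ S, x := by
    intro S hS
    rw [Finset.centroid_def, Finset.affineCombination_eq_linear_combination]
    · simp [Finset.centroidWeights_apply, Finset.smul_sum]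
    · exact Finset.sum_centroidWeights_eq_one_of_nonempty ℝ S hS
  have hFne : F.Nonempty := Finset.card_pos.1 (by omega)
  have hKne : K.Nonempty := ⟨a, ha⟩
  obtain ⟨y, hy⟩ := hFne
  -- the barycentre vector is a multiple of the vector from the apex to the facet barycentre
  have hdiff : ((n : ℝ) + 2) • (F.centroid ℝ id - K.centroid ℝ id) = F.centroid ℝ id - a := by
    rw [hcen F ⟨y, hy⟩, hcen K hKne, hFc, hc, ← Finset.add_sum_erase K (fun x => x) ha, ← hF]
    generalize ∑ x ∈ F, x = S
    push_cast
    have h1 : (n : ℝ) + 1 ≠ 0 := by positivity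
    have h2 : (n : ℝ) + 2 ≠ 0 := by positivity
    rw [smul_sub, smul_smul, smul_smul, mul_inv_cancel₀ h2, one_smul]
    have : ((n : ℝ) + 2) * ((n : ℝ) + 1)⁻¹ = ((n : ℝ) + 1)⁻¹ + 1 := by field_simp; ring
    rw [this, add_smul]
    module
  have hproj : ∀ x ∈ F, Vᗮ.starProjection (x - a) = ((n : ℝ) + 2) • w := by
    intro x hx
    rw [hw, ← map_smul, hdiff, ← sub_eq_zero, ← map_sub, sub_sub_sub_cancel_right,
      Submodule.starProjection_apply_eq_zero_iff, Submodule.orthogonal_orthogonal]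
    have hx' : x ∈ affineSpan ℝ (F : Set (Sp (n + 1))) := subset_affineSpan ℝ _ hx
    have hc' : F.centroid ℝ id ∈ affineSpan ℝ (F : Set (Sp (n + 1))) :=
      convexHull_subset_affineSpan _ (F.centroid_mem_convexHull ⟨y, hy⟩)
    rw [hV, ← direction_affineSpan]
    exact AffineSubspace.vsub_mem_direction hx' hc'
  have hw0 : w ≠ 0 := by
    intro h0
    have h1 := hproj y hy
    rw [h0, smul_zero, Submodule.starProjection_apply_eq_zero_iff,
      Submodule.orthogonal_orthogonal, hV, ← direction_affineSpan] at h1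
    have hy' : y ∈ affineSpan ℝ (F : Set (Sp (n + 1))) := subset_affineSpan ℝ _ hy
    have h2 : a ∈ affineSpan ℝ (F : Set (Sp (n + 1))) := by
      have := AffineSubspace.vadd_mem_of_mem_direction (Submodule.neg_mem _ h1) hy'
      simpa using this
    refine hK.notMem_affineSpan_sdiff ⟨a, ha⟩ univ ?_
    convert! h2 using 2
    ext x
    simp [hF, and_comm]
  have hwn : 0 < ‖w‖ := norm_pos_iff.2 hw0
  have hwV : w ∈ Vᗮ := by rw [hw]; exact Submodule.starProjection_apply_mem _ _
  refine ⟨by rw [hν, norm_smul, norm_inv, norm_norm, inv_mul_cancel₀ hwn.ne'],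
    (n + 2) * ‖w‖, by positivity, ?_⟩
  have hvert : ∀ x ∈ F, ⟪outwardNormal K F, x - a⟫ = (n + 2) * ‖w‖ := by
    intro x hx
    have h1 : ⟪w, x - a⟫ = ⟪w, Vᗮ.starProjection (x - a)⟫ := by
      rw [← Submodule.inner_starProjection_left_eq_right, (Submodule.starProjection_eq_self_iff).2 hwV]
    rw [hν, inner_smul_left, h1, hproj x hx, inner_smul_right, real_inner_self_eq_norm_sq]
    simp only [map_inv₀, conj_trivial]
    field_simp
  have hconv : Convex ℝ {x : Sp (n + 1) | ⟪outwardNormal K F, x - a⟫ = (n + 2) * ‖w‖} := by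
    intro x hx y hy s t hs ht hst
    simp only [mem_ofPred_eq] at hx hy ⊢
    have : s • x + t • y - a = s • (x - a) + t • (y - a) := by
      rw [smul_sub, smul_sub]
      nth_rewrite 1 [← one_smul ℝ a]
      rw [← hst]
      module
    rw [this, inner_add_right, inner_smul_right, inner_smul_right, hx, hy, ← add_mul, hst, one_mul]
  exact fun x hx => (convexHull_min (𝕜 := ℝ) (s := (F : Set (Sp (n + 1)))) hvert hconv) hx

lemma isCompact_hull {d : ℕ} (s : Finset (Sp d)) : IsCompact (hull s) :=
  (s.finite_toSet).isCompact_convexHull ℝ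

/-- A simplex is the cone over any of its facets with apex the opposite vertex. -/
lemma mem_hull_iff_cone {d : ℕ} {K : Finset (Sp d)} {a : Sp d} (ha : a ∈ K)
    (hne : (K.erase a).Nonempty) (x : Sp d) :
    x ∈ hull K ↔ ∃ s ∈ Icc (0 : ℝ) 1, ∃ y ∈ hull (K.erase a), x = a + s • (y - a) := by
  classical
  have hKe : (K : Set (Sp d)) = insert a (K.erase a : Set (Sp d)) := by
    rw [← Finset.coe_insert, Finset.insert_erase ha]
  rw [hull, hKe, convexHull_insert (by exact_mod_cast hne), convexJoin_singleton_left]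
  simp only [mem_iUnion, segment_eq_image', mem_image, exists_prop]
  constructor
  · rintro ⟨y, hy, s, hs, rfl⟩
    exact ⟨s, hs, y, hy, rfl⟩
  · rintro ⟨s, hs, y, hy, rfl⟩
    exact ⟨y, hy, s, hs, rfl⟩

/-- The divergence theorem on a simplex for the fields `u • (x - a)`, `a` a vertex. -/
lemma integral_simplex_cone {K : Finset (Sp (n + 1))}
    (hK : AffineIndependent ℝ ((↑) : K → Sp (n + 1))) (hc : K.card = n + 2) {a : Sp (n + 1)}
    (ha : a ∈ K) {h : ℝ} (hh : 0 < h)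
    (hF : ∀ x ∈ hull (K.erase a), ⟪outwardNormal K (K.erase a), x - a⟫ = h)
    {u : Sp (n + 1) → ℝ} (hu : ContDiff ℝ 1 u) :
    ∫ x in hull K, ((n + 1) * u x + fderiv ℝ u x (x - a)) = h * facetIntegral (K.erase a) u := by
  have hne : (K.erase a).Nonempty :=
    Finset.card_pos.1 (by rw [Finset.card_erase_of_mem ha, hc]; omega)
  exact integral_cone (by simp) a _ (outwardNormal_spec hK hc ha).1 hh (isCompact_hull _) hF
    (isCompact_hull _) (mem_hull_iff_cone ha hne) hu

lemma divergence_smul_sub {d : ℕ} {u : Sp d → ℝ} (a x : Sp d) (hu : DifferentiableAt ℝ u x) :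
    divergence (fun x => u x • (x - a)) x = d * u x + fderiv ℝ u x (x - a) := by
  have h1 : HasFDerivAt (fun x : Sp d => x - a) (ContinuousLinearMap.id ℝ (Sp d)) x :=
    (hasFDerivAt_id x).sub_const a
  have h2 := hu.hasFDerivAt.fun_smul h1
  rw [divergence, h2.fderiv]
  simp only [add_apply, smul_apply,
    ContinuousLinearMap.id_apply, ContinuousLinearMap.smulRight_apply, PiLp.add_apply,
    PiLp.smul_apply, smul_eq_mul, Finset.sum_add_distrib]
  congr 1
  · simp
  · have h3 : x - a = ∑ i, (x - a) i • EuclideanSpace.single i (1 : ℝ) := by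
      ext j; simp [Finset.sum_apply, Pi.single_apply]
    conv_rhs => rw [h3]
    simp [map_sum, mul_comm]

lemma divergence_sum {d : ℕ} {ι : Type*} (s : Finset ι) (φ : ι → Sp d → Sp d) (x : Sp d)
    (h : ∀ i ∈ s, DifferentiableAt ℝ (φ i) x) :
    divergence (fun x => ∑ i ∈ s, φ i x) x = ∑ i ∈ s, divergence (φ i) x := by
  simp only [divergence]
  rw [fderiv_fun_sum h, Finset.sum_comm]
  simp

/-- **Divergence theorem** on a simplex. Any field is a combination, with coefficients that depend
linearly on its values, of the fields `x - a`, `a` a vertex, to which the cone formula applies. -/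
theorem integral_divergence_simplex {K : Finset (Sp (n + 1))}
    (hK : AffineIndependent ℝ ((↑) : K → Sp (n + 1))) (hc : K.card = n + 2)
    {φ : Sp (n + 1) → Sp (n + 1)} (hφ : ContDiff ℝ 1 φ) :
    ∫ x in hull K, divergence φ x =
      ∑ a ∈ K, facetIntegral (K.erase a) fun x => ⟪φ x, outwardNormal K (K.erase a)⟫ := by
  classical
  have hspan : affineSpan ℝ (range ((↑) : K → Sp (n + 1))) = ⊤ := by
    rw [hK.affineSpan_eq_top_iff_card_eq_finrank_add_one]
    simp [hc]
  let b : AffineBasis K ℝ (Sp (n + 1)) := ⟨(↑), hK, hspan⟩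
  let g : K → Sp (n + 1) → ℝ := fun i x => -((b.coord i).linear (φ x))
  have hg : ∀ i, ContDiff ℝ 1 (g i) := fun i =>
    ((LinearMap.toContinuousLinearMap (b.coord i).linear).contDiff.comp hφ).neg
  have hlin : ∀ (i : K) (v : Sp (n + 1)), (b.coord i).linear v = b.coord i v - b.coord i 0 := by
    intro i v
    have := (b.coord i).linearMap_vsub v 0
    simpa using this
  -- the coefficients are minus the linear parts of the barycentric coordinates; they sum to zero
  have hdec : ∀ x, φ x = ∑ i, g i x • (x - (i : Sp (n + 1))) := by
    intro x
    have hbi : ∀ i : K, b i = (i : Sp (n + 1)) := fun i => rfl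
    have h1 := b.linear_combination_coord_eq_self (φ x)
    have h2 := b.linear_combination_coord_eq_self (0 : Sp (n + 1))
    have h3 := b.sum_coord_apply_eq_one (φ x)
    have h4 := b.sum_coord_apply_eq_one (0 : Sp (n + 1))
    simp only [hbi] at h1 h2
    simp only [g, hlin, smul_sub, Finset.sum_sub_distrib, ← Finset.sum_smul, sub_smul, h1, h2, h3, h4, neg_sub]
    simp
  choose hν h hpos hh using fun i : K => outwardNormal_spec hK hc i.2
  have hdiv : ∀ x, divergence φ x
      = ∑ i, ((n + 1) * g i x + fderiv ℝ (g i) x (x - (i : Sp (n + 1)))) := by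
    intro x
    have : φ = fun x => ∑ i, g i x • (x - (i : Sp (n + 1))) := funext hdec
    rw [this, divergence_sum]
    · refine Finset.sum_congr rfl fun i _ => ?_
      rw [divergence_smul_sub _ _ ((hg i).differentiable one_ne_zero x)]
      simp
    · intro i _
      exact ((hg i).differentiable one_ne_zero x).smul (by fun_prop)
  simp only [hdiv]
  rw [integral_finsetSum, ← Finset.sum_coe_sort K]
  · refine Finset.sum_congr rfl fun i _ => ?_
    rw [integral_simplex_cone hK hc i.2 (hpos i) (hh i) (hg i), facetIntegral, facetIntegral,
      ← integral_const_mul]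
    refine setIntegral_congr_fun (isCompact_hull _).measurableSet fun x hx => ?_
    rw [hdec x, sum_inner, Finset.sum_eq_single i]
    · rw [inner_smul_left, real_inner_comm, hh i x hx]; simp [mul_comm]
    · intro j _ hji
      have hj : (j : Sp (n + 1)) ∈ hull (K.erase (i : Sp (n + 1))) :=
        subset_convexHull ℝ _ (by simpa using fun h => hji (Subtype.ext h))
      have : x - (j : Sp (n + 1)) = (x - i) - (j - i) := by abel
      rw [inner_smul_left, real_inner_comm, this, inner_sub_right, hh i x hx, hh i _ hj]
      simp
    · simp
  · intro i _
    refine ContinuousOn.integrableOn_compact (isCompact_hull K) (Continuous.continuousOn ?_)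
    have := (hg i).continuous_fderiv one_ne_zero
    have := (hg i).continuous
    fun_prop

end Simplex

/-! ### Simplices and meshes up to null sets -/

section Hull
variable {d : ℕ}

lemma euclideanHausdorffMeasure_hull_lt_top (s : Finset (Sp d)) :
    (μHE[Module.finrank ℝ (vectorSpan ℝ (s : Set (Sp d)))] : Measure (Sp d)) (hull s) < ⊤ := by
  rcases s.eq_empty_or_nonempty with rfl | ⟨p, hp⟩
  · simp [hull]
  set V := vectorSpan ℝ (s : Set (Sp d)) with hV
  have hi : Isometry (fun y : V => (y : Sp d) + p) :=
    Isometry.of_dist_eq fun y z => by rw [dist_add_right]; rfl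
  have hsub : hull s ⊆ range (fun y : V => (y : Sp d) + p) := by
    intro x hx
    have hx' := convexHull_subset_affineSpan _ hx
    have hp' : p ∈ affineSpan ℝ (s : Set (Sp d)) := subset_affineSpan ℝ _ hp
    have h1 := AffineSubspace.vsub_mem_direction hx' hp'
    rw [direction_affineSpan] at h1
    exact ⟨⟨x - p, h1⟩, by simp⟩
  have h2 := hi.euclideanHausdorffMeasure_preimage (d := Module.finrank ℝ V) (hull s)
  rw [inter_eq_self_of_subset_left hsub, InnerProductSpace.euclideanHausdorffMeasure_eq_volume] at h2
  rw [← h2]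
  exact (hi.isClosedEmbedding.isCompact_preimage (isCompact_hull s)).measure_lt_top

/-- A simplex with at most `m` vertices has dimension less than `m`. -/
lemma euclideanHausdorffMeasure_hull_eq_zero {m : ℕ} (s : Finset (Sp d)) (hs : s.card ≤ m) :
    (μHE[m] : Measure (Sp d)) (hull s) = 0 := by
  rcases s.eq_empty_or_nonempty with rfl | hne
  · simp [hull]
  have hpos := hne.card_pos
  have h1 := finrank_vectorSpan_range_le ℝ ((↑) : s → Sp d) (n := s.card - 1)
    (by rw [Fintype.card_coe]; omega)
  rw [Subtype.range_coe_subtype] at h1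
  have h2 : Module.finrank ℝ (vectorSpan ℝ (s : Set (Sp d))) < m :=
    lt_of_le_of_lt h1 (by omega)
  refine (Measure.euclideanHausdorffMeasure_zero_or_top h2 (hull s)).resolve_right ?_
  exact (euclideanHausdorffMeasure_hull_lt_top s).ne

lemma volume_hull_eq_zero (s : Finset (Sp d)) (hs : s.card ≤ d) : volume (hull s) = 0 := by
  rw [← EuclideanSpace.euclideanHausdorffMeasure_eq_volume]
  exact euclideanHausdorffMeasure_hull_eq_zero s hs

end Hull

namespace Mesh
variable {n : ℕ} {Ω : Set (Sp (n + 1))} {M : Mesh Ω}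

lemma Elem.indep (K : M.Elem) : AffineIndependent ℝ ((↑) : K.1 → Sp (n + 1)) :=
  M.complex.indep K.2.1

lemma Elem.card_eq (K : M.Elem) : K.1.card = n + 2 := K.2.2

lemma mem_facetsOf {K : M.Elem} {F : M.Facet} : F ∈ M.facetsOf K ↔ F.1 ⊆ K.1 := by
  simp [facetsOf]

lemma mem_iFacetsOf {K : M.Elem} {F : M.IFacet} : F ∈ M.iFacetsOf K ↔ F.1.1 ⊆ K.1 := by
  simp [iFacetsOf]

lemma mem_bFacetsOf {K : M.Elem} {F : M.Facet} :
    F ∈ M.bFacetsOf K ↔ F.1 ⊆ K.1 ∧ ¬ M.IsInternal F := by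
  simp [bFacetsOf]

lemma mem_elemsOf {K : M.Elem} {F : M.IFacet} : K ∈ M.elemsOf F ↔ F.1.1 ⊆ K.1 := by
  simp [elemsOf]

/-- The facet of `K` opposite to the vertex `a`. -/
def oppFacet (K : M.Elem) (a : Sp (n + 1)) (ha : a ∈ K.1) : M.Facet :=
  ⟨K.1.erase a, M.complex.down_closed K.2.1 (Finset.erase_subset _ _)
    (Finset.card_pos.1 (by rw [Finset.card_erase_of_mem ha, K.card_eq]; omega)),
    by rw [Finset.card_erase_of_mem ha, K.card_eq]; rfl⟩

lemma exists_eq_erase {K : M.Elem} {F : M.Facet} (h : F.1 ⊆ K.1) :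
    ∃ a ∈ K.1, F.1 = K.1.erase a := by
  classical
  have h1 : (K.1 \ F.1).card = 1 := by
    rw [Finset.card_sdiff_of_subset h, K.card_eq, F.2.2]; omega
  obtain ⟨a, ha⟩ := Finset.card_eq_one.1 h1
  have ha' : a ∈ K.1 \ F.1 := by rw [ha]; simp
  rw [Finset.mem_sdiff] at ha'
  refine ⟨a, ha'.1, Finset.eq_of_subset_of_card_le ?_ ?_⟩
  · intro x hx
    exact Finset.mem_erase.2 ⟨fun h' => ha'.2 (h' ▸ hx), h hx⟩
  · rw [Finset.card_erase_of_mem ha'.1, K.card_eq, F.2.2]; rfl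

lemma sum_facetsOf (K : M.Elem) (g : Finset (Sp (n + 1)) → ℝ) :
    ∑ F ∈ M.facetsOf K, g F.1 = ∑ a ∈ K.1, g (K.1.erase a) := by
  classical
  symm
  refine Finset.sum_bij (fun a ha => oppFacet K a ha) ?_ ?_ ?_ ?_
  · intro a ha
    exact mem_facetsOf.2 (Finset.erase_subset _ _)
  · intro a ha b hb hab
    have h1 : K.1.erase a = K.1.erase b := congrArg Subtype.val hab
    by_contra hne
    have : a ∈ K.1.erase b := Finset.mem_erase.2 ⟨hne, ha⟩
    rw [← h1] at this
    simp at this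
  · intro F hF
    obtain ⟨a, ha, h⟩ := exists_eq_erase (mem_facetsOf.1 hF)
    exact ⟨a, ha, Subtype.ext h.symm⟩
  · intro a ha
    rfl

/-- Facets have finite surface measure. -/
lemma facet_finite (F : M.Facet) : (μHE[n] : Measure (Sp (n + 1))) (hull F.1) < ⊤ := by
  have h1 := euclideanHausdorffMeasure_hull_lt_top F.1
  have h2 := (M.complex.indep F.2.1).finrank_vectorSpan (n := n) (by simp [F.2.2])
  rw [Subtype.range_coe_subtype] at h2
  erw [h2] at h1
  exact h1

instance (F : M.Facet) : IsFiniteMeasure ((μHE[n] : Measure (Sp (n + 1))).restrict (hull F.1)) :=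
  ⟨by rw [Measure.restrict_apply_univ]; exact facet_finite F⟩

lemma facet_inter_null {F F' : M.Facet} (h : F ≠ F') :
    (μHE[n] : Measure (Sp (n + 1))) (hull F.1 ∩ hull F'.1) = 0 := by
  classical
  rw [M.complex.convexHull_inter_convexHull F.2.1 F'.2.1, ← Finset.coe_inter]
  refine euclideanHausdorffMeasure_hull_eq_zero _ ?_
  by_contra hc
  push Not at hc
  have h1 := Finset.eq_of_subset_of_card_le (Finset.inter_subset_left (s₁ := F.1) (s₂ := F'.1))
    (by rw [F.2.2]; omega)
  have h2 := Finset.eq_of_subset_of_card_le (Finset.inter_subset_right (s₁ := F.1) (s₂ := F'.1))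
    (by rw [F'.2.2]; omega)
  exact h (Subtype.ext (h1.symm.trans h2))

lemma elem_inter_card {K K' : M.Elem} (h : K ≠ K') : (K.1 ∩ K'.1).card ≤ n + 1 := by
  by_contra hc
  push Not at hc
  have h1 := Finset.eq_of_subset_of_card_le (Finset.inter_subset_left (s₁ := K.1) (s₂ := K'.1))
    (by rw [K.card_eq]; omega)
  have h2 := Finset.eq_of_subset_of_card_le (Finset.inter_subset_right (s₁ := K.1) (s₂ := K'.1))
    (by rw [K'.card_eq]; omega)
  exact h (Subtype.ext (h1.symm.trans h2))

lemma elem_inter_null {K K' : M.Elem} (h : K ≠ K') : volume (hull K.1 ∩ hull K'.1) = 0 := by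
  rw [M.complex.convexHull_inter_convexHull K.2.1 K'.2.1, ← Finset.coe_inter]
  exact volume_hull_eq_zero _ (elem_inter_card h)

lemma closure_eq_iUnion : closure Ω = ⋃ K : M.Elem, hull K.1 := by
  rw [← M.space_eq]
  ext x
  rw [M.complex.mem_space_iff, mem_iUnion]
  constructor
  · rintro ⟨s, hs, hx⟩
    obtain ⟨K, hK, hsK, hc⟩ := M.pure s hs
    exact ⟨⟨K, hK, hc⟩, convexHull_mono (by exact_mod_cast hsK) hx⟩
  · rintro ⟨K, hx⟩
    exact ⟨K.1, K.2.1, hx⟩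

lemma hull_subset_closure (K : M.Elem) : hull K.1 ⊆ closure Ω := by
  rw [closure_eq_iUnion (M := M)]
  exact subset_iUnion (fun K : M.Elem => hull K.1) K

lemma frontier_hull_null {d : ℕ} (s : Finset (Sp d)) : volume (frontier (hull s)) = 0 :=
  (convex_convexHull ℝ _).addHaar_frontier volume

lemma ae_mem_interior_hull {d : ℕ} (s : Finset (Sp d)) :
    ∀ᵐ x ∂(volume.restrict (hull s)), x ∈ interior (hull s) := by
  rw [ae_restrict_iff' (isCompact_hull s).measurableSet]
  filter_upwards [measure_eq_zero_iff_ae_notMem.1 (frontier_hull_null s)] with x hx h1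
  by_contra hni
  exact hx ⟨subset_closure h1, hni⟩

lemma interior_hull_subset (hΩr : interior (closure Ω) = Ω) (K : M.Elem) :
    interior (hull K.1) ⊆ Ω :=
  (interior_mono (hull_subset_closure K)).trans hΩr.subset

/-- The mesh covers `Ω` up to a null set: the integral over `Ω` is the sum of the integrals over the
elements. -/
lemma restrict_eq_sum (hΩr : interior (closure Ω) = Ω) :
    (volume.restrict Ω : Measure (Sp (n + 1))) = ∑ K : M.Elem, volume.restrict (hull K.1) := by
  have h1 : (Ω : Set (Sp (n + 1))) =ᵐ[volume] ⋃ K : M.Elem, hull K.1 := by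
    refine Filter.EventuallyLE.antisymm ?_ ?_
    · rw [← closure_eq_iUnion]
      exact (subset_closure).eventuallyLE
    · have hz : volume (⋃ K : M.Elem, frontier (hull K.1)) = 0 :=
        (measure_iUnion_null_iff).2 fun K => frontier_hull_null _
      have : ∀ᵐ x : Sp (n + 1), x ∉ ⋃ K : M.Elem, frontier (hull K.1) :=
        measure_eq_zero_iff_ae_notMem.1 hz
      filter_upwards [this] with x hx hxU
      obtain ⟨K, hK⟩ := mem_iUnion.1 hxU
      refine interior_hull_subset hΩr K ?_
      by_contra hni
      exact hx (mem_iUnion.2 ⟨K, subset_closure hK, hni⟩)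
  rw [Measure.restrict_congr_set h1, Measure.restrict_iUnion_ae]
  · exact Measure.sum_fintype _
  · intro K K' h
    exact elem_inter_null h
  · intro K
    exact (isCompact_hull K.1).measurableSet.nullMeasurableSet

lemma restrict_hull_le (hΩr : interior (closure Ω) = Ω) (K : M.Elem) :
    (volume.restrict (hull K.1) : Measure (Sp (n + 1))) ≤ volume.restrict Ω := by
  have h1 : interior (hull K.1) =ᵐ[volume] hull K.1 :=
    interior_ae_eq_of_null_frontier (frontier_hull_null _)
  rw [← Measure.restrict_congr_set h1]
  exact Measure.restrict_mono (interior_hull_subset hΩr K) le_rfl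

lemma integral_eq_sum (hΩr : interior (closure Ω) = Ω) {f : Sp (n + 1) → ℝ}
    (hf : IntegrableOn f Ω) : ∫ x in Ω, f x = ∑ K : M.Elem, ∫ x in hull K.1, f x := by
  rw [restrict_eq_sum (M := M) hΩr, integral_finsetSum_measure]
  exact fun K _ => Integrable.mono_measure hf (restrict_hull_le hΩr K)

lemma ae_notMem_of_ne {K K' : M.Elem} (h : K' ≠ K) :
    ∀ᵐ x ∂(volume.restrict (hull K.1)), x ∉ hull K'.1 := by
  rw [ae_restrict_iff' (isCompact_hull K.1).measurableSet]
  have := measure_eq_zero_iff_ae_notMem.1 (elem_inter_null h.symm)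
  filter_upwards [this] with x hx h1 h2
  exact hx ⟨h1, h2⟩

/-- Gluing along the open elements recovers the given restrictions: the boundaries of the elements
are null sets. -/
lemma glue_ae_eq {X : Type} [AddCommMonoid X] (u : M.Elem → Sp (n + 1) → X) (K : M.Elem) :
    glue u =ᵐ[volume.restrict (hull K.1)] u K := by
  have h1 := ae_mem_interior_hull K.1
  have h2 : ∀ᵐ x ∂(volume.restrict (hull K.1)), ∀ K' : M.Elem, K' ≠ K → x ∉ hull K'.1 := by
    rw [ae_all_iff]
    intro K'
    by_cases h : K' = K
    · simp [h]
    · filter_upwards [ae_notMem_of_ne h] with x hx _ using hx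
  filter_upwards [h1, h2] with x hx1 hx2
  rw [glue, Finset.sum_eq_single K]
  · rw [indicator_of_mem hx1]
  · intro K' _ h
    exact indicator_of_notMem (fun h' => hx2 K' h (interior_subset h')) _
  · simp

/-! ### Facets and the boundary -/

/-- The barycentric coordinates of an element. -/
def Elem.basis (K : M.Elem) : AffineBasis K.1 ℝ (Sp (n + 1)) :=
  ⟨(↑), K.indep, by
    rw [K.indep.affineSpan_eq_top_iff_card_eq_finrank_add_one]
    simp [K.card_eq]⟩

lemma Elem.basis_apply (K : M.Elem) (i : K.1) : K.basis i = (i : Sp (n + 1)) := rfl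

lemma Elem.range_basis (K : M.Elem) : range K.basis = (K.1 : Set (Sp (n + 1))) := by
  ext y; simp [Elem.basis_apply]

lemma Elem.mem_hull_iff (K : M.Elem) (x : Sp (n + 1)) :
    x ∈ hull K.1 ↔ ∀ i, 0 ≤ K.basis.coord i x := by
  have h := K.basis.convexHull_eq_nonneg_coord
  rw [K.range_basis] at h
  rw [hull, h]; rfl

lemma Elem.coord_eq_zero (K : M.Elem) (i : K.1) {s : Finset (Sp (n + 1))}
    (hs : s ⊆ K.1.erase i) {x : Sp (n + 1)} (hx : x ∈ hull s) : K.basis.coord i x = 0 := by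
  have hconv : Convex ℝ {x | K.basis.coord i x = 0} := by
    have : Convex ℝ ((K.basis.coord i) ⁻¹' {0}) := (convex_singleton (0 : ℝ)).affine_preimage _
    exact this
  refine convexHull_min (𝕜 := ℝ) (s := (s : Set (Sp (n + 1)))) (fun y hy => ?_) hconv hx
  have hy' := hs hy
  rw [Finset.mem_erase] at hy'
  have := K.basis.coord_apply_ne (i := i) (j := ⟨y, hy'.2⟩) (fun h => hy'.1 (by rw [h]))
  exact this

/-- A point of an element whose coordinate at one of the vertices vanishes lies in the opposite
facet. -/
lemma Elem.mem_hull_erase (K : M.Elem) (i : K.1) {x : Sp (n + 1)} (hx : x ∈ hull K.1)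
    (h0 : K.basis.coord i x = 0) : x ∈ hull (K.1.erase i) := by
  obtain ⟨s, hs, y, hy, rfl⟩ := (mem_hull_iff_cone i.2
    (Finset.card_pos.1 (by rw [Finset.card_erase_of_mem i.2, K.card_eq]; omega)) x).1 hx
  have h1 : K.basis.coord i (i : Sp (n + 1)) = 1 := by
    have := K.basis.coord_apply_eq i
    exact this
  have h2 := K.coord_eq_zero i subset_rfl hy
  have h3 : K.basis.coord i ((i : Sp (n + 1)) + s • (y - i)) = (1 - s) := by
    have e : (i : Sp (n + 1)) + s • (y - i) = AffineMap.lineMap (i : Sp (n + 1)) y s := by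
      rw [AffineMap.lineMap_apply]; simp [add_comm]
    rw [e, AffineMap.apply_lineMap, h1, h2, AffineMap.lineMap_apply]
    simp; ring
  rw [h3] at h0
  have : s = 1 := by linarith
  rw [this]; simpa using hy

/-- The points of a facet that lie on no proper subface of it. -/
def relint (F : M.Facet) : Set (Sp (n + 1)) :=
  {x | x ∈ hull F.1 ∧ ∀ b ∈ F.1, x ∉ hull (F.1.erase b)}

/-- The proper subfaces of a facet are null sets for the surface measure. -/
lemma ae_mem_relint (F : M.Facet) :
    ∀ᵐ x ∂((μHE[n] : Measure (Sp (n + 1))).restrict (hull F.1)), x ∈ relint F := by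
  have h1 : ∀ᵐ x ∂((μHE[n] : Measure (Sp (n + 1))).restrict (hull F.1)),
      ∀ b : F.1, x ∉ hull (F.1.erase b) := by
    rw [ae_all_iff]
    intro b
    refine ae_restrict_of_ae (measure_eq_zero_iff_ae_notMem.1 ?_)
    refine euclideanHausdorffMeasure_hull_eq_zero _ ?_
    rw [Finset.card_erase_of_mem b.2, F.2.2]; rfl
  filter_upwards [h1, ae_restrict_mem (isCompact_hull F.1).measurableSet] with x hx hxF
  exact ⟨hxF, fun b hb => hx ⟨b, hb⟩⟩

/-- A face of the mesh which contains a point of the relative interior of a facet contains that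
facet. -/
lemma subset_of_mem_relint {F : M.Facet} {x : Sp (n + 1)} (hx : x ∈ relint F)
    {s : Finset (Sp (n + 1))} (hs : s ∈ M.complex.faces) (hxs : x ∈ hull s) : F.1 ⊆ s := by
  classical
  by_contra hns
  obtain ⟨b, hbF, hbs⟩ := Finset.not_subset.1 hns
  have h1 := M.complex.inter_subset_convexHull F.2.1 hs ⟨hx.1, hxs⟩
  refine hx.2 b hbF (convexHull_mono ?_ h1)
  intro y hy
  exact Finset.mem_coe.2 (Finset.mem_erase.2 ⟨fun h => hbs (h ▸ hy.2), hy.1⟩)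

lemma coord_pos_of_mem_relint {F : M.Facet} {x : Sp (n + 1)} (hx : x ∈ relint F) {K : M.Elem}
    (hFK : F.1 ⊆ K.1) (i : K.1) (hi : (i : Sp (n + 1)) ∈ F.1) : 0 < K.basis.coord i x := by
  classical
  have hxK : x ∈ hull K.1 := convexHull_mono (by exact_mod_cast hFK) hx.1
  refine lt_of_le_of_ne ((K.mem_hull_iff x).1 hxK i) fun h0 => ?_
  have h1 := K.mem_hull_erase i hxK h0.symm
  have hf : K.1.erase i ∈ M.complex.faces := (oppFacet K i i.2).2.1
  have h2 := subset_of_mem_relint hx hf h1 hi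
  simp at h2

/-- A boundary facet does not meet `Ω`, up to a null set: an element on its other side would make it
internal. -/
lemma ae_notMem_of_not_isInternal (hΩ : IsOpen Ω) {F : M.Facet} (hF : ¬ M.IsInternal F) :
    ∀ᵐ x ∂((μHE[n] : Measure (Sp (n + 1))).restrict (hull F.1)), x ∉ Ω := by
  classical
  filter_upwards [ae_mem_relint F] with x hx hxΩ
  obtain ⟨K₀, hK₀, hFK₀, hc⟩ := M.pure F.1 F.2.1
  set K : M.Elem := ⟨K₀, hK₀, hc⟩
  have hFK : F.1 ⊆ K.1 := hFK₀
  obtain ⟨a, ha, hFa⟩ := exists_eq_erase hFK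
  -- a neighbourhood of `x` that meets only the elements which contain `x`
  set V : Set (Sp (n + 1)) := Ω ∩ ⋂ K' : M.Elem, {y | y ∈ hull K'.1 → x ∈ hull K'.1} with hV
  have hVo : IsOpen V := by
    refine hΩ.inter (isOpen_iInter_of_finite fun K' => ?_)
    by_cases h : x ∈ hull K'.1
    · simp [h]
    · simp only [h, imp_false]
      exact (isCompact_hull K'.1).isClosed.isOpen_compl
  have hxV : x ∈ V := ⟨hxΩ, mem_iInter.2 fun K' h => h⟩
  have hcont : Filter.Tendsto (fun ε : ℝ => x + ε • (x - a)) (nhdsWithin 0 (Ioi 0)) (nhds x) := by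
    have : Continuous (fun ε : ℝ => x + ε • (x - a)) := by fun_prop
    have h := this.tendsto 0
    simp only [zero_smul, add_zero] at h
    exact h.mono_left nhdsWithin_le_nhds
  -- a point of `Ω` slightly beyond `x`, on the ray from the vertex `a` of `K`, is not in `K`
  have hev := (hcont.eventually (hVo.mem_nhds hxV)).and self_mem_nhdsWithin
  obtain ⟨ε, hεV, hε⟩ := hev.exists
  have hε' : (0 : ℝ) < ε := hε
  set y := x + ε • (x - a) with hy
  have hyc : y ∈ closure Ω := subset_closure hεV.1
  rw [closure_eq_iUnion (M := M)] at hyc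
  obtain ⟨K', hyK'⟩ := mem_iUnion.1 hyc
  have hxK' : x ∈ hull K'.1 := mem_iInter.1 hεV.2 K' hyK'
  have hFK' := subset_of_mem_relint hx K'.2.1 hxK'
  have hKK' : K' = K := by
    by_contra hne
    exact hF ⟨K', K, hne, hFK', hFK⟩
  rw [hKK'] at hyK'
  have h1 := (K.mem_hull_iff y).1 hyK' ⟨a, ha⟩
  have h2 : K.basis.coord ⟨a, ha⟩ x = 0 := K.coord_eq_zero ⟨a, ha⟩ (by rw [hFa]) hx.1
  have h3 : K.basis.coord ⟨a, ha⟩ a = 1 := K.basis.coord_apply_eq ⟨a, ha⟩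
  have h4 : y = AffineMap.lineMap x a (-ε) := by
    rw [AffineMap.lineMap_apply, hy]; simp [add_comm]; module
  rw [h4, AffineMap.apply_lineMap, h2, h3, AffineMap.lineMap_apply] at h1
  simp at h1
  linarith

/-- An internal facet lies in `Ω`, up to a null set: the two elements lie on different sides of it,
and fill a neighbourhood of every point of its relative interior. -/
lemma ae_mem_of_isInternal (hΩr : interior (closure Ω) = Ω) {F : M.Facet} (hF : M.IsInternal F) :
    ∀ᵐ x ∂((μHE[n] : Measure (Sp (n + 1))).restrict (hull F.1)), x ∈ Ω := by
  classical
  obtain ⟨K, L, hKL, hFK, hFL⟩ := hF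
  filter_upwards [ae_mem_relint F] with x hx
  obtain ⟨a, ha, hFa⟩ := exists_eq_erase hFK
  obtain ⟨b, hb, hFb⟩ := exists_eq_erase hFL
  set α : K.1 := ⟨a, ha⟩
  set β : L.1 := ⟨b, hb⟩
  -- near `x`, membership in `K` or `L` is decided by the coordinate opposite to `F` alone
  set U : Set (Sp (n + 1)) := {y | (∀ i : K.1, (i : Sp (n + 1)) ∈ F.1 → 0 < K.basis.coord i y) ∧
    ∀ i : L.1, (i : Sp (n + 1)) ∈ F.1 → 0 < L.basis.coord i y} with hU
  have hcK : ∀ i, Continuous (K.basis.coord i) := fun i => continuous_barycentric_coord K.basis i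
  have hcL : ∀ i, Continuous (L.basis.coord i) := fun i => continuous_barycentric_coord L.basis i
  have hUo : IsOpen U := by
    have : U = (⋂ i : K.1, {y | (i : Sp (n + 1)) ∈ F.1 → 0 < K.basis.coord i y}) ∩
        ⋂ i : L.1, {y | (i : Sp (n + 1)) ∈ F.1 → 0 < L.basis.coord i y} := by
      ext y; simp [hU]
    rw [this]
    refine (isOpen_iInter_of_finite fun i => ?_).inter (isOpen_iInter_of_finite fun i => ?_)
    · by_cases h : (i : Sp (n + 1)) ∈ F.1
      · simp only [h, true_imp_iff]; exact isOpen_lt continuous_const (hcK i)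
      · simp [h]
    · by_cases h : (i : Sp (n + 1)) ∈ F.1
      · simp only [h, true_imp_iff]; exact isOpen_lt continuous_const (hcL i)
      · simp [h]
  have hxU : x ∈ U := ⟨fun i hi => coord_pos_of_mem_relint hx hFK i hi,
    fun i hi => coord_pos_of_mem_relint hx hFL i hi⟩
  have hUK : ∀ y ∈ U, 0 ≤ K.basis.coord α y → y ∈ hull K.1 := by
    intro y hy h0
    rw [K.mem_hull_iff]
    intro i
    by_cases h : (i : Sp (n + 1)) ∈ F.1
    · exact (hy.1 i h).le
    · have : i = α := by
        rw [hFa, Finset.mem_erase] at h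
        push Not at h
        exact Subtype.ext (by_contra fun h' => h h' i.2)
      rwa [this]
  have hUL : ∀ y ∈ U, 0 ≤ L.basis.coord β y → y ∈ hull L.1 := by
    intro y hy h0
    rw [L.mem_hull_iff]
    intro i
    by_cases h : (i : Sp (n + 1)) ∈ F.1
    · exact (hy.2 i h).le
    · have : i = β := by
        rw [hFb, Finset.mem_erase] at h
        push Not at h
        exact Subtype.ext (by_contra fun h' => h h' i.2)
      rwa [this]
  have hinter : K.1 ∩ L.1 = F.1 := by
    refine (Finset.eq_of_subset_of_card_le (Finset.subset_inter hFK hFL) ?_).symm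
    rw [F.2.2]; exact elem_inter_card hKL
  -- the coordinates opposite to `F` are proportional, since both vanish on `F`
  set κ := L.basis.coord β a with hκ
  have hprop : ∀ y, L.basis.coord β y = κ * K.basis.coord α y := by
    intro y
    have h1 : y = Finset.univ.affineCombination ℝ K.basis (fun i => K.basis.coord i y) :=
      (K.basis.affineCombination_coord_eq_self y).symm
    have hsum := K.basis.sum_coord_apply_eq_one y
    conv_lhs => rw [h1]
    rw [Finset.map_affineCombination _ _ _ hsum,
      Finset.affineCombination_eq_linear_combination _ _ _ hsum, Finset.sum_eq_single α]
    · simp only [Function.comp_apply, smul_eq_mul, Elem.basis_apply, hκ, α, mul_comm]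
    · intro i _ hi
      have hiF : (i : Sp (n + 1)) ∈ F.1 := by
        rw [hFa, Finset.mem_erase]
        exact ⟨fun h => hi (Subtype.ext h), i.2⟩
      have h0 : L.basis.coord β (i : Sp (n + 1)) = 0 :=
        L.coord_eq_zero β (by rw [hFb]) (subset_convexHull ℝ _ hiF)
      simp [Elem.basis_apply, h0]
    · simp
  have hxα : K.basis.coord α x = 0 := K.coord_eq_zero α (by rw [hFa]) hx.1
  have hκ0 : κ ≤ 0 := by
    by_contra hpos
    push Not at hpos
    -- points of `K` close to `x` would lie in `L`, and so in `F`
    have hcont : Filter.Tendsto (fun ε : ℝ => AffineMap.lineMap x a ε) (nhdsWithin 0 (Ioi 0))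
        (nhds x) := by
      have : Continuous (fun ε : ℝ => AffineMap.lineMap x a ε) := AffineMap.lineMap_continuous
      have h := this.tendsto 0
      simp only [AffineMap.lineMap_apply_zero] at h
      exact h.mono_left nhdsWithin_le_nhds
    obtain ⟨ε, hεU, hε⟩ := ((hcont.eventually (hUo.mem_nhds hxU)).and self_mem_nhdsWithin).exists
    have hε' : (0 : ℝ) < ε := hε
    have hα : K.basis.coord α (AffineMap.lineMap x a ε) = ε := by
      have h3 : K.basis.coord α a = 1 := K.basis.coord_apply_eq α
      rw [AffineMap.apply_lineMap, hxα, h3, AffineMap.lineMap_apply]; simp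
    have hyK := hUK _ hεU (by rw [hα]; exact hε'.le)
    have hyL := hUL _ hεU (by rw [hprop, hα]; positivity)
    have := M.complex.inter_subset_convexHull K.2.1 L.2.1 ⟨hyK, hyL⟩
    rw [← Finset.coe_inter, hinter] at this
    have h0 := K.coord_eq_zero α (by rw [hFa]) this
    rw [hα] at h0
    linarith
  have hsub : U ⊆ closure Ω := by
    intro y hy
    rcases le_or_gt 0 (K.basis.coord α y) with h | h
    · exact hull_subset_closure K (hUK y hy h)
    · refine hull_subset_closure L (hUL y hy ?_)
      rw [hprop]
      nlinarith
  rw [← hΩr]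
  exact interior_maximal hsub hUo hxU

end Mesh

/-! ### Integration by parts and traces -/

section Pairing
variable {X : Type*} [MeasurableSpace X] {μ : Measure X} {V : Type*} [NormedAddCommGroup V]
  [InnerProductSpace ℝ V]

lemma memLp_of_continuous_of_isCompact [TopologicalSpace X] [OpensMeasurableSpace X] [T2Space X]
    [SecondCountableTopology X] {f : X → V} (hf : Continuous f) {K : Set X} (hK : IsCompact K)
    (hμ : μ K < ⊤) (p : ℝ≥0∞) : MemLp f p (μ.restrict K) := by
  have : IsFiniteMeasure (μ.restrict K) := ⟨by rwa [Measure.restrict_apply_univ]⟩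
  obtain ⟨C, hC⟩ := hK.exists_bound_of_continuousOn hf.continuousOn
  refine MemLp.of_bound ?_ C ?_
  · exact (hf.continuousOn.aestronglyMeasurable_of_isCompact hK hK.measurableSet)
  · exact (ae_restrict_mem hK.measurableSet).mono fun x hx => hC x hx

lemma integrable_inner_of_memLp {f g : X → V} (hf : MemLp f 2 μ) (hg : MemLp g 2 μ) :
    Integrable (fun x => ⟪f x, g x⟫) μ := by
  have h := L2.integrable_inner (𝕜 := ℝ) (hf.toLp f) (hg.toLp g)
  refine h.congr ?_
  filter_upwards [hf.coeFn_toLp, hg.coeFn_toLp] with x h1 h2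
  rw [h1, h2]

lemma integral_inner_eq_inner_toLp {f g : X → V} (hf : MemLp f 2 μ) (hg : MemLp g 2 μ) :
    ∫ x, ⟪f x, g x⟫ ∂μ = ⟪hf.toLp f, hg.toLp g⟫ := by
  rw [L2.inner_def]
  refine integral_congr_ae ?_
  filter_upwards [hf.coeFn_toLp, hg.coeFn_toLp] with x h1 h2
  rw [h1, h2]

lemma tendsto_integral_inner {f : ℕ → X → V} {f' g : X → V} (hf : ∀ m, MemLp (f m) 2 μ)
    (hf' : MemLp f' 2 μ) (hg : MemLp g 2 μ)
    (hlim : Filter.Tendsto (fun m => eLpNorm (f m - f') 2 μ) Filter.atTop (nhds 0)) :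
    Filter.Tendsto (fun m => ∫ x, ⟪f m x, g x⟫ ∂μ) Filter.atTop (nhds (∫ x, ⟪f' x, g x⟫ ∂μ)) := by
  have h := (Lp.tendsto_Lp_iff_tendsto_eLpNorm'' f hf f' hf').2 hlim
  have h2 := h.inner (tendsto_const_nhds (x := hg.toLp g)) (𝕜 := ℝ)
  simpa only [← integral_inner_eq_inner_toLp] using h2

end Pairing

section
variable {d : ℕ}

lemma memLp_hull {V : Type*} [NormedAddCommGroup V] [InnerProductSpace ℝ V] {f : Sp d → V}
    (hf : Continuous f) (s : Finset (Sp d)) (p : ℝ≥0∞) : MemLp f p (volume.restrict (hull s)) :=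
  memLp_of_continuous_of_isCompact hf (isCompact_hull s) (isCompact_hull s).measure_lt_top p

lemma continuous_divergence {φ : Sp d → Sp d} (hφ : ContDiff ℝ 1 φ) :
    Continuous (divergence φ) := by
  have := hφ.continuous_fderiv one_ne_zero
  unfold divergence
  fun_prop

lemma continuous_gradient {w : Sp d → ℝ} (hw : ContDiff ℝ 1 w) : Continuous (gradient w) := by
  have := hw.continuous_fderiv one_ne_zero
  unfold gradient
  fun_prop

lemma divergence_smul {u : Sp d → ℝ} {φ : Sp d → Sp d} {x : Sp d} (hu : DifferentiableAt ℝ u x)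
    (hφ : DifferentiableAt ℝ φ x) :
    divergence (fun x => u x • φ x) x = u x * divergence φ x + ⟪gradient u x, φ x⟫ := by
  rw [divergence, fderiv_fun_smul hu hφ, inner_gradient_left]
  simp only [add_apply, smul_apply, ContinuousLinearMap.smulRight_apply, PiLp.add_apply,
    PiLp.smul_apply, smul_eq_mul, Finset.sum_add_distrib, divergence, Finset.mul_sum]
  congr 1
  have h3 : φ x = ∑ i, φ x i • EuclideanSpace.single i (1 : ℝ) := by
    ext j; simp [Finset.sum_apply, Pi.single_apply]
  conv_rhs => rw [h3]
  simp [map_sum, mul_comm]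

lemma divergence_smul_single {u : Sp d → ℝ} {x : Sp d} (hu : DifferentiableAt ℝ u x) (i : Fin d) :
    divergence (fun x => u x • EuclideanSpace.single i (1 : ℝ)) x = gradient u x i := by
  rw [divergence_smul hu (by fun_prop)]
  have : divergence (fun _ : Sp d => EuclideanSpace.single i (1 : ℝ)) x = 0 := by
    simp [divergence]
  rw [this, mul_zero, zero_add, EuclideanSpace.inner_single_right]
  simp

end

namespace Mesh
variable {n : ℕ} {Ω : Set (Sp (n + 1))} {M : Mesh Ω}

lemma memLp_facet {V : Type*} [NormedAddCommGroup V] [InnerProductSpace ℝ V]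
    {f : Sp (n + 1) → V} (hf : Continuous f) (F : M.Facet) (p : ℝ≥0∞) :
    MemLp f p ((μHE[n] : Measure (Sp (n + 1))).restrict (hull F.1)) :=
  memLp_of_continuous_of_isCompact hf (isCompact_hull F.1) (facet_finite F) p

/-- Integration by parts on an element. -/
lemma integral_by_parts (K : M.Elem) {w : Sp (n + 1) → ℝ} {φ : Sp (n + 1) → Sp (n + 1)}
    (hw : ContDiff ℝ 1 w) (hφ : ContDiff ℝ 1 φ) :
    ∫ x in hull K.1, (w x * divergence φ x + ⟪gradient w x, φ x⟫) =
      ∑ F ∈ M.facetsOf K, facetIntegral F.1 fun x => w x * ⟪φ x, outwardNormal K.1 F.1⟫ := by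
  have h := integral_divergence_simplex (φ := fun x => w x • φ x) K.indep K.card_eq (hw.smul hφ)
  have h1 : ∀ x, divergence (fun x => w x • φ x) x =
      w x * divergence φ x + ⟪gradient w x, φ x⟫ := fun x =>
    divergence_smul (hw.differentiable one_ne_zero x) (hφ.differentiable one_ne_zero x)
  simp only [h1, inner_smul_left] at h
  rw [h, sum_facetsOf K fun s => facetIntegral s fun x => w x * ⟪φ x, outwardNormal K.1 s⟫]
  simp

/-- A pair in `H¹₀` is the limit of one sequence of test functions, along which all integration by
parts formulas on the elements pass to the limit. -/
lemma exists_seq_of_memH10 (hΩr : interior (closure Ω) = Ω) {ψ : Sp (n + 1) → ℝ}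
    {v : Sp (n + 1) → Sp (n + 1)} (h : MemH10 Ω ψ v) :
    ∃ w : ℕ → Sp (n + 1) → ℝ, (∀ m, IsTest Ω (w m)) ∧ ∀ (K : M.Elem)
      (φ : Sp (n + 1) → Sp (n + 1)), ContDiff ℝ ∞ φ →
      Filter.Tendsto (fun m => ∑ F ∈ M.facetsOf K,
        facetIntegral F.1 fun x => w m x * ⟪φ x, outwardNormal K.1 F.1⟫) Filter.atTop
        (nhds (∫ x in hull K.1, (ψ x * divergence φ x + ⟪v x, φ x⟫))) := by
  obtain ⟨hψ, hv, happ⟩ := h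
  choose w hw h1 h2 using fun m : ℕ => happ ((m : ℝ≥0∞) + 1)⁻¹
    (ENNReal.inv_pos.2 (by finiteness))
  refine ⟨w, hw, fun K φ hφ => ?_⟩
  have hle := restrict_hull_le hΩr K
  have hφ1 : ContDiff ℝ 1 φ := hφ.of_le (by exact_mod_cast le_top)
  have hw1 : ∀ m, ContDiff ℝ 1 (w m) := fun m => (hw m).1.of_le (by exact_mod_cast le_top)
  have hψK : MemLp ψ 2 (volume.restrict (hull K.1)) := hψ.mono_measure hle
  have hvK : MemLp v 2 (volume.restrict (hull K.1)) := hv.mono_measure hle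
  have hdiv := memLp_hull (continuous_divergence hφ1) K.1 2
  have hφL := memLp_hull hφ.continuous K.1 2
  have hwL : ∀ m, MemLp (w m) 2 (volume.restrict (hull K.1)) :=
    fun m => memLp_hull (hw m).1.continuous K.1 2
  have hgL : ∀ m, MemLp (gradient (w m)) 2 (volume.restrict (hull K.1)) :=
    fun m => memLp_hull (continuous_gradient (hw1 m)) K.1 2
  have hz : Filter.Tendsto (fun m : ℕ => ((m : ℝ≥0∞) + 1)⁻¹) Filter.atTop (nhds 0) := by
    have := (Filter.tendsto_add_atTop_iff_nat 1).2 ENNReal.tendsto_inv_nat_nhds_zero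
    simpa using this
  have hlim1 : Filter.Tendsto (fun m => eLpNorm (w m - ψ) 2 (volume.restrict (hull K.1)))
      Filter.atTop (nhds 0) := by
    refine tendsto_of_tendsto_of_tendsto_of_le_of_le tendsto_const_nhds hz (fun _ => zero_le)
      fun m => ?_
    rw [eLpNorm_sub_comm]
    exact (eLpNorm_mono_measure _ hle).trans (h1 m).le
  have hlim2 : Filter.Tendsto (fun m => eLpNorm (gradient (w m) - v) 2
      (volume.restrict (hull K.1))) Filter.atTop (nhds 0) := by
    refine tendsto_of_tendsto_of_tendsto_of_le_of_le tendsto_const_nhds hz (fun _ => zero_le)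
      fun m => ?_
    rw [eLpNorm_sub_comm]
    exact (eLpNorm_mono_measure _ hle).trans (h2 m).le
  have t1 := tendsto_integral_inner hwL hψK hdiv hlim1
  have t2 := tendsto_integral_inner hgL hvK hφL hlim2
  have t3 := t1.add t2
  have hconv : ∀ (a : Sp (n + 1) → ℝ) (b : Sp (n + 1) → Sp (n + 1)),
      MemLp a 2 (volume.restrict (hull K.1)) → MemLp b 2 (volume.restrict (hull K.1)) →
      ∫ x in hull K.1, (a x * divergence φ x + ⟪b x, φ x⟫) =
      (∫ x in hull K.1, ⟪a x, divergence φ x⟫) + ∫ x in hull K.1, ⟪b x, φ x⟫ := by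
    intro a b ha hb
    rw [← integral_add (integrable_inner_of_memLp ha hdiv) (integrable_inner_of_memLp hb hφL)]
    simp [mul_comm]
  rw [hconv ψ v hψK hvK]
  refine t3.congr fun m => ?_
  rw [← hconv _ _ (hwL m) (hgL m), integral_by_parts K (hw1 m) hφ1]

lemma hull_facet_disjoint_interior {K : M.Elem} {F : M.Facet} (h : F.1 ⊆ K.1) {x : Sp (n + 1)}
    (hx : x ∈ hull F.1) : x ∉ interior (hull K.1) := by
  intro hxi
  obtain ⟨a, ha, hFa⟩ := exists_eq_erase h
  have h1 := K.basis.interior_convexHull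
  rw [K.range_basis] at h1
  rw [hull, h1] at hxi
  have h3 := hxi ⟨a, ha⟩
  rw [K.coord_eq_zero ⟨a, ha⟩ (by rw [hFa]) hx] at h3
  exact lt_irrefl _ h3

lemma sum_facetIntegral_eq_zero (K : M.Elem) {g : M.Facet → Sp (n + 1) → ℝ}
    (hg : ∀ F ∈ M.facetsOf K, ∀ x ∈ hull F.1, g F x = 0) :
    ∑ F ∈ M.facetsOf K, facetIntegral F.1 (g F) = 0 := by
  refine Finset.sum_eq_zero fun F hF => ?_
  exact setIntegral_eq_zero_of_forall_eq_zero fun x hx => hg F hF x hx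

/-- Two integrable functions on an element agree if they agree when tested with smooth functions
with compact support in the interior. -/
lemma ae_eq_of_integral_test (K : M.Elem) {V : Type*} [NormedAddCommGroup V] [NormedSpace ℝ V]
    [CompleteSpace V] {f : Sp (n + 1) → V}
    (hf : IntegrableOn f (hull K.1))
    (h : ∀ g : Sp (n + 1) → ℝ, ContDiff ℝ ∞ g → HasCompactSupport g →
      tsupport g ⊆ interior (hull K.1) → ∫ x in hull K.1, g x • f x = 0) :
    ∀ᵐ x ∂(volume.restrict (hull K.1)), f x = 0 := by
  have h1 := isOpen_interior.ae_eq_zero_of_integral_contDiff_smul_eq_zero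
    (U := interior (hull K.1)) (μ := volume.restrict (hull K.1)) (f := f)
    (hf.locallyIntegrable.locallyIntegrableOn _) h
  filter_upwards [h1, ae_mem_interior_hull K.1] with x h3 h4 using h3 h4

lemma memLp_one_of_two {K : M.Elem} {V : Type*} [NormedAddCommGroup V] {f : Sp (n + 1) → V}
    (hf : MemLp f 2 (volume.restrict (hull K.1))) : IntegrableOn f (hull K.1) := by
  have : IsFiniteMeasure (volume.restrict (hull K.1)) :=
    ⟨by rw [Measure.restrict_apply_univ]; exact (isCompact_hull K.1).measure_lt_top⟩
  exact hf.integrable (by norm_num)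

/-- The integration by parts formula for a function in `H¹₀(Ω)` with its global gradient and any of
its traces on an element: the gradient on the element is the restriction of the global one. -/
lemma HasTrace.integral_by_parts (hΩr : interior (closure Ω) = Ω) {ψ : Sp (n + 1) → ℝ}
    {v : Sp (n + 1) → Sp (n + 1)} (h : MemH10 Ω ψ v) {K : M.Elem} {γ : Sp (n + 1) → ℝ}
    (hγ : HasTrace K ψ γ) {φ : Sp (n + 1) → Sp (n + 1)} (hφ : ContDiff ℝ ∞ φ) :
    ∫ x in hull K.1, (ψ x * divergence φ x + ⟪v x, φ x⟫) =
      ∑ F ∈ M.facetsOf K, facetIntegral F.1 fun x => γ x * ⟪φ x, outwardNormal K.1 F.1⟫ := by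
  obtain ⟨hψK, -, G, hG, hibp⟩ := hγ
  obtain ⟨w, hw, hlim⟩ := exists_seq_of_memH10 (M := M) hΩr h
  have hle := restrict_hull_le hΩr K
  have hvK : MemLp v 2 (volume.restrict (hull K.1)) := h.2.1.mono_measure hle
  have hsplit : ∀ (φ : Sp (n + 1) → Sp (n + 1)), ContDiff ℝ ∞ φ →
      ∀ (b : Sp (n + 1) → Sp (n + 1)), MemLp b 2 (volume.restrict (hull K.1)) →
      ∫ x in hull K.1, (ψ x * divergence φ x + ⟪b x, φ x⟫) =
      (∫ x in hull K.1, ⟪ψ x, divergence φ x⟫) + ∫ x in hull K.1, ⟪b x, φ x⟫ := by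
    intro φ hφ b hb
    have hφ1 : ContDiff ℝ 1 φ := hφ.of_le (by exact_mod_cast le_top)
    rw [← integral_add (integrable_inner_of_memLp hψK
      (memLp_hull (continuous_divergence hφ1) K.1 2))
      (integrable_inner_of_memLp hb (memLp_hull hφ.continuous K.1 2))]
    simp [mul_comm]
  -- `G` and `v` agree, as is seen by testing with fields that vanish on the boundary
  have hGv : ∀ᵐ x ∂(volume.restrict (hull K.1)), G x - v x = 0 := by
    have hGv : IntegrableOn (fun x => G x - v x) (hull K.1) :=
      (memLp_one_of_two hG).sub (memLp_one_of_two hvK)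
    refine ae_eq_of_integral_test K hGv ?_
    intro g hg hgc hgs
    have hint : ∀ b : Sp (n + 1) → Sp (n + 1), MemLp b 2 (volume.restrict (hull K.1)) →
        IntegrableOn (fun x => g x • b x) (hull K.1) := fun b hb =>
      (memLp_one_of_two hb).continuousOn_smul hg.continuous.continuousOn (isCompact_hull K.1)
    refine ext_inner_right ℝ fun e => ?_
    have hφe : ContDiff ℝ ∞ fun x => g x • e := hg.smul contDiff_const
    have hz : ∀ F ∈ M.facetsOf K, ∀ x ∈ hull F.1, g x = 0 := by
      intro F hF x hx
      by_contra hne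
      exact hull_facet_disjoint_interior (mem_facetsOf.1 hF) hx
        (hgs (subset_tsupport _ hne))
    have e1 := hibp _ hφe
    rw [sum_facetIntegral_eq_zero K (fun F hF x hx => by simp [hz F hF x hx]),
      hsplit _ hφe G hG] at e1
    have e2 := hlim K _ hφe
    have e3 := tendsto_nhds_unique (e2.congr fun m => sum_facetIntegral_eq_zero K
      fun F hF x hx => by simp [hz F hF x hx]) tendsto_const_nhds
    rw [hsplit _ hφe v hvK] at e3
    have e4 : ∫ x in hull K.1, ⟪G x, g x • e⟫ = ∫ x in hull K.1, ⟪v x, g x • e⟫ := by linarith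
    have e5 : ∀ b : Sp (n + 1) → Sp (n + 1), MemLp b 2 (volume.restrict (hull K.1)) →
        ⟪∫ x in hull K.1, g x • b x, e⟫ = ∫ x in hull K.1, ⟪b x, g x • e⟫ := by
      intro b hb
      rw [real_inner_comm, ← integral_inner (hint b hb)]
      refine integral_congr_ae (Filter.Eventually.of_forall fun x => ?_)
      simp only [inner_smul_right, real_inner_comm]
    simp only [smul_sub]
    rw [integral_sub (hint G hG) (hint v hvK), inner_sub_left, e5 G hG, e5 v hvK, e4, sub_self,
      inner_zero_left]
  rw [← hibp φ hφ]
  refine integral_congr_ae ?_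
  filter_upwards [hGv] with x hx
  rw [sub_eq_zero.1 hx]

/-- The volume side of the integration by parts formula for the pair `(ψ, v)` and the field
`g • (x - a)`. For `v = ∇ψ` it is a multiple of the moment with `g` of the trace of `ψ` on the facet
opposite to `a`. -/
def coneFunctional (K : M.Elem) (a : Sp (n + 1)) (g : Sp (n + 1) → ℝ) (ψ : Sp (n + 1) → ℝ)
    (v : Sp (n + 1) → Sp (n + 1)) : ℝ :=
  ∫ x in hull K.1, (ψ x * divergence (fun x => g x • (x - a)) x + ⟪v x, g x • (x - a)⟫)

/-- The field `g • (x - a)`, with `a` the vertex opposite to `F`, isolates the facet `F` in the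
boundary integral over `∂K`. -/
lemma sum_facets_cone {K : M.Elem} {F : M.Facet} (hFK : F.1 ⊆ K.1) {a : Sp (n + 1)} (ha : a ∈ K.1)
    (hFa : F.1 = K.1.erase a) {h : ℝ}
    (hh : ∀ x ∈ hull (K.1.erase a), ⟪outwardNormal K.1 (K.1.erase a), x - a⟫ = h)
    (u g : Sp (n + 1) → ℝ) :
    ∑ F' ∈ M.facetsOf K, facetIntegral F'.1
      (fun x => u x * ⟪g x • (x - a), outwardNormal K.1 F'.1⟫) =
      h * facetIntegral F.1 fun x => u x * g x := by
  rw [Finset.sum_eq_single F]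
  · rw [facetIntegral, facetIntegral, ← integral_const_mul]
    refine setIntegral_congr_fun (isCompact_hull F.1).measurableSet fun x hx => ?_
    rw [hFa] at hx
    have := hh x hx
    rw [← hFa, real_inner_comm] at this
    simp only [inner_smul_left, this]
    simp; ring
  · intro F' hF' hne
    refine setIntegral_eq_zero_of_forall_eq_zero fun x hx => ?_
    obtain ⟨b, hb, hF'b⟩ := exists_eq_erase (mem_facetsOf.1 hF')
    obtain ⟨-, h', -, hh'⟩ := outwardNormal_spec K.indep K.card_eq hb
    have hab : a ≠ b := fun hab => hne (Subtype.ext (by rw [hF'b, hFa, hab]))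
    have haF' : a ∈ hull (K.1.erase b) :=
      subset_convexHull ℝ _ (Finset.mem_coe.2 (Finset.mem_erase.2 ⟨hab, ha⟩))
    rw [hF'b] at hx ⊢
    have h1 : x - a = (x - b) - (a - b) := by abel
    rw [inner_smul_left, real_inner_comm, h1, inner_sub_right, hh' x hx, hh' a haF']
    simp
  · intro h'
    exact absurd (mem_facetsOf.2 hFK) h'

lemma contDiff_smul_sub {g : Sp (n + 1) → ℝ} (hg : ContDiff ℝ ∞ g) (a : Sp (n + 1)) :
    ContDiff ℝ ∞ fun x => g x • (x - a) := hg.smul (contDiff_id.sub contDiff_const)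

/-- Facet moments of traces are given by volume integrals. -/
lemma HasTrace.facet_moment (hΩr : interior (closure Ω) = Ω) {ψ : Sp (n + 1) → ℝ}
    {v : Sp (n + 1) → Sp (n + 1)} (h : MemH10 Ω ψ v) {K : M.Elem} {γ : Sp (n + 1) → ℝ}
    (hγ : HasTrace K ψ γ) {F : M.Facet} (hFK : F.1 ⊆ K.1) {a : Sp (n + 1)} (ha : a ∈ K.1)
    (hFa : F.1 = K.1.erase a) {η : ℝ}
    (hh : ∀ x ∈ hull (K.1.erase a), ⟪outwardNormal K.1 (K.1.erase a), x - a⟫ = η)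
    {g : Sp (n + 1) → ℝ} (hg : ContDiff ℝ ∞ g) :
    coneFunctional K a g ψ v = η * facetIntegral F.1 fun x => γ x * g x := by
  rw [coneFunctional, hγ.integral_by_parts hΩr h (contDiff_smul_sub hg a)]
  exact sum_facets_cone hFK ha hFa hh γ g

/-- Along an approximating sequence of test functions, all facet moments converge to those of the
traces, from whichever element these are taken. -/
lemma tendsto_facet_moment (hΩr : interior (closure Ω) = Ω) {ψ : Sp (n + 1) → ℝ}
    {v : Sp (n + 1) → Sp (n + 1)} (h : MemH10 Ω ψ v) :
    ∃ w : ℕ → Sp (n + 1) → ℝ, (∀ m, IsTest Ω (w m)) ∧ ∀ (K : M.Elem) (γ : Sp (n + 1) → ℝ),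
      HasTrace K ψ γ → ∀ F ∈ M.facetsOf K, ∀ g : Sp (n + 1) → ℝ, ContDiff ℝ ∞ g →
      Filter.Tendsto (fun m => facetIntegral F.1 fun x => w m x * g x) Filter.atTop
        (nhds (facetIntegral F.1 fun x => γ x * g x)) := by
  obtain ⟨w, hw, hlim⟩ := exists_seq_of_memH10 (M := M) hΩr h
  refine ⟨w, hw, fun K γ hγ F hF g hg => ?_⟩
  have hFK := mem_facetsOf.1 hF
  obtain ⟨a, ha, hFa⟩ := exists_eq_erase hFK
  obtain ⟨-, η, hη, hh⟩ := outwardNormal_spec K.indep K.card_eq ha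
  have h1 := hlim K _ (contDiff_smul_sub hg a)
  simp only [sum_facets_cone hFK ha hFa hh] at h1
  have h2 := hγ.facet_moment hΩr h hFK ha hFa hh hg
  rw [coneFunctional] at h2
  rw [h2] at h1
  have h3 := h1.const_mul η⁻¹
  simpa only [inv_mul_cancel_left₀ hη.ne'] using h3

/-- The traces of a function in `H¹₀(Ω)` from the elements on both sides of a facet agree. -/
lemma HasTrace.facet_moment_eq (hΩr : interior (closure Ω) = Ω) {ψ : Sp (n + 1) → ℝ}
    {v : Sp (n + 1) → Sp (n + 1)} (h : MemH10 Ω ψ v) {K L : M.Elem} {γ γ' : Sp (n + 1) → ℝ}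
    (hγ : HasTrace K ψ γ) (hγ' : HasTrace L ψ γ') {F : M.Facet} (hFK : F.1 ⊆ K.1)
    (hFL : F.1 ⊆ L.1) {g : Sp (n + 1) → ℝ} (hg : ContDiff ℝ ∞ g) :
    (facetIntegral F.1 fun x => γ x * g x) = facetIntegral F.1 fun x => γ' x * g x := by
  obtain ⟨w, -, hlim⟩ := tendsto_facet_moment (M := M) hΩr h
  exact tendsto_nhds_unique (hlim K γ hγ F (mem_facetsOf.2 hFK) g hg)
    (hlim L γ' hγ' F (mem_facetsOf.2 hFL) g hg)

/-- The trace of a function in `H¹₀(Ω)` vanishes on the boundary facets. -/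
lemma HasTrace.facet_moment_boundary (hΩ : IsOpen Ω) (hΩr : interior (closure Ω) = Ω)
    {ψ : Sp (n + 1) → ℝ} {v : Sp (n + 1) → Sp (n + 1)} (h : MemH10 Ω ψ v) {K : M.Elem}
    {γ : Sp (n + 1) → ℝ} (hγ : HasTrace K ψ γ) {F : M.Facet} (hFK : F.1 ⊆ K.1)
    (hF : ¬ M.IsInternal F) {g : Sp (n + 1) → ℝ} (hg : ContDiff ℝ ∞ g) :
    (facetIntegral F.1 fun x => γ x * g x) = 0 := by
  obtain ⟨w, hw, hlim⟩ := tendsto_facet_moment (M := M) hΩr h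
  refine tendsto_nhds_unique (hlim K γ hγ F (mem_facetsOf.2 hFK) g hg) ?_
  have : ∀ m, (facetIntegral F.1 fun x => w m x * g x) = 0 := by
    intro m
    refine integral_eq_zero_of_ae ?_
    filter_upwards [ae_notMem_of_not_isInternal hΩ hF] with x hx
    have : w m x = 0 := by
      by_contra hne
      exact hx ((hw m).2.2 (subset_tsupport _ hne))
    simp [this]
  simp only [this]
  exact tendsto_const_nhds

/-! ### Normal traces -/

/-- Integration by parts on an element for a field with a weak divergence in `Ω` and component
traces on the element. -/
lemma integral_by_parts_of_hasWeakDiv (hΩr : interior (closure Ω) = Ω)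
    {v : Sp (n + 1) → Sp (n + 1)} {D : Sp (n + 1) → ℝ} (hv : MemLp v 2 (volume.restrict Ω))
    (hD : MemLp D 2 (volume.restrict Ω)) (hvD : HasWeakDiv Ω v D) {K : M.Elem}
    {γ : Sp (n + 1) → Sp (n + 1)} (hγ : ∀ i, HasTrace K (fun x => v x i) (fun x => γ x i))
    {w : Sp (n + 1) → ℝ} (hw : ContDiff ℝ ∞ w) :
    ∫ x in hull K.1, (⟪v x, gradient w x⟫ + D x * w x) =
      ∑ F ∈ M.facetsOf K, facetIntegral F.1 fun x => w x * ⟪γ x, outwardNormal K.1 F.1⟫ := by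
  have hle := restrict_hull_le hΩr K
  choose h1 h2 G hG hibp using hγ
  have hDK : MemLp D 2 (volume.restrict (hull K.1)) := hD.mono_measure hle
  have hvK : MemLp v 2 (volume.restrict (hull K.1)) := hv.mono_measure hle
  set H : Sp (n + 1) → ℝ := fun x => ∑ i, G i x i with hH
  have hGi : ∀ i j, MemLp (fun x => G i x j) 2 (volume.restrict (hull K.1)) := fun i j =>
    (EuclideanSpace.proj j : Sp (n + 1) →L[ℝ] ℝ).comp_memLp' (hG i)
  have hHL : MemLp H 2 (volume.restrict (hull K.1)) := memLp_finsetSum _ fun i _ => hGi i i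
  -- the sum of the component formulas
  have hsum : ∀ w : Sp (n + 1) → ℝ, ContDiff ℝ ∞ w →
      ∫ x in hull K.1, (⟪v x, gradient w x⟫ + H x * w x) =
      ∑ F ∈ M.facetsOf K, facetIntegral F.1 fun x => w x * ⟪γ x, outwardNormal K.1 F.1⟫ := by
    intro w hw
    have hw1 : ContDiff ℝ 1 w := hw.of_le (by exact_mod_cast le_top)
    have hgr := continuous_gradient hw1
    have e := fun i => hibp i (fun x => w x • EuclideanSpace.single i (1 : ℝ))
      (hw.smul contDiff_const)
    have hdiv : ∀ i x, divergence (fun x => w x • EuclideanSpace.single i (1 : ℝ)) x =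
        gradient w x i := fun i x =>
      divergence_smul_single (hw1.differentiable one_ne_zero x) i
    simp only [hdiv, inner_smul_right, inner_smul_left, EuclideanSpace.inner_single_right,
      EuclideanSpace.inner_single_left, one_mul, map_one, conj_trivial] at e
    have hL : ∫ x in hull K.1, (⟪v x, gradient w x⟫ + H x * w x) =
        ∑ i, ∫ x in hull K.1, (v x i * gradient w x i + w x * G i x i) := by
      rw [← integral_finsetSum]
      · refine integral_congr_ae (Filter.Eventually.of_forall fun x => ?_)
        simp only [hH, PiLp.inner_apply, Finset.sum_add_distrib, Finset.sum_mul]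
        congr 1
        · simp [mul_comm]
        · simp [mul_comm]
      · intro i _
        have a1 := integrable_inner_of_memLp (h1 i) (memLp_hull (f := fun x => gradient w x i)
          (by fun_prop) K.1 2)
        have a2 := integrable_inner_of_memLp (hGi i i) (memLp_hull hw.continuous K.1 2)
        refine (a1.add a2).congr (Filter.Eventually.of_forall fun x => ?_)
        simp [mul_comm]
    rw [hL]
    simp only [e]
    rw [Finset.sum_comm]
    refine Finset.sum_congr rfl fun F hF => ?_
    simp only [facetIntegral]
    rw [← integral_finsetSum]
    · refine integral_congr_ae (Filter.Eventually.of_forall fun x => ?_)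
      simp only [PiLp.inner_apply, Finset.mul_sum]
      refine Finset.sum_congr rfl fun i _ => ?_
      simp; ring
    · intro i _
      have a1 := integrable_inner_of_memLp (h2 i F hF) (memLp_facet
        (f := fun x => w x * outwardNormal K.1 F.1 i) (by have := hw.continuous; fun_prop) F 2)
      refine a1.congr (Filter.Eventually.of_forall fun x => ?_)
      simp; ring
  -- the weak divergence on the element, which is `H`, is the restriction of `D`
  have hHD : ∀ᵐ x ∂(volume.restrict (hull K.1)), H x - D x = 0 := by
    refine ae_eq_of_integral_test K ((memLp_one_of_two hHL).sub (memLp_one_of_two hDK)) ?_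
    intro g hg hgc hgs
    have hg1 : ContDiff ℝ 1 g := hg.of_le (by exact_mod_cast le_top)
    have hz : ∀ F ∈ M.facetsOf K, ∀ x ∈ hull F.1, g x = 0 := by
      intro F hF x hx
      by_contra hne
      exact hull_facet_disjoint_interior (mem_facetsOf.1 hF) hx
        (hgs (subset_tsupport _ hne))
    have e1 := hsum g hg
    rw [sum_facetIntegral_eq_zero K (fun F hF x hx => by simp [hz F hF x hx])] at e1
    have e2 := hvD g ⟨hg, hgc, hgs.trans (interior_hull_subset hΩr K)⟩
    -- both integrands vanish outside the element
    have hloc : ∀ f : Sp (n + 1) → ℝ, (∀ x, x ∉ tsupport g → f x = 0) →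
        ∫ x in Ω, f x = ∫ x in hull K.1, f x := by
      intro f hf
      have s1 : ∫ x in Ω, f x = ∫ x, f x := setIntegral_eq_integral_of_forall_compl_eq_zero
        fun x hx => hf x fun h => hx (interior_hull_subset hΩr K (hgs h))
      have s2 : ∫ x in hull K.1, f x = ∫ x, f x := setIntegral_eq_integral_of_forall_compl_eq_zero
        fun x hx => hf x fun h => hx (interior_subset (hgs h))
      rw [s1, s2]
    have hgrad0 : ∀ x, x ∉ tsupport g → gradient g x = 0 := by
      intro x hx
      have : fderiv ℝ g x = 0 := by
        by_contra hne
        exact hx (support_fderiv_subset ℝ hne)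
      rw [gradient, this, map_zero]
    rw [hloc _ fun x hx => by rw [hgrad0 x hx, inner_zero_right],
      hloc _ fun x hx => by rw [image_eq_zero_of_notMem_tsupport hx, mul_zero]] at e2
    have i1 : Integrable (fun x => ⟪v x, gradient g x⟫) (volume.restrict (hull K.1)) :=
      integrable_inner_of_memLp hvK (memLp_hull (continuous_gradient hg1) K.1 2)
    have i2 : Integrable (fun x => H x * g x) (volume.restrict (hull K.1)) := by
      refine (integrable_inner_of_memLp hHL (memLp_hull hg.continuous K.1 2)).congr
        (Filter.Eventually.of_forall fun x => ?_)
      simp [mul_comm]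
    have i3 : Integrable (fun x => D x * g x) (volume.restrict (hull K.1)) := by
      refine (integrable_inner_of_memLp hDK (memLp_hull hg.continuous K.1 2)).congr
        (Filter.Eventually.of_forall fun x => ?_)
      simp [mul_comm]
    rw [integral_add i1 i2, e2] at e1
    have : ∫ x in hull K.1, g x • (H x - D x) =
        (∫ x in hull K.1, H x * g x) - ∫ x in hull K.1, D x * g x := by
      rw [← integral_sub i2 i3]
      refine integral_congr_ae (Filter.Eventually.of_forall fun x => ?_)
      simp only [smul_eq_mul]; ring
    rw [this]; linarith
  rw [← hsum w hw]
  refine integral_congr_ae ?_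
  filter_upwards [hHD] with x hx
  rw [sub_eq_zero.1 hx]

/-- The normal traces of a field with a weak divergence in `Ω` cancel on internal facets: the formulas
on the elements are summed for test functions that vanish on all other facets. -/
lemma sum_normal_trace_eq_zero (hΩ : IsOpen Ω) (hΩr : interior (closure Ω) = Ω)
    {v : Sp (n + 1) → Sp (n + 1)} {D : Sp (n + 1) → ℝ} (hv : MemLp v 2 (volume.restrict Ω))
    (hD : MemLp D 2 (volume.restrict Ω)) (hvD : HasWeakDiv Ω v D)
    {γ : M.Elem → Sp (n + 1) → Sp (n + 1)}
    (hγ : ∀ K i, HasTrace K (fun x => v x i) (fun x => γ K x i)) (F : M.IFacet)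
    {μ : Sp (n + 1) → ℝ} (hμ : Continuous μ) :
    ∑ K ∈ M.elemsOf F, facetIntegral F.1.1
      (fun x => ⟪γ K x, outwardNormal K.1 F.1.1⟫ * μ x) = 0 := by
  classical
  set ν : Measure (Sp (n + 1)) := (μHE[n] : Measure (Sp (n + 1))).restrict (hull F.1.1) with hν
  set H : Sp (n + 1) → ℝ := fun x => ∑ K ∈ M.elemsOf F, ⟪γ K x, outwardNormal K.1 F.1.1⟫ with hH
  have hi : ∀ K ∈ M.elemsOf F, MemLp (fun x => ⟪γ K x, outwardNormal K.1 F.1.1⟫) 2 ν := by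
    intro K hK
    have : (fun x => ⟪γ K x, outwardNormal K.1 F.1.1⟫) =
        fun x => ∑ i, outwardNormal K.1 F.1.1 i * γ K x i := by
      funext x
      simp [PiLp.inner_apply]
    rw [this]
    exact memLp_finsetSum _ fun i _ =>
      ((hγ K i).2.1 F.1 (mem_facetsOf.2 (mem_elemsOf.1 hK))).const_mul _
  have hHL : MemLp H 2 ν := memLp_finsetSum _ hi
  -- `Ω` without the other facets
  set U : Set (Sp (n + 1)) := Ω ∩ ⋂ F' : M.Facet, {x | F' ≠ F.1 → x ∉ hull F'.1} with hU
  have hUo : IsOpen U := by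
    refine hΩ.inter (isOpen_iInter_of_finite fun F' => ?_)
    by_cases h : F' = F.1
    · simp [h]
    · simp only [ne_eq, h, not_false_eq_true, true_imp_iff]
      exact (isCompact_hull F'.1).isClosed.isOpen_compl
  have hUae : ∀ᵐ x ∂ν, x ∈ U := by
    have a1 := ae_mem_of_isInternal hΩr F.2
    have a2 : ∀ᵐ x ∂ν, ∀ F' : M.Facet, F' ≠ F.1 → x ∉ hull F'.1 := by
      rw [ae_all_iff]
      intro F'
      by_cases h : F' = F.1
      · simp [h]
      · rw [hν, ae_restrict_iff' (isCompact_hull _).measurableSet]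
        filter_upwards [measure_eq_zero_iff_ae_notMem.1 (facet_inter_null h)] with x hx hxF _ hxF'
        exact hx ⟨hxF', hxF⟩
    filter_upwards [a1, a2] with x h1 h2
    exact ⟨h1, mem_iInter.2 h2⟩
  have hzero : ∀ᵐ x ∂ν, x ∈ U → H x = 0 := by
    refine hUo.ae_eq_zero_of_integral_contDiff_smul_eq_zero
      ((hHL.integrable (by norm_num)).locallyIntegrable.locallyIntegrableOn _) ?_
    intro g hg hgc hgs
    have hg1 : ContDiff ℝ 1 g := hg.of_le (by exact_mod_cast le_top)
    have hgΩ : IsTest Ω g := ⟨hg, hgc, hgs.trans inter_subset_left⟩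
    have e1 := fun K => integral_by_parts_of_hasWeakDiv hΩr hv hD hvD (hγ K) hg
    have hgL : MemLp g 2 (volume.restrict Ω) := (hg.continuous.memLp_of_hasCompactSupport hgc)
    have hgrc : HasCompactSupport (gradient g) := by
      have := hgc.fderiv (𝕜 := ℝ)
      exact this.comp_left (g := (InnerProductSpace.toDual ℝ (Sp (n + 1))).symm) (map_zero _)
    have hgrL : MemLp (gradient g) 2 (volume.restrict Ω) :=
      (continuous_gradient hg1).memLp_of_hasCompactSupport hgrc
    have i1 : Integrable (fun x => ⟪v x, gradient g x⟫) (volume.restrict Ω) :=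
      integrable_inner_of_memLp hv hgrL
    have i2 : Integrable (fun x => D x * g x) (volume.restrict Ω) := by
      refine (integrable_inner_of_memLp hD hgL).congr (Filter.Eventually.of_forall fun x => ?_)
      simp [mul_comm]
    have e2 : ∫ x in Ω, (⟪v x, gradient g x⟫ + D x * g x) = 0 := by
      rw [integral_add i1 i2, hvD g hgΩ]; ring
    rw [integral_eq_sum (M := M) (f := fun x => ⟪v x, gradient g x⟫ + D x * g x) hΩr
      (i1.add i2)] at e2
    simp only [e1] at e2
    -- only the facet `F` contributes
    have e3 : ∀ K : M.Elem, ∑ F' ∈ M.facetsOf K, facetIntegral F'.1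
        (fun x => g x * ⟪γ K x, outwardNormal K.1 F'.1⟫) =
        if F.1.1 ⊆ K.1 then ∫ x, g x * ⟪γ K x, outwardNormal K.1 F.1.1⟫ ∂ν else 0 := by
      intro K
      have hne : ∀ F' : M.Facet, F' ≠ F.1 → facetIntegral F'.1
          (fun x => g x * ⟪γ K x, outwardNormal K.1 F'.1⟫) = 0 := by
        intro F' hF'
        refine setIntegral_eq_zero_of_forall_eq_zero fun x hx => ?_
        have : g x = 0 := by
          by_contra hne
          exact mem_iInter.1 (hgs (subset_tsupport _ hne)).2 F' hF' hx
        rw [this, zero_mul]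
      split_ifs with h
      · rw [Finset.sum_eq_single F.1 (fun F' _ h' => hne F' h')
          (fun h' => absurd (mem_facetsOf.2 h) h')]
        rfl
      · refine Finset.sum_eq_zero fun F' hF' => hne F' ?_
        rintro rfl
        exact h (mem_facetsOf.1 hF')
    simp only [e3] at e2
    rw [← Finset.sum_filter] at e2
    have hgb : ∃ C, ∀ x, ‖g x‖ ≤ C := hgc.exists_bound_of_continuous hg.continuous
    obtain ⟨C, hC⟩ := hgb
    have e4 : ∫ x, g x • H x ∂ν =
        ∑ K ∈ M.elemsOf F, ∫ x, g x * ⟪γ K x, outwardNormal K.1 F.1.1⟫ ∂ν := by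
      rw [← integral_finsetSum]
      · simp [hH, Finset.mul_sum]
      · intro K hK
        exact ((hi K hK).integrable (by norm_num)).bdd_mul (c := C)
          hg.continuous.aestronglyMeasurable (Filter.Eventually.of_forall hC)
    rw [e4, ← e2]
    refine Finset.sum_congr ?_ fun _ _ => rfl
    ext K
    simp [mem_elemsOf]
  have hfin : ∑ K ∈ M.elemsOf F, facetIntegral F.1.1
      (fun x => ⟪γ K x, outwardNormal K.1 F.1.1⟫ * μ x) = ∫ x, H x * μ x ∂ν := by
    simp only [hH, Finset.sum_mul]
    rw [integral_finsetSum]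
    · rfl
    · intro K hK
      refine (integrable_inner_of_memLp (hi K hK) (memLp_facet hμ F.1 2)).congr
        (Filter.Eventually.of_forall fun x => ?_)
      simp [mul_comm]
  rw [hfin]
  refine integral_eq_zero_of_ae ?_
  filter_upwards [hzero, hUae] with x h1 h2
  simp [h1 h2]

end Mesh

/-! ### Bochner-Sobolev functions of time -/

section TimeCalculus
variable {X : Type} [NormedAddCommGroup X] [NormedSpace ℝ X]
variable {Y : Type} [NormedAddCommGroup Y] [NormedSpace ℝ Y]
variable {q : ℝ≥0∞} {T : ℝ} {k : ℕ} {u v : ℝ → X}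

lemma MemW.memLp (h : MemW q T k u) : MemLp u q (volume.restrict (Ioc 0 T)) := by
  cases k with
  | zero => exact h
  | succ k => exact h.1

lemma MemW.intervalIntegrable (hq : 1 ≤ q) (hT : 0 < T) (h : MemW q T k u) :
    IntervalIntegrable u volume 0 T := by
  rw [intervalIntegrable_iff_integrableOn_Ioc_of_le hT.le]
  exact h.memLp.integrable hq

lemma MemW.congr_ae (h : MemW q T 0 u) (huv : u =ᵐ[volume.restrict (Ioc 0 T)] v) :
    MemW q T 0 v := (memLp_congr_ae huv).1 h

lemma MemW.congr (h : MemW q T k u) (hT : 0 < T) (huv : ∀ t ∈ Icc 0 T, u t = v t) :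
    MemW q T k v := by
  have hae : u =ᵐ[volume.restrict (Ioc 0 T)] v :=
    (ae_restrict_mem measurableSet_Ioc).mono fun t ht => huv t (Ioc_subset_Icc_self ht)
  cases k with
  | zero => exact MemW.congr_ae h hae
  | succ k =>
    obtain ⟨h1, u', hu', h2⟩ := h
    refine ⟨(memLp_congr_ae hae).1 h1, u', hu', fun t ht => ?_⟩
    rw [← huv t ht, ← huv 0 ⟨le_rfl, hT.le⟩, h2 t ht]

lemma MemW.add (hq : 1 ≤ q) (hT : 0 < T) (hu : MemW q T k u) (hv : MemW q T k v) :
    MemW q T k (fun t => u t + v t) := by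
  induction k generalizing u v with
  | zero => exact MemLp.add hu hv
  | succ k ih =>
    obtain ⟨h1, u', hu', h2⟩ := hu
    obtain ⟨g1, v', hv', g2⟩ := hv
    refine ⟨h1.add g1, _, ih hu' hv', fun t ht => ?_⟩
    have hsub : uIcc 0 t ⊆ uIcc 0 T := by
      rw [uIcc_of_le ht.1, uIcc_of_le hT.le]; exact Icc_subset_Icc_right ht.2
    beta_reduce
    rw [h2 t ht, g2 t ht, intervalIntegral.integral_add
      ((hu'.intervalIntegrable hq hT).mono_set hsub) ((hv'.intervalIntegrable hq hT).mono_set hsub)]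
    abel

lemma MemW.clm [CompleteSpace X] [CompleteSpace Y] (hq : 1 ≤ q) (hT : 0 < T) (L : X →L[ℝ] Y)
    (hu : MemW q T k u) : MemW q T k (fun t => L (u t)) := by
  induction k generalizing u with
  | zero => exact L.comp_memLp' hu
  | succ k ih =>
    obtain ⟨h1, u', hu', h2⟩ := hu
    refine ⟨L.comp_memLp' h1, _, ih hu', fun t ht => ?_⟩
    have hsub : uIcc 0 t ⊆ uIcc 0 T := by
      rw [uIcc_of_le ht.1, uIcc_of_le hT.le]; exact Icc_subset_Icc_right ht.2
    beta_reduce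
    rw [h2 t ht, map_add, L.intervalIntegral_comp_comm
      ((hu'.intervalIntegrable hq hT).mono_set hsub)]

lemma MemW.const_mul {f : ℝ → ℝ} (hq : 1 ≤ q) (hT : 0 < T) (c : ℝ) (hf : MemW q T k f) :
    MemW q T k (fun t => c * f t) :=
  hf.clm hq hT (c • ContinuousLinearMap.id ℝ ℝ)

lemma MemW.zero : MemW q T k (fun _ => (0 : X)) := by
  induction k with
  | zero => exact MemLp.zero
  | succ k ih => exact ⟨MemLp.zero, _, ih, fun t _ => by simp⟩

lemma MemW.sum (hq : 1 ≤ q) (hT : 0 < T) {ι : Type*} (s : Finset ι) {f : ι → ℝ → X}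
    (hf : ∀ i ∈ s, MemW q T k (f i)) : MemW q T k (fun t => ∑ i ∈ s, f i t) := by
  classical
  induction s using Finset.induction_on with
  | empty => simpa using MemW.zero
  | insert i s hi ih =>
    simp only [Finset.sum_insert hi]
    exact (hf i (Finset.mem_insert_self _ _)).add hq hT
      (ih fun j hj => hf j (Finset.mem_insert_of_mem hj))

lemma MemW.continuousOn (hq : 1 ≤ q) (hT : 0 < T) (h : MemW q T (k + 1) u) :
    ContinuousOn u (Icc 0 T) := by
  obtain ⟨-, u', hu', h2⟩ := h
  have h3 := intervalIntegral.continuousOn_primitive_interval' (hu'.intervalIntegrable hq hT)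
    (left_mem_uIcc)
  rw [uIcc_of_le hT.le] at h3
  exact (h3.const_add (u 0)).congr h2

lemma hasDerivWithinAt_of_primitive [CompleteSpace X] (hv : ContinuousOn v (Icc 0 T))
    (h : ∀ t ∈ Icc 0 T, u t = u 0 + ∫ s in (0 : ℝ)..t, v s) {t : ℝ} (ht : t ∈ Icc 0 T) :
    HasDerivWithinAt u (v t) (Icc 0 T) t := by
  have : Fact (t ∈ Icc 0 T) := ⟨ht⟩
  have h1 : ContinuousOn v (uIcc 0 t) := by
    rw [uIcc_of_le ht.1]
    exact hv.mono (Icc_subset_Icc_right ht.2)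
  have h2 := intervalIntegral.integral_hasDerivWithinAt_right (s := Icc 0 T) (t := Icc 0 T)
    h1.intervalIntegrable (hv.stronglyMeasurableAtFilter_nhdsWithin measurableSet_Icc t) (hv t ht)
  exact (h2.const_add (u 0)).congr h (h t ht)

lemma ae_hasDerivAt_of_primitive [CompleteSpace X] (hT : 0 < T)
    (hv : IntervalIntegrable v volume 0 T)
    (h : ∀ t ∈ Icc 0 T, u t = u 0 + ∫ s in (0 : ℝ)..t, v s) :
    ∀ᵐ t, t ∈ Ioo 0 T → HasDerivAt u (v t) t := by
  filter_upwards [hv.ae_hasDerivAt_integral] with t h1 ht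
  have ht' : t ∈ uIcc 0 T := by rw [uIcc_of_le hT.le]; exact Ioo_subset_Icc_self ht
  refine ((h1 ht' 0 left_mem_uIcc).const_add (u 0)).congr_of_eventuallyEq ?_
  filter_upwards [isOpen_Ioo.mem_nhds ht] with s hs using h s (Ioo_subset_Icc_self hs)

lemma timeDeriv_eq_of_hasDerivAt {u' : X} {t : ℝ} (hT : 0 < T) (ht : t ∈ Ioo 0 T)
    (h : HasDerivAt u u' t) : timeDeriv T u t = u' :=
  h.hasDerivWithinAt.derivWithin (uniqueDiffOn_Icc hT t (Ioo_subset_Icc_self ht))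

/-- A function in `W^{k+2,q}` is differentiable everywhere, also at the end points. -/
lemma MemW.hasDerivWithinAt [CompleteSpace X] (hq : 1 ≤ q) (hT : 0 < T) (h : MemW q T (k + 2) u)
    {t : ℝ} (ht : t ∈ Icc 0 T) : HasDerivWithinAt u (timeDeriv T u t) (Icc 0 T) t := by
  obtain ⟨-, u', hu', h2⟩ := h
  have h4 := hasDerivWithinAt_of_primitive (hu'.continuousOn hq hT) h2 ht
  rw [timeDeriv, h4.derivWithin (uniqueDiffOn_Icc hT t ht)]
  exact h4

/-- A function in `W^{k+1,q}` is differentiable almost everywhere. -/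
lemma MemW.ae_hasDerivAt [CompleteSpace X] (hq : 1 ≤ q) (hT : 0 < T) (h : MemW q T (k + 1) u) :
    ∀ᵐ t, t ∈ Ioo 0 T → HasDerivAt u (timeDeriv T u t) t := by
  obtain ⟨-, u', hu', h2⟩ := h
  filter_upwards [ae_hasDerivAt_of_primitive hT (hu'.intervalIntegrable hq hT) h2] with t h3 ht
  rw [timeDeriv_eq_of_hasDerivAt hT ht (h3 ht)]
  exact h3 ht

lemma ae_restrict_Ioc_of_Ioo {P : ℝ → Prop} (h : ∀ᵐ t, t ∈ Ioo 0 T → P t) :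
    ∀ᵐ t ∂(volume.restrict (Ioc 0 T)), P t := by
  rw [← Measure.restrict_congr_set (Ioo_ae_eq_Ioc (a := (0 : ℝ)) (b := T)),
    ae_restrict_iff' measurableSet_Ioo]
  exact h

/-- The weak derivative is the pointwise one: almost everywhere for a function in `W^{1,q}`, and
everywhere for a function in `W^{k+2,q}`. -/
lemma MemW.timeDeriv [CompleteSpace X] (hq : 1 ≤ q) (hT : 0 < T) (h : MemW q T (k + 1) u) :
    MemW q T k (timeDeriv T u) := by
  obtain ⟨-, u', hu', h2⟩ := h
  cases k with
  | zero =>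
    refine hu'.congr_ae (ae_restrict_Ioc_of_Ioo ?_)
    filter_upwards [ae_hasDerivAt_of_primitive hT (hu'.intervalIntegrable hq hT) h2] with t h3 ht
    exact (timeDeriv_eq_of_hasDerivAt hT ht (h3 ht)).symm
  | succ k =>
    refine hu'.congr hT fun t ht => ?_
    have h4 := hasDerivWithinAt_of_primitive (hu'.continuousOn hq hT) h2 ht
    exact (h4.derivWithin (uniqueDiffOn_Icc hT t ht)).symm

lemma absolutelyContinuousOnInterval_congr {f g : ℝ → ℝ} {a b : ℝ}
    (hf : AbsolutelyContinuousOnInterval f a b) (hfg : ∀ t ∈ uIcc a b, f t = g t) :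
    AbsolutelyContinuousOnInterval g a b := by
  rw [absolutelyContinuousOnInterval_iff] at hf ⊢
  intro ε hε
  obtain ⟨δ, hδ, h⟩ := hf ε hε
  refine ⟨δ, hδ, fun E hE hs => ?_⟩
  have := h E hE hs
  refine lt_of_eq_of_lt (Finset.sum_congr rfl fun i hi => ?_) this
  rw [hfg _ (hE.1 i hi).1, hfg _ (hE.1 i hi).2]

lemma MemW.absolutelyContinuous {f : ℝ → ℝ} (hq : 1 ≤ q) (hT : 0 < T) (h : MemW q T (k + 1) f) :
    AbsolutelyContinuousOnInterval f 0 T := by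
  obtain ⟨-, f', hf', h2⟩ := h
  have h3 := (hf'.intervalIntegrable hq hT).absolutelyContinuousOnInterval_intervalIntegral
    (c := 0) left_mem_uIcc
  have hconst : AbsolutelyContinuousOnInterval (fun _ : ℝ => f 0) 0 T :=
    (LipschitzWith.const (f 0)).lipschitzOnWith.absolutelyContinuousOnInterval
  refine absolutelyContinuousOnInterval_congr (hconst.fun_add h3) fun t ht => ?_
  rw [uIcc_of_le hT.le] at ht
  exact (h2 t ht).symm

end TimeCalculus

/-! ### Functions of time with values in a finite-dimensional space -/

section FinCalculus
variable {V W Z : Type} [AddCommGroup V] [Module ℝ V] [FiniteDimensional ℝ V]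
  [AddCommGroup W] [Module ℝ W] [FiniteDimensional ℝ W] [AddCommGroup Z] [Module ℝ Z]
  [FiniteDimensional ℝ Z]
variable {q : ℝ≥0∞} {T : ℝ} {k : ℕ} {u : ℝ → V} {w : ℝ → W} {z : ℝ → Z}

/-- Time derivative on `[0,T]` of a function with values in a finite-dimensional space, taken
coordinatewise. -/
def finDeriv (T : ℝ) (u : ℝ → V) (t : ℝ) : V :=
  ∑ i, timeDeriv T (fun s => (Module.finBasis ℝ V).repr (u s) i) t • Module.finBasis ℝ V i

lemma linear_eq_sum (l : V →ₗ[ℝ] ℝ) (x : V) :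
    l x = ∑ i, l (Module.finBasis ℝ V i) * (Module.finBasis ℝ V).repr x i := by
  conv_lhs => rw [← (Module.finBasis ℝ V).sum_repr x]
  simp only [map_sum, map_smul, smul_eq_mul, mul_comm]

lemma linear_finDeriv (l : V →ₗ[ℝ] ℝ) (u : ℝ → V) (t : ℝ) :
    l (finDeriv T u t) = ∑ i, l (Module.finBasis ℝ V i) *
      timeDeriv T (fun s => (Module.finBasis ℝ V).repr (u s) i) t := by
  simp [finDeriv, map_sum, mul_comm]

/-- `u` has the derivative `u'` at `t` within `s`, tested with linear functionals. -/
def HasFinDerivAt (u : ℝ → V) (u' : V) (s : Set ℝ) (t : ℝ) : Prop :=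
  ∀ l : V →ₗ[ℝ] ℝ, HasDerivWithinAt (fun r => l (u r)) (l u') s t

lemma MemWFin.coord (h : MemWFin q T k u) (i) :
    MemW q T k (fun s => (Module.finBasis ℝ V).repr (u s) i) :=
  h ((Module.finBasis ℝ V).coord i)

lemma hasFinDerivAt_finDeriv {s : Set ℝ} {t : ℝ}
    (h : ∀ i, HasDerivWithinAt (fun s => (Module.finBasis ℝ V).repr (u s) i)
      (timeDeriv T (fun s => (Module.finBasis ℝ V).repr (u s) i) t) s t) :
    HasFinDerivAt u (finDeriv T u t) s t := by
  intro l
  rw [linear_finDeriv]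
  have h1 := HasDerivWithinAt.fun_sum (u := Finset.univ) fun i _ =>
    (h i).const_mul (l (Module.finBasis ℝ V i))
  refine h1.congr_of_eventuallyEq ?_ ?_
  · exact Filter.Eventually.of_forall fun r => linear_eq_sum l (u r)
  · exact linear_eq_sum l (u t)

lemma MemWFin.hasFinDerivAt (hq : 1 ≤ q) (hT : 0 < T) (h : MemWFin q T (k + 2) u) {t : ℝ}
    (ht : t ∈ Icc 0 T) : HasFinDerivAt u (finDeriv T u t) (Icc 0 T) t :=
  hasFinDerivAt_finDeriv fun i => (h.coord i).hasDerivWithinAt hq hT ht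

lemma MemWFin.ae_hasFinDerivAt (hq : 1 ≤ q) (hT : 0 < T) (h : MemWFin q T (k + 1) u) :
    ∀ᵐ t, t ∈ Ioo 0 T → HasFinDerivAt u (finDeriv T u t) univ t := by
  have h1 : ∀ᵐ t, ∀ i, t ∈ Ioo 0 T →
      HasDerivAt (fun s => (Module.finBasis ℝ V).repr (u s) i)
      (timeDeriv T (fun s => (Module.finBasis ℝ V).repr (u s) i) t) t :=
    ae_all_iff.2 fun i => (h.coord i).ae_hasDerivAt hq hT
  filter_upwards [h1] with t h2 ht
  exact hasFinDerivAt_finDeriv fun i => (h2 i ht).hasDerivWithinAt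

lemma MemWFin.finDeriv (hq : 1 ≤ q) (hT : 0 < T) (h : MemWFin q T (k + 1) u) :
    MemWFin q T k (finDeriv T u) := by
  intro l
  simp only [linear_finDeriv]
  exact MemW.sum hq hT _ fun i _ => ((h.coord i).timeDeriv hq hT).const_mul hq hT _

lemma HasFinDerivAt.sub {u₁ u₂ : ℝ → V} {u₁' u₂' : V} {s : Set ℝ} {t : ℝ}
    (h₁ : HasFinDerivAt u₁ u₁' s t) (h₂ : HasFinDerivAt u₂ u₂' s t) :
    HasFinDerivAt (fun r => u₁ r - u₂ r) (u₁' - u₂') s t := by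
  intro l
  simpa only [map_sub] using (h₁ l).fun_sub (h₂ l)

lemma MemWFin.sub (hq : 1 ≤ q) (hT : 0 < T) {u₁ u₂ : ℝ → V} (h₁ : MemWFin q T k u₁)
    (h₂ : MemWFin q T k u₂) : MemWFin q T k (fun r => u₁ r - u₂ r) := by
  intro l
  have := (h₁ l).add hq hT ((h₂ l).const_mul hq hT (-1))
  simpa [sub_eq_add_neg] using this

/-- Uniqueness of derivatives of functions with values in a finite-dimensional space. -/
lemma HasFinDerivAt.unique {u' u'' : V} {s : Set ℝ} {t : ℝ} (hs : UniqueDiffWithinAt ℝ s t)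
    (h₁ : HasFinDerivAt u u' s t) (h₂ : HasFinDerivAt u u'' s t) : u' = u'' := by
  rw [← sub_eq_zero, ← Module.forall_dual_apply_eq_zero_iff ℝ]
  intro l
  rw [map_sub, sub_eq_zero, ← (h₁ l).derivWithin hs, ← (h₂ l).derivWithin hs]

/-- Regularity in time can be checked on any family of functionals which separates points. -/
lemma MemWFin.of_separating (hq : 1 ≤ q) (hT : 0 < T) (S : Set (V →ₗ[ℝ] ℝ))
    (hS : ∀ x, (∀ l ∈ S, l x = 0) → x = 0) (h : ∀ l ∈ S, MemW q T k (fun t => l (u t))) :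
    MemWFin q T k u := by
  have htop : Submodule.span ℝ S = ⊤ := by
    have h1 := Subspace.dualCoannihilator_dualAnnihilator_eq (K := ℝ) (V := V)
      (W := Submodule.span ℝ S)
    have h2 : (Submodule.span ℝ S).dualCoannihilator = ⊥ := by
      rw [eq_bot_iff]
      intro x hx
      rw [Submodule.mem_dualCoannihilator] at hx
      exact hS x fun l hl => hx l (Submodule.subset_span hl)
    rw [h2, Submodule.dualAnnihilator_bot] at h1
    exact h1.symm
  intro l
  have hl : l ∈ Submodule.span ℝ S := by rw [htop]; trivial
  induction hl using Submodule.span_induction with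
  | mem l hl => exact h l hl
  | zero => simpa using MemW.zero
  | add l₁ l₂ _ _ h₁ h₂ => simpa using h₁.add hq hT h₂
  | smul c l _ h => simpa using h.const_mul hq hT c

lemma bilinear_eq_sum (B : V →ₗ[ℝ] W →ₗ[ℝ] ℝ) (x : V) (y : W) :
    B x y = ∑ i, (Module.finBasis ℝ V).repr x i * B (Module.finBasis ℝ V i) y := by
  conv_lhs => rw [← (Module.finBasis ℝ V).sum_repr x]
  simp only [map_sum, map_smul, LinearMap.sum_apply, LinearMap.smul_apply, smul_eq_mul]

/-- The product rule for bilinear forms. -/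
lemma HasFinDerivAt.bilinear (B : V →ₗ[ℝ] W →ₗ[ℝ] ℝ) {u' : V} {w' : W} {s : Set ℝ} {t : ℝ}
    (hu : HasFinDerivAt u u' s t) (hw : HasFinDerivAt w w' s t) :
    HasDerivWithinAt (fun r => B (u r) (w r)) (B u' (w t) + B (u t) w') s t := by
  have h1 := HasDerivWithinAt.fun_sum (u := Finset.univ) fun i _ =>
    (hu ((Module.finBasis ℝ V).coord i)).fun_mul (hw (B (Module.finBasis ℝ V i)))
  simp only [Module.Basis.coord_apply] at h1
  rw [bilinear_eq_sum B u', bilinear_eq_sum B (u t), ← Finset.sum_add_distrib]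
  refine h1.congr_of_eventuallyEq ?_ ?_
  · exact Filter.Eventually.of_forall fun r => bilinear_eq_sum B (u r) (w r)
  · exact bilinear_eq_sum B (u t) (w t)

lemma trilinear_eq_sum (C : V →ₗ[ℝ] W →ₗ[ℝ] Z →ₗ[ℝ] ℝ) (x : V) (y : W) (a : Z) :
    C x y a = ∑ i, (Module.finBasis ℝ V).repr x i * C (Module.finBasis ℝ V i) y a := by
  conv_lhs => rw [← (Module.finBasis ℝ V).sum_repr x]
  simp only [map_sum, map_smul, LinearMap.sum_apply, LinearMap.smul_apply, smul_eq_mul]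

lemma HasFinDerivAt.trilinear (C : V →ₗ[ℝ] W →ₗ[ℝ] Z →ₗ[ℝ] ℝ) {u' : V} {w' : W} {z' : Z}
    {s : Set ℝ} {t : ℝ} (hu : HasFinDerivAt u u' s t) (hw : HasFinDerivAt w w' s t)
    (hz : HasFinDerivAt z z' s t) :
    HasDerivWithinAt (fun r => C (u r) (w r) (z r))
      (C u' (w t) (z t) + C (u t) w' (z t) + C (u t) (w t) z') s t := by
  have h1 := HasDerivWithinAt.fun_sum (u := Finset.univ) fun i _ =>
    (hu ((Module.finBasis ℝ V).coord i)).fun_mul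
      (HasFinDerivAt.bilinear (C (Module.finBasis ℝ V i)) hw hz)
  simp only [Module.Basis.coord_apply] at h1
  rw [trilinear_eq_sum C u', trilinear_eq_sum C (u t) w', trilinear_eq_sum C (u t) (w t) z',
    ← Finset.sum_add_distrib, ← Finset.sum_add_distrib]
  simp only [mul_add, ← add_assoc] at h1
  refine h1.congr_of_eventuallyEq ?_ ?_
  · exact Filter.Eventually.of_forall fun r => trilinear_eq_sum C (u r) (w r) (z r)
  · exact trilinear_eq_sum C (u t) (w t) (z t)

lemma absolutelyContinuousOnInterval_sum {ι : Type*} (s : Finset ι) {f : ι → ℝ → ℝ} {a b : ℝ}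
    (hf : ∀ i ∈ s, AbsolutelyContinuousOnInterval (f i) a b) :
    AbsolutelyContinuousOnInterval (fun t => ∑ i ∈ s, f i t) a b := by
  classical
  induction s using Finset.induction_on with
  | empty =>
    simp only [Finset.sum_empty]
    exact (LipschitzWith.const (0 : ℝ)).lipschitzOnWith.absolutelyContinuousOnInterval
  | insert i s hi ih =>
    simp only [Finset.sum_insert hi]
    exact (hf i (Finset.mem_insert_self _ _)).fun_add
      (ih fun j hj => hf j (Finset.mem_insert_of_mem hj))

/-- `u` is absolutely continuous on `[0,T]`, tested with linear functionals. -/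
def IsFinAC (T : ℝ) (u : ℝ → V) : Prop :=
  ∀ l : V →ₗ[ℝ] ℝ, AbsolutelyContinuousOnInterval (fun t => l (u t)) 0 T

lemma MemWFin.isFinAC (hq : 1 ≤ q) (hT : 0 < T) (h : MemWFin q T (k + 1) u) : IsFinAC T u :=
  fun l => (h l).absolutelyContinuous hq hT

lemma IsFinAC.bilinear (B : V →ₗ[ℝ] W →ₗ[ℝ] ℝ) (hu : IsFinAC T u) (hw : IsFinAC T w) :
    AbsolutelyContinuousOnInterval (fun t => B (u t) (w t)) 0 T := by
  rw [funext fun t => bilinear_eq_sum B (u t) (w t)]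
  exact absolutelyContinuousOnInterval_sum _ fun i _ =>
    (hu ((Module.finBasis ℝ V).coord i)).fun_mul (hw (B (Module.finBasis ℝ V i)))

lemma IsFinAC.trilinear (C : V →ₗ[ℝ] W →ₗ[ℝ] Z →ₗ[ℝ] ℝ) (hu : IsFinAC T u) (hw : IsFinAC T w)
    (hz : IsFinAC T z) : AbsolutelyContinuousOnInterval (fun t => C (u t) (w t) (z t)) 0 T := by
  rw [funext fun t => trilinear_eq_sum C (u t) (w t) (z t)]
  exact absolutelyContinuousOnInterval_sum _ fun i _ =>
    (hu ((Module.finBasis ℝ V).coord i)).fun_mul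
      (IsFinAC.bilinear (C (Module.finBasis ℝ V i)) hw hz)

end FinCalculus

/-- A Grönwall type estimate in which the growth factor has integral less than one. The inequality is
integrated up to the time at which `E` is maximal, and the growth term is absorbed. -/
theorem le_of_ae_deriv_le {T σ : ℝ} (hT : 0 < T) (hσ : σ < 1) {E E' β H : ℝ → ℝ}
    (hE : AbsolutelyContinuousOnInterval E 0 T) (hE0 : ∀ t ∈ Icc 0 T, 0 ≤ E t)
    (hd : ∀ᵐ t, t ∈ Ioo 0 T → HasDerivAt E (E' t) t)
    (hle : ∀ᵐ t, t ∈ Ioo 0 T → E' t ≤ β t * E t + H t)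
    (hβ : IntervalIntegrable β volume 0 T) (hβ0 : ∀ t, 0 ≤ β t)
    (hH : IntervalIntegrable H volume 0 T) (hH0 : ∀ t, 0 ≤ H t)
    (hβσ : ∫ t in (0 : ℝ)..T, β t ≤ σ) {t : ℝ} (ht : t ∈ Icc 0 T) :
    E t ≤ (1 - σ)⁻¹ * (E 0 + ∫ s in (0 : ℝ)..T, H s) := by
  have hEc := hE.continuousOn
  rw [uIcc_of_le hT.le] at hEc
  -- the time at which the energy is maximal
  obtain ⟨m, hm, hmax⟩ := isCompact_Icc.exists_isMaxOn ⟨(0 : ℝ), ⟨le_rfl, hT.le⟩⟩ hEc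
  have hsub : uIcc 0 m ⊆ uIcc 0 T := by
    rw [uIcc_of_le hm.1, uIcc_of_le hT.le]; exact Icc_subset_Icc_right hm.2
  have hEm := hE.mono hsub
  have h1 := hEm.integral_deriv_eq_sub
  have hβm := hβ.mono_set hsub
  have hHm := hH.mono_set hsub
  have h2 : ∫ s in (0 : ℝ)..m, deriv E s ≤ ∫ s in (0 : ℝ)..m, (β s * E m + H s) := by
    refine intervalIntegral.integral_mono_ae_restrict hm.1 hEm.intervalIntegrable_deriv
      ((hβm.mul_const _).add hHm) ?_
    have h0 : ∀ᵐ s : ℝ, s ≠ 0 := by simp [ae_iff, measure_singleton]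
    have hT' : ∀ᵐ s : ℝ, s ≠ T := by simp [ae_iff, measure_singleton]
    rw [Filter.EventuallyLE, ae_restrict_iff' measurableSet_Icc]
    filter_upwards [hd, hle, h0, hT'] with s a1 a2 a3 a4 hs
    have hsI : s ∈ Ioo 0 T := ⟨lt_of_le_of_ne hs.1 a3.symm,
      lt_of_le_of_ne (hs.2.trans hm.2) a4⟩
    rw [(a1 hsI).deriv]
    refine (a2 hsI).trans ?_
    have := hmax (Ioo_subset_Icc_self hsI)
    simp only [mem_ofPred_eq] at this
    have := mul_le_mul_of_nonneg_left this (hβ0 s)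
    linarith
  rw [h1, intervalIntegral.integral_add (hβm.mul_const _) hHm,
    intervalIntegral.integral_mul_const] at h2
  have hmono : ∀ f : ℝ → ℝ, IntervalIntegrable f volume 0 T → (∀ t, 0 ≤ f t) →
      ∫ s in (0 : ℝ)..m, f s ≤ ∫ s in (0 : ℝ)..T, f s := by
    intro f hf hf0
    refine intervalIntegral.integral_mono_interval le_rfl hm.1 hm.2 ?_ hf
    exact Filter.Eventually.of_forall hf0
  have h3 := (hmono β hβ hβ0).trans hβσ
  have h4 := hmono H hH hH0
  have h5 := mul_le_mul_of_nonneg_right h3 (hE0 m hm)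
  have h6 : (1 - σ) * E m ≤ E 0 + ∫ s in (0 : ℝ)..T, H s := by nlinarith
  have h7 : E t ≤ E m := hmax ht
  have h8 : 0 < 1 - σ := by linarith
  refine h7.trans ?_
  rw [inv_mul_eq_div, le_div_iff₀ h8]
  linarith

/-! ### The energy estimate at a fixed time -/

set_option maxHeartbeats 1000000 in
/-- The energy estimate at a fixed time. The error equation for the flux is tested with
`V + (δ/c²) V'`, the wave equation with `z`, and the equation on the skeleton together with its
time derivative with `l'`. Then `Φ z`, `D V` and `D V'` are estimated by Young's inequality, with
`D V'` absorbed in the dissipation `δ ‖V'‖²`. The case `θ = 0` is the estimate of low order, the case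
`θ = 1` the one for the equations that have been differentiated in time. -/
theorem energy_rate_le {S Q Λ : Type*} [AddCommGroup S] [Module ℝ S] [AddCommGroup Q] [Module ℝ Q]
    [AddCommGroup Λ] [Module ℝ Λ]
    (A A' m₀ s : S →ₗ[ℝ] S →ₗ[ℝ] ℝ) (mv : Q →ₗ[ℝ] Q →ₗ[ℝ] ℝ) (b : S →ₗ[ℝ] Q →ₗ[ℝ] ℝ)
    (e : Λ →ₗ[ℝ] Q →ₗ[ℝ] ℝ) (f : Λ →ₗ[ℝ] S →ₗ[ℝ] ℝ) (g : Λ →ₗ[ℝ] Λ →ₗ[ℝ] ℝ)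
    (D : Q → ℝ) (Φ : S → ℝ) {c δ θ k a₀ a₁ N Nφ γ T : ℝ} (hc : 0 < c) (hδ : 0 ≤ δ)
    (ha₀ : 0 < a₀) (ha₁ : 0 ≤ a₁) (hγ : 0 < γ) (hT : 0 < T) (hθ : θ = 0 ∨ θ = 1)
    (ψ z z' : S) (V V' : Q) (l l' : Λ)
    (h₁ : ∀ r, mv V' r + b z r + e l' r = D r)
    (h₂ : ∀ w, A z' w + θ * A' z w - c ^ 2 * b w (V + (δ / c ^ 2) • V')
      + c ^ 2 * s (ψ + (δ / c ^ 2) • z) w + c ^ 2 * f (l + (δ / c ^ 2) • l') w = Φ w)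
    (h₃ : ∀ μ, - e μ V + f μ ψ + g l μ = 0) (h₃' : ∀ μ, - e μ V' + f μ z + g l' μ = 0)
    (hD : ∀ r, |D r| ≤ N * √(mv r r)) (hDadd : ∀ r r', D (r + r') = D r + D r')
    (hDsmul : ∀ (a : ℝ) r, D (a • r) = a * D r)
    (hΦ : |Φ z| ≤ Nφ * √(m₀ z z)) (hA' : |A' z z| ≤ 2 * |k| * a₁ * m₀ z z)
    (hA : a₀ * m₀ z z ≤ A z z) (hm₀ : 0 ≤ m₀ z z) (hmv : ∀ r, 0 ≤ mv r r)
    (hP : 0 ≤ s ψ ψ + 2 * f l ψ + g l l) (hP' : 0 ≤ s z z + 2 * f l' z + g l' l') :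
    A z' z + 1 / 2 * A' z z + c ^ 2 * (mv V' V + (s ψ z + f l z + f l' ψ + g l l'))
      ≤ (2 * |k| / a₀ * a₁ + γ / T) *
          (1 / 2 * A z z + c ^ 2 / 2 * (mv V V + (s ψ ψ + 2 * f l ψ + g l l)))
        + (T / (2 * γ * a₀) * Nφ ^ 2 + (δ / 4 + c ^ 2 * T / (2 * γ)) * N ^ 2) := by
  have hc2 : 0 < c ^ 2 := by positivity
  have e1 := h₁ (V + (δ / c ^ 2) • V')
  have e2 := h₂ z
  have e3 := h₃ l'
  have e3' := h₃' l'
  rw [hDadd, hDsmul] at e1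
  simp only [map_add, map_smul, LinearMap.add_apply, LinearMap.smul_apply, smul_eq_mul] at e1 e2
  -- the energy identity
  have key : A z' z + 1 / 2 * A' z z + c ^ 2 * (mv V' V + (s ψ z + f l z + f l' ψ + g l l'))
      = Φ z + c ^ 2 * D V + δ * D V' + (1 / 2 - θ) * A' z z - δ * mv V' V'
        - δ * (s z z + 2 * f l' z + g l' l') := by
    have hk : c ^ 2 * (δ / c ^ 2) = δ := by field_simp
    generalize hκ : δ / c ^ 2 = κ at *
    rw [← hk]
    linear_combination e2 + c ^ 2 * e1 + c ^ 2 * e3 + c ^ 2 * κ * e3'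
  rw [key]
  have b1 : Φ z ≤ T / (2 * γ * a₀) * Nφ ^ 2 + γ / T * (1 / 2 * A z z) := by
    have h1 := (le_abs_self _).trans hΦ
    have h2 : Nφ * √(m₀ z z) ≤ T / (2 * γ * a₀) * Nφ ^ 2 + γ / T * (1 / 2 * (a₀ * m₀ z z)) := by
      have h3 : 0 ≤ T / (2 * γ * a₀) * (Nφ - γ * a₀ / T * √(m₀ z z)) ^ 2 := by positivity
      have h4 : T / (2 * γ * a₀) * (Nφ - γ * a₀ / T * √(m₀ z z)) ^ 2
          = T / (2 * γ * a₀) * Nφ ^ 2 - Nφ * √(m₀ z z)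
            + γ / T * (1 / 2 * (a₀ * √(m₀ z z) ^ 2)) := by field_simp; ring
      rw [Real.sq_sqrt hm₀] at h4
      linarith
    have h5 : γ / T * (1 / 2 * (a₀ * m₀ z z)) ≤ γ / T * (1 / 2 * A z z) := by gcongr
    linarith
  have b2 : c ^ 2 * D V ≤ c ^ 2 * T / (2 * γ) * N ^ 2 + γ / T * (c ^ 2 / 2 * mv V V) := by
    have h1 := mul_le_mul_of_nonneg_left ((le_abs_self _).trans (hD V)) hc2.le
    have h3 : 0 ≤ c ^ 2 * T / (2 * γ) * (N - γ / T * √(mv V V)) ^ 2 := by positivity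
    have h4 : c ^ 2 * T / (2 * γ) * (N - γ / T * √(mv V V)) ^ 2
        = c ^ 2 * T / (2 * γ) * N ^ 2 - c ^ 2 * (N * √(mv V V))
          + γ / T * (c ^ 2 / 2 * √(mv V V) ^ 2) := by field_simp; ring
    rw [Real.sq_sqrt (hmv V)] at h4
    linarith
  have b3 : δ * D V' - δ * mv V' V' ≤ δ / 4 * N ^ 2 := by
    have h1 := (le_abs_self _).trans (hD V')
    have h2 := sq_nonneg (N / 2 - √(mv V' V'))
    have h3 := Real.sq_sqrt (hmv V')
    have h4 : D V' - mv V' V' ≤ N ^ 2 / 4 := by nlinarith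
    have h5 := mul_le_mul_of_nonneg_left h4 hδ
    linarith
  have b4 : (1 / 2 - θ) * A' z z ≤ 2 * |k| / a₀ * a₁ * (1 / 2 * A z z) := by
    have h1 : (1 / 2 - θ) * A' z z ≤ 1 / 2 * |A' z z| := by
      rcases hθ with rfl | rfl
      · linarith [le_abs_self (A' z z)]
      · linarith [neg_abs_le (A' z z)]
    have h2 : 2 * |k| * a₁ * m₀ z z ≤ 2 * |k| * a₁ * (A z z / a₀) := by
      have : m₀ z z ≤ A z z / a₀ := by rw [le_div_iff₀ ha₀]; linarith
      gcongr
    have h3 : 2 * |k| * a₁ * (A z z / a₀) = 2 * |k| / a₀ * a₁ * A z z := by ring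
    linarith
  have b5 : 0 ≤ δ * (s z z + 2 * f l' z + g l' l') := mul_nonneg hδ hP'
  have b6 : 0 ≤ γ / T * (c ^ 2 / 2 * (s ψ ψ + 2 * f l ψ + g l l)) := by positivity
  have b7 : 0 ≤ 2 * |k| / a₀ * a₁ * (c ^ 2 / 2 * (mv V V + (s ψ ψ + 2 * f l ψ + g l l))) := by
    have := hmv V
    positivity
  -- the growth factor times the energy, term by term
  have b8 : ∀ x y P R : ℝ, (x + y) * (P + R) = x * P + y * P + x * R + y * R := by
    intros; ring
  rw [b8, mul_add (c ^ 2 / 2), mul_add (γ / T)] at *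
  linarith

/-! ### Polynomial functions -/

section Polynomials
variable {d m : ℕ}

/-- The polynomial function on `ℝ^d` that is given by a polynomial. -/
def polyFun (d : ℕ) : MvPolynomial (Fin d) ℝ →ₗ[ℝ] (Sp d → ℝ) :=
  LinearMap.pi fun x : Sp d => (MvPolynomial.aeval fun i => x i).toLinearMap

lemma polyFun_apply (P : MvPolynomial (Fin d) ℝ) (x : Sp d) :
    polyFun d P x = MvPolynomial.aeval (fun i => x i) P := rfl

lemma polyFun_mul (P Q : MvPolynomial (Fin d) ℝ) (x : Sp d) :
    polyFun d (P * Q) x = polyFun d P x * polyFun d Q x := by simp [polyFun_apply]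

/-- A description of `polySpace` by monomials of degree less than `m`, which needs no case
distinction at `m = 0`. -/
lemma polySpace_eq_map : ∀ m : ℕ, polySpace d m =
    (MvPolynomial.restrictSupport ℝ {s : Fin d →₀ ℕ | s.degree < m}).map (polyFun d)
  | 0 => by
    simp only [Nat.not_lt_zero, Set.ofPred_false]
    rw [MvPolynomial.restrictSupport_eq_span]
    simp [polySpace]
  | m + 1 => by
    have : MvPolynomial.restrictTotalDegree (Fin d) ℝ m =
        MvPolynomial.restrictSupport ℝ {s : Fin d →₀ ℕ | s.degree < m + 1} := by
      simp only [Nat.lt_succ_iff]; rfl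
    rw [← this]; rfl

lemma polyFun_mem {P : MvPolynomial (Fin d) ℝ}
    (h : P ∈ MvPolynomial.restrictSupport ℝ {s : Fin d →₀ ℕ | s.degree < m}) :
    polyFun d P ∈ polySpace d m := by
  rw [polySpace_eq_map]; exact Submodule.mem_map_of_mem h

lemma polySpace_mono {m' : ℕ} (h : m ≤ m') : polySpace d m ≤ polySpace d m' := by
  rw [polySpace_eq_map, polySpace_eq_map]
  exact Submodule.map_mono (MvPolynomial.restrictSupport_mono _ fun s hs => lt_of_lt_of_le hs h)

instance : FiniteDimensional ℝ (polySpace d m) := by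
  cases m with
  | zero => exact inferInstanceAs (FiniteDimensional ℝ (⊥ : Submodule ℝ (Sp d → ℝ)))
  | succ m => exact inferInstanceAs (FiniteDimensional ℝ
      ((MvPolynomial.restrictTotalDegree (Fin d) ℝ m).map (polyFun d)))

lemma analyticOnNhd_polyFun (P : MvPolynomial (Fin d) ℝ) : AnalyticOnNhd ℝ (polyFun d P) univ :=
  AnalyticOnNhd.aeval_mvPolynomial
    (fun i x _ => (EuclideanSpace.proj i : Sp d →L[ℝ] ℝ).analyticAt x) P

lemma analyticOnNhd_of_mem_polySpace {f : Sp d → ℝ} (hf : f ∈ polySpace d m) :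
    AnalyticOnNhd ℝ f univ := by
  rw [polySpace_eq_map] at hf
  obtain ⟨P, -, rfl⟩ := hf
  exact analyticOnNhd_polyFun P

lemma contDiff_of_mem_polySpace {f : Sp d → ℝ} (hf : f ∈ polySpace d m) : ContDiff ℝ ∞ f :=
  (analyticOnNhd_of_mem_polySpace hf).contDiff

lemma continuous_of_mem_polySpace {f : Sp d → ℝ} (hf : f ∈ polySpace d m) : Continuous f :=
  (contDiff_of_mem_polySpace hf).continuous

/-- A polynomial vanishes if it vanishes on a nonempty open set. -/
lemma eq_zero_of_mem_polySpace {f : Sp d → ℝ} (hf : f ∈ polySpace d m) {U : Set (Sp d)}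
    (hU : IsOpen U) (hne : U.Nonempty) (h : ∀ x ∈ U, f x = 0) : f = 0 := by
  obtain ⟨x, hx⟩ := hne
  refine (analyticOnNhd_of_mem_polySpace hf).eq_of_eventuallyEq (z₀ := x)
    (fun x _ => analyticAt_const) ?_
  filter_upwards [hU.mem_nhds hx] with y hy using h y hy

lemma fderiv_polyFun (P : MvPolynomial (Fin d) ℝ) (x y : Sp d) :
    fderiv ℝ (polyFun d P) x y = ∑ i, y i * polyFun d (MvPolynomial.pderiv i P) x := by
  have hdiff : ∀ P : MvPolynomial (Fin d) ℝ, DifferentiableAt ℝ (polyFun d P) x := fun P =>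
    (analyticOnNhd_polyFun P x trivial).differentiableAt
  induction P using MvPolynomial.induction_on with
  | C a =>
    have h : polyFun d (MvPolynomial.C a) = fun _ => a := by ext x; simp [polyFun_apply]
    rw [h]; simp
  | add P Q hP hQ =>
    rw [map_add, fderiv_add (hdiff P) (hdiff Q), add_apply, hP, hQ,
      ← Finset.sum_add_distrib]
    refine Finset.sum_congr rfl fun i _ => ?_
    rw [map_add, map_add, Pi.add_apply]; ring
  | mul_X P j hP =>
    have h : polyFun d (P * MvPolynomial.X j) = fun x => polyFun d P x * x j := by
      ext x; simp [polyFun_apply]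
    have hj : HasFDerivAt (fun x : Sp d => x j)
        (EuclideanSpace.proj j : Sp d →L[ℝ] ℝ) x :=
      (EuclideanSpace.proj j : Sp d →L[ℝ] ℝ).hasFDerivAt
    rw [h, fderiv_fun_mul (hdiff P) hj.differentiableAt, hj.fderiv]
    simp only [add_apply, smul_apply, smul_eq_mul, hP, PiLp.proj_apply]
    have hterm : ∀ i, y i * polyFun d (MvPolynomial.pderiv i (P * MvPolynomial.X j)) x =
        x j * (y i * polyFun d (MvPolynomial.pderiv i P) x) +
          (if i = j then y j * polyFun d P x else 0) := by
      intro i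
      rw [MvPolynomial.pderiv_mul, map_add, Pi.add_apply, polyFun_mul, polyFun_mul]
      split_ifs with hij
      · subst hij
        simp [polyFun_apply]; ring
      · rw [MvPolynomial.pderiv_X_of_ne (Ne.symm hij)]
        simp [polyFun_apply]; ring
    rw [Finset.sum_congr rfl fun i _ => hterm i, Finset.sum_add_distrib, ← Finset.mul_sum]
    simp
    ring

lemma pderiv_mem_restrictSupport {P : MvPolynomial (Fin d) ℝ}
    (h : P ∈ MvPolynomial.restrictSupport ℝ {s : Fin d →₀ ℕ | s.degree < m + 1}) (i : Fin d) :
    MvPolynomial.pderiv i P ∈ MvPolynomial.restrictSupport ℝ {s : Fin d →₀ ℕ | s.degree < m} := by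
  rw [MvPolynomial.restrictSupport_eq_span] at h
  induction h using Submodule.span_induction with
  | mem P hP =>
    obtain ⟨s, hs, rfl⟩ := hP
    simp only [MvPolynomial.pderiv_monomial, MvPolynomial.monomial_mem_restrictSupport]
    by_cases hi : s i = 0
    · right; simp [hi]
    · left
      have h1 : Finsupp.single i 1 ≤ s := by
        rw [Finsupp.single_le_iff]; omega
      have h2 : (s - Finsupp.single i 1).degree + (Finsupp.single i 1).degree = s.degree := by
        rw [← map_add, tsub_add_cancel_of_le h1]
      simp only [Finsupp.degree_single, mem_ofPred_eq] at h2 hs ⊢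
      omega
  | zero => simp
  | add P Q _ _ hP hQ => rw [map_add]; exact add_mem hP hQ
  | smul c P _ hP => rw [Derivation.map_smul]; exact Submodule.smul_mem _ c hP

/-- Directional derivatives lower the degree. -/
lemma fderiv_mem_polySpace {f : Sp d → ℝ} (hf : f ∈ polySpace d (m + 1)) (y : Sp d) :
    (fun x => fderiv ℝ f x y) ∈ polySpace d m := by
  rw [polySpace_eq_map] at hf
  obtain ⟨P, hP, rfl⟩ := hf
  have : (fun x => fderiv ℝ (polyFun d P) x y) =
      ∑ i, y i • polyFun d (MvPolynomial.pderiv i P) := by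
    ext x; simp [fderiv_polyFun]
  rw [this]
  exact Submodule.sum_mem _ fun i _ => Submodule.smul_mem _ _
    (polyFun_mem (pderiv_mem_restrictSupport hP i))

lemma euler_mem_restrictSupport {P : MvPolynomial (Fin d) ℝ}
    (h : P ∈ MvPolynomial.restrictSupport ℝ {s : Fin d →₀ ℕ | s.degree < m + 1}) :
    ∑ i, MvPolynomial.X i * MvPolynomial.pderiv i P - (m : ℝ) • P ∈
      MvPolynomial.restrictSupport ℝ {s : Fin d →₀ ℕ | s.degree < m} := by
  rw [MvPolynomial.restrictSupport_eq_span] at h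
  induction h using Submodule.span_induction with
  | mem P hP =>
    obtain ⟨s, hs, rfl⟩ := hP
    simp only [MvPolynomial.X_mul_pderiv_monomial]
    have h1 : ∑ i, s i • MvPolynomial.monomial s (1 : ℝ) =
        (s.degree : ℝ) • MvPolynomial.monomial s (1 : ℝ) := by
      rw [← Finset.sum_smul, Finsupp.degree_eq_sum, Nat.cast_smul_eq_nsmul]
    rw [h1, ← sub_smul, MvPolynomial.smul_monomial, MvPolynomial.monomial_mem_restrictSupport]
    rcases lt_or_eq_of_le (Nat.lt_succ_iff.1 hs) with h2 | h2
    · exact Or.inl h2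
    · right; simp [h2]
  | zero => simp
  | add P Q _ _ hP hQ =>
    have h1 : ∑ i, MvPolynomial.X i * MvPolynomial.pderiv i (P + Q) - (m : ℝ) • (P + Q) =
        (∑ i, MvPolynomial.X i * MvPolynomial.pderiv i P - (m : ℝ) • P) +
        (∑ i, MvPolynomial.X i * MvPolynomial.pderiv i Q - (m : ℝ) • Q) := by
      simp only [map_add, mul_add, Finset.sum_add_distrib, smul_add]; abel
    rw [h1]; exact add_mem hP hQ
  | smul c P _ hP =>
    have h1 : ∑ i, MvPolynomial.X i * MvPolynomial.pderiv i (c • P) - (m : ℝ) • (c • P) =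
        c • (∑ i, MvPolynomial.X i * MvPolynomial.pderiv i P - (m : ℝ) • P) := by
      simp only [Derivation.map_smul, mul_smul_comm, smul_sub, Finset.smul_sum,
        smul_comm c (m : ℝ)]
    rw [h1]; exact Submodule.smul_mem _ c hP

/-- Euler's identity for the leading part: the radial derivative of a polynomial `f` of degree at
most `m` is `m * f` up to terms of lower degree. -/
lemma euler_mem_polySpace {f : Sp d → ℝ} (hf : f ∈ polySpace d (m + 1)) (a : Sp d) :
    (fun x => fderiv ℝ f x (x - a) - m * f x) ∈ polySpace d m := by
  have h1 := fderiv_mem_polySpace hf a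
  rw [polySpace_eq_map] at hf
  obtain ⟨P, hP, rfl⟩ := hf
  have h2 := polyFun_mem (euler_mem_restrictSupport hP)
  have h3 : (fun x => fderiv ℝ (polyFun d P) x (x - a) - m * polyFun d P x) =
      polyFun d (∑ i, MvPolynomial.X i * MvPolynomial.pderiv i P - (m : ℝ) • P) -
        fun x => fderiv ℝ (polyFun d P) x a := by
    ext x
    rw [map_sub (fderiv ℝ (polyFun d P) x), fderiv_polyFun P x x]
    simp [polyFun_apply]
    ring
  rw [h3]
  exact sub_mem h2 h1

end Polynomials

lemma inner_eq_mul (a b : ℝ) : ⟪a, b⟫ = a * b := by simp [mul_comm]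

section Pairing
variable {X : Type*} [MeasurableSpace X] {E V W : Type*} [NormedAddCommGroup E]
  [InnerProductSpace ℝ E] [AddCommGroup V] [Module ℝ V] [AddCommGroup W] [Module ℝ W]

/-- The `L²` inner product as a bilinear form on two spaces of square integrable functions. -/
def pairing (μ : Measure X) (Φ : V →ₗ[ℝ] (X → E)) (Ψ : W →ₗ[ℝ] (X → E))
    (hΦ : ∀ v, MemLp (Φ v) 2 μ) (hΨ : ∀ w, MemLp (Ψ w) 2 μ) : V →ₗ[ℝ] W →ₗ[ℝ] ℝ :=
  LinearMap.mk₂ ℝ (fun v w => ∫ x, ⟪Φ v x, Ψ w x⟫ ∂μ)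
    (fun v v' w => by
      simp only [map_add, Pi.add_apply, inner_add_left]
      exact integral_add (integrable_inner_of_memLp (hΦ v) (hΨ w))
        (integrable_inner_of_memLp (hΦ v') (hΨ w)))
    (fun a v w => by
      simp only [map_smul, Pi.smul_apply, inner_smul_left, conj_trivial, integral_const_mul,
        smul_eq_mul])
    (fun v w w' => by
      simp only [map_add, Pi.add_apply, inner_add_right]
      exact integral_add (integrable_inner_of_memLp (hΦ v) (hΨ w))
        (integrable_inner_of_memLp (hΦ v) (hΨ w')))
    (fun a v w => by
      simp only [map_smul, Pi.smul_apply, inner_smul_right, integral_const_mul, smul_eq_mul])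

lemma pairing_apply {μ : Measure X} {Φ : V →ₗ[ℝ] (X → E)} {Ψ : W →ₗ[ℝ] (X → E)}
    (hΦ : ∀ v, MemLp (Φ v) 2 μ) (hΨ : ∀ w, MemLp (Ψ w) 2 μ) (v : V) (w : W) :
    pairing μ Φ Ψ hΦ hΨ v w = ∫ x, ⟪Φ v x, Ψ w x⟫ ∂μ := rfl

end Pairing

namespace Mesh
variable {n : ℕ} {Ω : Set (Sp (n + 1))} {M : Mesh Ω} {p : ℕ}

/-! ### Broken polynomials -/

/-- Restriction of a broken polynomial to an element. -/
def sLin (K : M.Elem) : M.SSpace p →ₗ[ℝ] (Sp (n + 1) → ℝ) :=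
  (Submodule.subtype _).comp (LinearMap.proj K)

lemma sFun_mem (w : M.SSpace p) (K : M.Elem) : sFun w K ∈ polySpace (n + 1) (p + 1) := (w K).2

lemma contDiff_sFun (w : M.SSpace p) (K : M.Elem) : ContDiff ℝ ∞ (sFun w K) :=
  contDiff_of_mem_polySpace (sFun_mem w K)

lemma continuous_sFun (w : M.SSpace p) (K : M.Elem) : Continuous (sFun w K) :=
  (contDiff_sFun w K).continuous

lemma qFun_comp_mem (q : M.QSpace p) (K : M.Elem) (i : Fin (n + 1)) :
    (fun x => qFun q K x i) ∈ polySpace (n + 1) (p + 1) := (q K i).2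

lemma contDiff_qFun (q : M.QSpace p) (K : M.Elem) : ContDiff ℝ ∞ (qFun q K) := by
  rw [contDiff_euclidean]
  exact fun i => contDiff_of_mem_polySpace (qFun_comp_mem q K i)

lemma continuous_qFun (q : M.QSpace p) (K : M.Elem) : Continuous (qFun q K) :=
  (contDiff_qFun q K).continuous

/-- Restriction of a broken polynomial vector field to an element. -/
def qLin (K : M.Elem) : M.QSpace p →ₗ[ℝ] (Sp (n + 1) → Sp (n + 1)) where
  toFun q := qFun q K
  map_add' q q' := by ext x i; simp [qFun]
  map_smul' a q := by ext x i; simp [qFun]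

lemma divergence_qFun (q : M.QSpace p) (K : M.Elem) :
    divergence (qFun q K) =
      fun x => ∑ i, fderiv ℝ (q K i : Sp (n + 1) → ℝ) x (EuclideanSpace.single i 1) := by
  ext x
  refine Finset.sum_congr rfl fun i _ => ?_
  have h1 : DifferentiableAt ℝ (qFun q K) x :=
    (contDiff_qFun q K).differentiable (by simp) x
  have h2 := ((EuclideanSpace.proj i : Sp (n + 1) →L[ℝ] ℝ).hasFDerivAt.comp x
    h1.hasFDerivAt).fderiv
  have h3 : (⇑(EuclideanSpace.proj i : Sp (n + 1) →L[ℝ] ℝ) ∘ qFun q K) = (q K i : _ → ℝ) := rfl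
  rw [h3] at h2
  rw [h2]
  rfl

lemma divergence_qFun_mem (q : M.QSpace p) (K : M.Elem) :
    divergence (qFun q K) ∈ polySpace (n + 1) p := by
  rw [divergence_qFun]
  have : (fun x => ∑ i, fderiv ℝ (q K i : Sp (n + 1) → ℝ) x (EuclideanSpace.single i 1)) =
      ∑ i, fun x => fderiv ℝ (q K i : Sp (n + 1) → ℝ) x (EuclideanSpace.single i 1) := by
    ext x; simp
  rw [this]
  exact Submodule.sum_mem _ fun i _ => fderiv_mem_polySpace (q K i).2 _

/-- The divergence on an element. -/
def divLin (K : M.Elem) : M.QSpace p →ₗ[ℝ] (Sp (n + 1) → ℝ) where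
  toFun q := divergence (qFun q K)
  map_add' q q' := by
    have h : ∀ (q : M.QSpace p) x, DifferentiableAt ℝ (qFun q K) x := fun q x =>
      (contDiff_qFun q K).differentiable (by simp) x
    have h1 : qFun (q + q') K = fun x => qFun q K x + qFun q' K x := (qLin K).map_add q q'
    ext x
    rw [h1]
    simp only [divergence, Pi.add_apply]
    rw [fderiv_fun_add (h q x) (h q' x)]
    simp [Finset.sum_add_distrib]
  map_smul' a q := by
    have h : ∀ (q : M.QSpace p) x, DifferentiableAt ℝ (qFun q K) x := fun q x =>
      (contDiff_qFun q K).differentiable (by simp) x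
    have h1 : qFun (a • q) K = fun x => a • qFun q K x := (qLin K).map_smul a q
    ext x
    rw [h1]
    simp only [divergence, Pi.smul_apply, RingHom.id_apply]
    rw [fderiv_fun_const_smul (h q x)]
    simp [Finset.mul_sum]

/-- Restriction of a function on the skeleton to a facet. -/
def mLin (F : M.IFacet) : M.MSpace p →ₗ[ℝ] (Sp (n + 1) → ℝ) :=
  (Submodule.subtype _).comp (LinearMap.proj F)

/-- An element of `M_p` is a polynomial on every facet. -/
lemma exists_mFun_eq (l : M.MSpace p) (F : M.IFacet) :
    ∃ P ∈ polySpace (n + 1) (p + 1), mFun l F = (hull F.1.1).indicator P := by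
  obtain ⟨P, hP, h⟩ := (l F).2
  exact ⟨P, hP, h.symm⟩

/-- The surface measure on a facet. -/
abbrev facetMeasure (F : M.Facet) : Measure (Sp (n + 1)) :=
  (μHE[n] : Measure (Sp (n + 1))).restrict (hull F.1)

lemma facetIntegral_eq (F : M.Facet) (g : Sp (n + 1) → ℝ) :
    facetIntegral F.1 g = ∫ x, g x ∂(facetMeasure F) := rfl

lemma facetIntegral_congr {F : M.Facet} {g g' : Sp (n + 1) → ℝ} (h : ∀ x ∈ hull F.1, g x = g' x) :
    facetIntegral F.1 g = facetIntegral F.1 g' :=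
  setIntegral_congr_fun (isCompact_hull F.1).measurableSet h

lemma facetIntegral_const_mul (F : M.Facet) (a : ℝ) (g : Sp (n + 1) → ℝ) :
    facetIntegral F.1 (fun x => a * g x) = a * facetIntegral F.1 g := integral_const_mul a _

lemma memLp_mFun (l : M.MSpace p) (F : M.IFacet) : MemLp (mLin F l) 2 (facetMeasure F.1) := by
  obtain ⟨P, hP, h⟩ := exists_mFun_eq l F
  refine (memLp_congr_ae ?_).2 (memLp_facet (continuous_of_mem_polySpace hP) F.1 2)
  filter_upwards [ae_restrict_mem (isCompact_hull F.1.1).measurableSet] with x hx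
  have : mLin F l = (hull F.1.1).indicator P := h
  rw [this, indicator_of_mem hx]

lemma memLp_sFun (w : M.SSpace p) (K : M.Elem) : MemLp (sFun w K) 2 (volume.restrict (hull K.1)) :=
  memLp_hull (continuous_sFun w K) _ _

lemma memLp_sFun_facet (w : M.SSpace p) (K : M.Elem) (F : M.Facet) :
    MemLp (sFun w K) 2 (facetMeasure F) :=
  memLp_facet (continuous_sFun w K) _ _

lemma memLp_qFun (q : M.QSpace p) (K : M.Elem) : MemLp (qFun q K) 2 (volume.restrict (hull K.1)) :=
  memLp_hull (continuous_qFun q K) _ _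

lemma memLp_div (q : M.QSpace p) (K : M.Elem) : MemLp (divLin K q) 2 (volume.restrict (hull K.1)) :=
  memLp_hull (continuous_of_mem_polySpace (divergence_qFun_mem q K)) _ _

/-- The normal component of a vector field on a facet. -/
def normalLin (K : M.Elem) (F : M.Facet) : M.QSpace p →ₗ[ℝ] (Sp (n + 1) → ℝ) where
  toFun q x := ⟪qFun q K x, outwardNormal K.1 F.1⟫
  map_add' q q' := by
    have h1 : qFun (q + q') K = fun x => qFun q K x + qFun q' K x := (qLin K).map_add q q'
    ext x; rw [h1]; simp [inner_add_left]
  map_smul' a q := by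
    have h1 : qFun (a • q) K = fun x => a • qFun q K x := (qLin K).map_smul a q
    ext x; rw [h1]; simp [inner_smul_left]

lemma normalLin_mem (q : M.QSpace p) (K : M.Elem) (F : M.Facet) :
    normalLin K F q ∈ polySpace (n + 1) (p + 1) := by
  have : normalLin K F q = ∑ i, outwardNormal K.1 F.1 i • (q K i : Sp (n + 1) → ℝ) := by
    ext x
    simp [normalLin, PiLp.inner_apply, qFun]
  rw [this]
  exact Submodule.sum_mem _ fun i _ => Submodule.smul_mem _ _ (q K i).2

/-- The normal jump as a linear map. -/
def jumpLin (F : M.IFacet) : M.QSpace p →ₗ[ℝ] (Sp (n + 1) → ℝ) :=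
  ∑ K ∈ M.elemsOf F, normalLin K F.1

lemma jumpLin_apply (F : M.IFacet) (q : M.QSpace p) : jumpLin F q = jump (qFun q) F := by
  ext x; simp [jumpLin, jump, normalLin]

lemma memLp_jump (q : M.QSpace p) (F : M.IFacet) : MemLp (jumpLin F q) 2 (facetMeasure F.1) := by
  refine memLp_facet ?_ F.1 2
  rw [jumpLin, LinearMap.sum_apply]
  have := Submodule.sum_mem (polySpace (n + 1) (p + 1)) (t := M.elemsOf F) fun K _ =>
    normalLin_mem q K F.1
  exact continuous_of_mem_polySpace this

lemma memLp_sLin (w : M.SSpace p) (K : M.Elem) : MemLp (sLin K w) 2 (volume.restrict (hull K.1)) :=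
  memLp_sFun w K

lemma memLp_sLin_facet (w : M.SSpace p) (K : M.Elem) (F : M.Facet) :
    MemLp (sLin K w) 2 (facetMeasure F) := memLp_sFun_facet w K F

lemma memLp_qLin (q : M.QSpace p) (K : M.Elem) : MemLp (qLin K q) 2 (volume.restrict (hull K.1)) :=
  memLp_qFun q K

/-! ### The bilinear forms of the method -/

variable (M p) in
/-- `m_h` on `S_p × S_p`. -/
def mB : M.SSpace p →ₗ[ℝ] M.SSpace p →ₗ[ℝ] ℝ :=
  ∑ K : M.Elem, pairing (volume.restrict (hull K.1)) (sLin K) (sLin K)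
    (fun w => memLp_sLin w K) (fun w => memLp_sLin w K)

variable (M p) in
/-- `𝐦_h` on `Q_p × Q_p`. -/
def mvB : M.QSpace p →ₗ[ℝ] M.QSpace p →ₗ[ℝ] ℝ :=
  ∑ K : M.Elem, pairing (volume.restrict (hull K.1)) (qLin K) (qLin K)
    (fun w => memLp_qLin w K) (fun w => memLp_qLin w K)

variable (M p) in
/-- `b_h` on `S_p × Q_p`. -/
def bB : M.SSpace p →ₗ[ℝ] M.QSpace p →ₗ[ℝ] ℝ :=
  ∑ K : M.Elem, pairing (volume.restrict (hull K.1)) (sLin K) (divLin K)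
    (fun w => memLp_sLin w K) (fun w => memLp_div w K)

variable (p) in
/-- `s_h` on `S_p × S_p`. -/
def sB (τ : M.Elem → M.Facet → ℝ) : M.SSpace p →ₗ[ℝ] M.SSpace p →ₗ[ℝ] ℝ :=
  ∑ K : M.Elem, ∑ F ∈ M.facetsOf K, τ K F • pairing (facetMeasure F) (sLin K) (sLin K)
    (fun w => memLp_sLin_facet w K F) (fun w => memLp_sLin_facet w K F)

variable (M p) in
/-- `e_h` on `M_p × Q_p`. -/
def eB : M.MSpace p →ₗ[ℝ] M.QSpace p →ₗ[ℝ] ℝ :=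
  -∑ F : M.IFacet, pairing (facetMeasure F.1) (mLin F) (jumpLin F)
    (fun w => memLp_mFun w F) (fun w => memLp_jump w F)

variable (p) in
/-- `f_h` on `M_p × S_p`. -/
def fB (τ : M.Elem → M.Facet → ℝ) : M.MSpace p →ₗ[ℝ] M.SSpace p →ₗ[ℝ] ℝ :=
  -∑ K : M.Elem, ∑ F ∈ M.iFacetsOf K, τ K F.1 • pairing (facetMeasure F.1) (mLin F) (sLin K)
    (fun w => memLp_mFun w F) (fun w => memLp_sLin_facet w K F.1)

variable (p) in
/-- `g_h` on `M_p × M_p`. -/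
def gB (τ : M.Elem → M.Facet → ℝ) : M.MSpace p →ₗ[ℝ] M.MSpace p →ₗ[ℝ] ℝ :=
  ∑ K : M.Elem, ∑ F ∈ M.iFacetsOf K, τ K F.1 • pairing (facetMeasure F.1) (mLin F) (mLin F)
    (fun w => memLp_mFun w F) (fun w => memLp_mFun w F)

lemma mB_apply (z w : M.SSpace p) : mB M p z w = mForm (sFun z) (sFun w) := by
  simp only [mB, mForm, LinearMap.sum_apply, pairing_apply, inner_eq_mul]
  rfl

lemma mvB_apply (q r : M.QSpace p) : mvB M p q r = mvForm (qFun q) (qFun r) := by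
  simp only [mvB, mvForm, LinearMap.sum_apply, pairing_apply]
  rfl

lemma bB_apply (w : M.SSpace p) (q : M.QSpace p) : bB M p w q = bForm (sFun w) (qFun q) := by
  simp only [bB, bForm, LinearMap.sum_apply, pairing_apply, inner_eq_mul]
  rfl

lemma sB_apply (τ : M.Elem → M.Facet → ℝ) (z w : M.SSpace p) :
    sB p τ z w = sForm τ (sFun z) (sFun w) := by
  simp only [sB, sForm, LinearMap.sum_apply, LinearMap.smul_apply, pairing_apply, inner_eq_mul,
    smul_eq_mul, mul_assoc, facetIntegral_const_mul]
  rfl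

lemma eB_apply (l : M.MSpace p) (q : M.QSpace p) : eB M p l q = eForm (mFun l) (qFun q) := by
  simp only [eB, eForm, LinearMap.neg_apply, LinearMap.sum_apply, pairing_apply, inner_eq_mul,
    jumpLin_apply]
  rfl

lemma fB_apply (τ : M.Elem → M.Facet → ℝ) (l : M.MSpace p) (w : M.SSpace p) :
    fB p τ l w = fForm τ (mFun l) (sFun w) := by
  simp only [fB, fForm, LinearMap.neg_apply, LinearMap.sum_apply, LinearMap.smul_apply,
    pairing_apply, inner_eq_mul, smul_eq_mul, mul_assoc, facetIntegral_const_mul]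
  rfl

lemma gB_apply (τ : M.Elem → M.Facet → ℝ) (l μ : M.MSpace p) :
    gB p τ l μ = gForm τ (mFun l) (mFun μ) := by
  simp only [gB, gForm, LinearMap.sum_apply, LinearMap.smul_apply,
    pairing_apply, inner_eq_mul, smul_eq_mul, mul_assoc, facetIntegral_const_mul]
  rfl

/-- A broken polynomial on one element as a continuous function. -/
def cLin (K : M.Elem) : M.SSpace p →ₗ[ℝ] C(Sp (n + 1), ℝ) where
  toFun w := ⟨sFun w K, continuous_sFun w K⟩
  map_add' _ _ := rfl
  map_smul' _ _ := rfl

/-- The integral of continuous functions over an element. -/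
def intLin (K : M.Elem) : C(Sp (n + 1), ℝ) →ₗ[ℝ] ℝ where
  toFun f := ∫ x in hull K.1, f x
  map_add' f g := integral_add (memLp_one_iff_integrable.1 (memLp_hull f.continuous _ 1))
    (memLp_one_iff_integrable.1 (memLp_hull g.continuous _ 1))
  map_smul' a _ := integral_const_mul a _

variable (M p) in
/-- The trilinear form `(α ζ, w)` on `S_p`. -/
def mC : M.SSpace p →ₗ[ℝ] M.SSpace p →ₗ[ℝ] M.SSpace p →ₗ[ℝ] ℝ :=
  ∑ K : M.Elem, ((LinearMap.mul ℝ C(Sp (n + 1), ℝ)).compl₁₂ (cLin K) (cLin K)).compr₂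
    (((LinearMap.mul ℝ C(Sp (n + 1), ℝ)).compr₂ (intLin K)).compl₂ (cLin K))

lemma mC_apply (α z w : M.SSpace p) :
    mC M p α z w = ∑ K : M.Elem, ∫ x in hull K.1, sFun α K x * sFun z K x * sFun w K x := by
  simp only [mC, LinearMap.sum_apply]
  rfl

lemma integrable_sFun_mul (z w : M.SSpace p) (K : M.Elem) :
    IntegrableOn (fun x => sFun z K x * sFun w K x) (hull K.1) :=
  memLp_one_iff_integrable.1 (memLp_hull
    ((continuous_sFun z K).mul (continuous_sFun w K)) _ 1)

lemma integrable_sFun_mul_mul (α z w : M.SSpace p) (K : M.Elem) :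
    IntegrableOn (fun x => sFun α K x * sFun z K x * sFun w K x) (hull K.1) :=
  memLp_one_iff_integrable.1 (memLp_hull
    (((continuous_sFun α K).mul (continuous_sFun z K)).mul (continuous_sFun w K)) _ 1)

/-- The inner product on `S_p` with the weight `1 + 2kα`. -/
def wB (k : ℝ) (α : M.SSpace p) : M.SSpace p →ₗ[ℝ] M.SSpace p →ₗ[ℝ] ℝ :=
  mB M p + (2 * k) • mC M p α

lemma wB_apply (k : ℝ) (α z w : M.SSpace p) :
    wB k α z w = ∑ K : M.Elem, ∫ x in hull K.1,
      (1 + 2 * k * sFun α K x) * sFun z K x * sFun w K x := by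
  simp only [wB, LinearMap.add_apply, LinearMap.smul_apply, mB_apply, mC_apply, mForm, smul_eq_mul,
    Finset.mul_sum, ← integral_const_mul]
  rw [← Finset.sum_add_distrib]
  refine Finset.sum_congr rfl fun K _ => ?_
  rw [← integral_add (integrable_sFun_mul z w K)
    ((integrable_sFun_mul_mul α z w K).const_mul _)]
  congr 1; ext x; ring

lemma mB_comm (z w : M.SSpace p) : mB M p z w = mB M p w z := by
  simp only [mB_apply, mForm, mul_comm]

lemma mC_comm (α z w : M.SSpace p) : mC M p α z w = mC M p α w z := by
  simp only [mC_apply, mul_right_comm]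

lemma mvB_comm (q r : M.QSpace p) : mvB M p q r = mvB M p r q := by
  simp only [mvB_apply, mvForm, real_inner_comm]

lemma sB_comm (τ : M.Elem → M.Facet → ℝ) (z w : M.SSpace p) : sB p τ z w = sB p τ w z := by
  simp only [sB_apply, sForm, mul_right_comm]

lemma gB_comm (τ : M.Elem → M.Facet → ℝ) (l μ : M.MSpace p) : gB p τ l μ = gB p τ μ l := by
  simp only [gB_apply, gForm, mul_right_comm]

/-! ### Broken functions in `L²(Ω)` -/

lemma memLp_glue {X : Type} [NormedAddCommGroup X] {q : ℝ≥0∞}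
    {u : M.Elem → Sp (n + 1) → X} (hu : ∀ K, MemLp (u K) q (volume.restrict (hull K.1))) :
    MemLp (glue u) q (volume.restrict Ω) := by
  refine memLp_finsetSum Finset.univ fun K _ => ?_
  rw [memLp_indicator_iff_restrict isOpen_interior.measurableSet]
  refine (hu K).mono_measure ?_
  rw [Measure.restrict_restrict isOpen_interior.measurableSet]
  exact Measure.restrict_mono (inter_subset_left.trans interior_subset) le_rfl

lemma toL2_ae (hΩr : interior (closure Ω) = Ω) {X : Type} [NormedAddCommGroup X]
    {u : M.Elem → Sp (n + 1) → X} (hu : ∀ K, MemLp (u K) 2 (volume.restrict (hull K.1)))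
    (K : M.Elem) : toL2 (Ω := Ω) u =ᵐ[volume.restrict (hull K.1)] u K := by
  have h := memLp_glue hu
  have h1 : toL2 (Ω := Ω) u = h.toLp (glue u) := by rw [toL2, dif_pos h]
  rw [h1]
  filter_upwards [ae_mono (restrict_hull_le hΩr K) h.coeFn_toLp, glue_ae_eq u K] with x h1 h2
  rw [h1, h2]

lemma ae_of_forall_elem (hΩr : interior (closure Ω) = Ω) {P : Sp (n + 1) → Prop}
    (h : ∀ K : M.Elem, ∀ᵐ x ∂(volume.restrict (hull K.1)), P x) :
    ∀ᵐ x ∂(volume.restrict Ω), P x := by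
  rw [restrict_eq_sum (M := M) hΩr, ← Measure.sum_fintype, Measure.ae_sum_iff]
  exact h

lemma inner_eq_sum (hΩr : interior (closure Ω) = Ω) (M : Mesh Ω) {X : Type} [NormedAddCommGroup X]
    [InnerProductSpace ℝ X] (f g : L2 Ω X) :
    ⟪f, g⟫ = ∑ K : M.Elem, ∫ x in hull K.1, ⟪f x, g x⟫ := by
  rw [L2.inner_def]
  exact integral_eq_sum hΩr (L2.integrable_inner f g)

lemma inner_toL2 (hΩr : interior (closure Ω) = Ω) {X : Type} [NormedAddCommGroup X]
    [InnerProductSpace ℝ X] (f : L2 Ω X) {u : M.Elem → Sp (n + 1) → X}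
    (hu : ∀ K, MemLp (u K) 2 (volume.restrict (hull K.1))) :
    ⟪f, toL2 u⟫ = ∑ K : M.Elem, ∫ x in hull K.1, ⟪f x, u K x⟫ := by
  rw [inner_eq_sum hΩr M]
  refine Finset.sum_congr rfl fun K _ => integral_congr_ae ?_
  filter_upwards [toL2_ae hΩr hu K] with x hx
  rw [hx]

/-- The embedding of `S_p` into `L²(Ω)`. -/
def tS (hΩr : interior (closure Ω) = Ω) : M.SSpace p →ₗ[ℝ] L2 Ω ℝ where
  toFun w := toL2 (sFun w)
  map_add' z w := by
    refine Lp.ext (ae_of_forall_elem (M := M) hΩr fun K => ?_)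
    filter_upwards [toL2_ae hΩr (memLp_sFun (z + w)) K, toL2_ae hΩr (memLp_sFun z) K,
      toL2_ae hΩr (memLp_sFun w) K, ae_mono (restrict_hull_le hΩr K)
        (Lp.coeFn_add (toL2 (Ω := Ω) (sFun z)) (toL2 (sFun w)))] with x h1 h2 h3 h4
    rw [h4, Pi.add_apply]
    rw [h2, h3]
    exact h1
  map_smul' a w := by
    refine Lp.ext (ae_of_forall_elem (M := M) hΩr fun K => ?_)
    filter_upwards [toL2_ae hΩr (memLp_sFun (a • w)) K,
      toL2_ae hΩr (memLp_sFun w) K, ae_mono (restrict_hull_le hΩr K)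
        (Lp.coeFn_smul a (toL2 (Ω := Ω) (sFun w)))] with x h1 h2 h4
    rw [RingHom.id_apply, h4, Pi.smul_apply]
    rw [h2]
    exact h1

/-- The embedding of `Q_p` into `L²(Ω)^d`. -/
def tQ (hΩr : interior (closure Ω) = Ω) : M.QSpace p →ₗ[ℝ] L2 Ω (Sp (n + 1)) where
  toFun w := toL2 (qFun w)
  map_add' z w := by
    refine Lp.ext (ae_of_forall_elem (M := M) hΩr fun K => ?_)
    filter_upwards [toL2_ae hΩr (memLp_qFun (z + w)) K, toL2_ae hΩr (memLp_qFun z) K,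
      toL2_ae hΩr (memLp_qFun w) K, ae_mono (restrict_hull_le hΩr K)
        (Lp.coeFn_add (toL2 (Ω := Ω) (qFun z)) (toL2 (qFun w)))] with x h1 h2 h3 h4
    rw [h4, Pi.add_apply]
    rw [h2, h3]
    exact h1
  map_smul' a w := by
    refine Lp.ext (ae_of_forall_elem (M := M) hΩr fun K => ?_)
    filter_upwards [toL2_ae hΩr (memLp_qFun (a • w)) K,
      toL2_ae hΩr (memLp_qFun w) K, ae_mono (restrict_hull_le hΩr K)
        (Lp.coeFn_smul a (toL2 (Ω := Ω) (qFun w)))] with x h1 h2 h4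
    rw [RingHom.id_apply, h4, Pi.smul_apply]
    rw [h2]
    exact h1

lemma tS_apply (hΩr : interior (closure Ω) = Ω) (w : M.SSpace p) : tS hΩr w = toL2 (sFun w) := rfl

lemma tQ_apply (hΩr : interior (closure Ω) = Ω) (w : M.QSpace p) : tQ hΩr w = toL2 (qFun w) := rfl

lemma inner_tS (hΩr : interior (closure Ω) = Ω) (f : L2 Ω ℝ) (w : M.SSpace p) :
    ⟪f, tS hΩr w⟫ = ∑ K : M.Elem, ∫ x in hull K.1, f x * sFun w K x := by
  rw [tS_apply, inner_toL2 hΩr f (memLp_sFun w)]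
  simp only [inner_eq_mul]

lemma inner_tQ (hΩr : interior (closure Ω) = Ω) (f : L2 Ω (Sp (n + 1))) (q : M.QSpace p) :
    ⟪f, tQ hΩr q⟫ = ∑ K : M.Elem, ∫ x in hull K.1, ⟪f x, qFun q K x⟫ :=
  inner_toL2 hΩr f (memLp_qFun q)

lemma inner_tS_tS (hΩr : interior (closure Ω) = Ω) (z w : M.SSpace p) :
    ⟪tS hΩr z, tS hΩr w⟫ = mB M p z w := by
  rw [inner_tS, mB_apply, mForm]
  refine Finset.sum_congr rfl fun K _ => integral_congr_ae ?_
  filter_upwards [toL2_ae hΩr (memLp_sFun z) K] with x hx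
  rw [tS_apply, hx]

lemma inner_tQ_tQ (hΩr : interior (closure Ω) = Ω) (q r : M.QSpace p) :
    ⟪tQ hΩr q, tQ hΩr r⟫ = mvB M p q r := by
  rw [inner_tQ, mvB_apply, mvForm]
  refine Finset.sum_congr rfl fun K _ => integral_congr_ae ?_
  filter_upwards [toL2_ae hΩr (memLp_qFun q) K] with x hx
  rw [tQ_apply, hx]

end Mesh

/-! ### Unisolvence -/

lemma eqOn_zero_of_integral_sq {X : Type*} [TopologicalSpace X] [MeasurableSpace X]
    [OpensMeasurableSpace X] {μ : Measure X} [μ.IsOpenPosMeasure] {f : X → ℝ} (hf : Continuous f)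
    {S U : Set X} (hi : IntegrableOn (fun x => f x ^ 2) S μ) (h : ∫ x in S, f x ^ 2 ∂μ = 0)
    (hU : IsOpen U) (hUS : U ⊆ S) : ∀ x ∈ U, f x = 0 := by
  have h1 := (integral_eq_zero_iff_of_nonneg (fun x => sq_nonneg (f x)) hi).1 h
  have h2 : f =ᵐ[μ.restrict U] fun _ => 0 := by
    filter_upwards [ae_mono (Measure.restrict_mono hUS le_rfl) h1] with x hx
    simpa using hx
  exact Measure.eqOn_open_of_ae_eq h2 hU hf.continuousOn continuousOn_const

namespace Mesh
variable {n : ℕ} {Ω : Set (Sp (n + 1))} {M : Mesh Ω} {p : ℕ}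

lemma interior_hull_nonempty (K : M.Elem) : (interior (hull K.1)).Nonempty := by
  have h3 := K.basis.tot
  rw [K.range_basis] at h3
  exact interior_convexHull_nonempty_iff_affineSpan_eq_top.2 h3

lemma integrableOn_hull {f : Sp (n + 1) → ℝ} (hf : Continuous f) (K : M.Elem) :
    IntegrableOn f (hull K.1) := memLp_one_iff_integrable.1 (memLp_hull hf _ 1)

lemma integrable_facet {f : Sp (n + 1) → ℝ} (hf : Continuous f) (F : M.Facet) :
    Integrable f (facetMeasure F) := memLp_one_iff_integrable.1 (memLp_facet hf _ 1)

/-- A polynomial with vanishing `L²` norm on an element is zero. -/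
lemma eq_zero_of_integral_sq_hull {f : Sp (n + 1) → ℝ} {m : ℕ} (hf : f ∈ polySpace (n + 1) m)
    (K : M.Elem) (h : ∫ x in hull K.1, f x ^ 2 = 0) : f = 0 :=
  eq_zero_of_mem_polySpace hf isOpen_interior (interior_hull_nonempty K)
    (eqOn_zero_of_integral_sq (continuous_of_mem_polySpace hf)
      (integrableOn_hull ((continuous_of_mem_polySpace hf).pow 2) K) h isOpen_interior
      interior_subset)

/-- A continuous function with vanishing `L²` norm on a facet is zero there. In coordinates of the
hyperplane the facet is a convex set with interior points. -/
lemma eqOn_zero_of_facetIntegral_sq {f : Sp (n + 1) → ℝ} (hf : Continuous f) {K : M.Elem}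
    {F : M.Facet} (hFK : F.1 ⊆ K.1) (h : facetIntegral F.1 (fun x => f x ^ 2) = 0) :
    ∀ x ∈ hull F.1, f x = 0 := by
  obtain ⟨a, ha, hFa⟩ := exists_eq_erase hFK
  obtain ⟨hν, η, hη, hh⟩ := outwardNormal_spec K.indep K.card_eq ha
  rw [← hFa] at hν hh
  set ν := outwardNormal K.1 F.1
  set J := normalCoord a ν hν with hJ
  have hne : (K.1.erase a).Nonempty :=
    Finset.card_pos.1 (by rw [Finset.card_erase_of_mem ha, K.card_eq]; omega)
  have hcone := mem_hull_iff_cone ha hne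
  rw [← hFa] at hcone
  have hJc : Continuous J := continuous_normalCoord a ν hν
  set F' : Set (ℝ ∙ ν)ᗮ := (fun y => J (η, y)) ⁻¹' hull F.1 with hF'
  have hJF : Continuous fun y : (ℝ ∙ ν)ᗮ => J (η, y) := hJc.comp (by fun_prop)
  have hF'c : IsClosed F' := (isCompact_hull F.1).isClosed.preimage hJF
  have hi : Isometry (fun y : (ℝ ∙ ν)ᗮ => J (η, y)) := isometry_normalCoord a ν hν η
  have hF'k : IsCompact F' := hi.isClosedEmbedding.isCompact_preimage (isCompact_hull F.1)
  have hconv : Convex ℝ F' := by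
    intro y hy z hz s t hs ht hst
    have h1 := (convex_convexHull ℝ (F.1 : Set (Sp (n + 1)))) hy hz hs ht hst
    have h2 : s • J (η, y) + t • J (η, z) = J (η, s • y + t • z) := by
      simp only [hJ, normalCoord_apply, Submodule.coe_add, Submodule.coe_smul]
      have h3 : t = 1 - s := by linarith
      subst h3
      module
    have h4 : s • J (η, y) + t • J (η, z) ∈ hull F.1 := h1
    rw [h2] at h4
    exact h4
  -- a slice of the interior of the element is a scaled copy of an open subset of the facet
  have hint : (interior F').Nonempty := by
    obtain ⟨x₀, hx₀⟩ := interior_hull_nonempty K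
    set q := J.symm x₀ with hq
    have hJq : J q = x₀ := J.apply_symm_apply x₀
    obtain ⟨s, hs, y, hy, hxy⟩ := (hcone x₀).1 (interior_subset hx₀)
    have hq1 : q.1 = s * η := by
      have := inner_normalCoord a ν hν q
      rw [← hJ, hJq, hxy, add_sub_cancel_left, inner_smul_right, hh y hy] at this
      exact this.symm
    have key : ∀ (s : ℝ) (y : (ℝ ∙ ν)ᗮ), J (s * η, s • y) = a + s • (J (η, y) - a) := by
      intro s y
      simp only [hJ, normalCoord_apply, Submodule.coe_smul]
      module
    have hsub : ∀ s : ℝ, s ≠ 0 → ∀ y : (ℝ ∙ ν)ᗮ, J (s * η, s • y) ∈ hull K.1 → y ∈ F' := by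
      intro s hs y hy
      obtain ⟨r, hr, z, hz, hzy⟩ := (hcone _).1 hy
      have h1 : s * η = r * η := by
        have := inner_normalCoord a ν hν (s * η, s • y)
        rw [← hJ, hzy, add_sub_cancel_left, inner_smul_right, hh z hz] at this
        exact this.symm
      have h2 : s = r := mul_right_cancel₀ hη.ne' h1
      subst h2
      rw [key] at hzy
      have h3 := smul_right_injective _ hs (add_left_cancel hzy)
      have h4 : J (η, y) = z := sub_left_injective h3
      change J (η, y) ∈ hull F.1
      rw [h4]; exact hz
    by_cases hs0 : s = 0
    · -- the apex is not an interior point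
      exfalso
      have h0 : x₀ = a := by rw [hxy, hs0]; simp
      have h1 : ∀ᶠ t : ℝ in nhds 0, a - t • ν ∈ hull K.1 := by
        have hc : Filter.Tendsto (fun t : ℝ => a - t • ν) (nhds 0) (nhds a) := by
          have : Continuous fun t : ℝ => a - t • ν := by fun_prop
          simpa using this.tendsto 0
        refine hc.eventually ?_
        rw [← h0]
        exact mem_interior_iff_mem_nhds.1 hx₀
      obtain ⟨t, ht, ht0⟩ := (h1.filter_mono nhdsWithin_le_nhds |>.and
        (self_mem_nhdsWithin (s := Ioi (0 : ℝ)))).exists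
      obtain ⟨r, hr, z, hz, hzy⟩ := (hcone _).1 ht
      have h2 := congrArg (fun x => ⟪ν, x - a⟫) hzy
      simp only [sub_sub_cancel_left, inner_neg_right, inner_smul_right,
        real_inner_self_eq_norm_sq, hν, add_sub_cancel_left, hh z hz] at h2
      have h3 : 0 ≤ r * η := mul_nonneg hr.1 hη.le
      have h4 : (0 : ℝ) < t := ht0
      linarith
    · refine ⟨s⁻¹ • q.2, mem_interior.2 ⟨(fun y => J (s * η, s • y)) ⁻¹' interior (hull K.1),
        fun y hy => hsub s hs0 y (interior_subset hy), isOpen_interior.preimage ?_, ?_⟩⟩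
      · exact hJc.comp (by fun_prop)
      · change J (s * η, s • s⁻¹ • q.2) ∈ interior (hull K.1)
        rw [smul_inv_smul₀ hs0, ← hq1]
        change J q ∈ interior (hull K.1)
        rw [hJq]; exact hx₀
  have h1 : ∫ y in F', (f (J (η, y))) ^ 2 = 0 := by
    have := setIntegral_hyperplane (n := n) (by simp) a ν hν η (hull F.1) hh (fun x => f x ^ 2)
    rw [← this]; exact h
  have hfJ : Continuous fun y : (ℝ ∙ ν)ᗮ => f (J (η, y)) := hf.comp hJF
  have h2 := eqOn_zero_of_integral_sq hfJ ((hfJ.pow 2).continuousOn.integrableOn_compact hF'k) h1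
    isOpen_interior interior_subset
  have h3 : ∀ y ∈ F', f (J (η, y)) = 0 := by
    intro y hy
    have h4 : y ∈ closure (interior F') := by
      rw [hconv.closure_interior_eq_closure_of_nonempty_interior hint]
      exact subset_closure hy
    have h5 : IsClosed {y | f (J (η, y)) = 0} := isClosed_eq hfJ continuous_const
    exact closure_minimal h2 h5 h4
  intro x hx
  have hJx : J (η, (J.symm x).2) = x := by
    have h4 : (J.symm x).1 = η := by
      have := inner_normalCoord a ν hν (J.symm x)
      rw [← hJ, J.apply_symm_apply, hh x hx] at this
      exact this.symm
    rw [← h4]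
    exact J.apply_symm_apply x
  have := h3 (J.symm x).2 (by change J (η, (J.symm x).2) ∈ hull F.1; rw [hJx]; exact hx)
  rwa [hJx] at this

/-- Unisolvence: a polynomial of degree at most `p` on an element is determined by its moments of
degree less than `p` and by its values on one facet. The cone formula for `ρ²` expresses its
integral over the facet by the integral of `n ρ² + 2 ρ (x - a)·∇ρ`, `n` the dimension; by Euler's
identity and the vanishing moments the latter is `(n + 2p) ∫ ρ²`. -/
lemma eq_zero_of_moments {ρ : Sp (n + 1) → ℝ} (hρ : ρ ∈ polySpace (n + 1) (p + 1)) {K : M.Elem}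
    {F : M.Facet} (hFK : F.1 ⊆ K.1)
    (h : ∀ r ∈ polySpace (n + 1) p, ∫ x in hull K.1, ρ x * r x = 0)
    (hF : facetIntegral F.1 (fun x => ρ x * ρ x) = 0) : ρ = 0 := by
  obtain ⟨a, ha, hFa⟩ := exists_eq_erase hFK
  obtain ⟨-, η, hη, hh⟩ := outwardNormal_spec K.indep K.card_eq ha
  have hρc := contDiff_of_mem_polySpace hρ
  have hρ1 : ContDiff ℝ 1 ρ := hρc.of_le (by exact_mod_cast le_top)
  have h1 := integral_simplex_cone K.indep K.card_eq ha hη hh (hρ1.mul hρ1)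
  rw [← hFa] at h1
  have hE := euler_mem_polySpace hρ a
  have h3 := h _ hE
  have hEc := continuous_of_mem_polySpace hE
  have hfd : ∀ x, fderiv ℝ (fun x => ρ x * ρ x) x (x - a) =
      2 * (ρ x * (fderiv ℝ ρ x (x - a) - p * ρ x)) + 2 * p * ρ x ^ 2 := by
    intro x
    have hd := hρ1.differentiable one_ne_zero x
    rw [fderiv_fun_mul hd hd]
    simp only [add_apply, smul_apply, smul_eq_mul]
    ring
  have hcont := hρc.continuous
  have h4 : ∫ x in hull K.1, (((n : ℝ) + 1) * (ρ x * ρ x) + fderiv ℝ (fun x => ρ x * ρ x) x (x - a)) =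
      (n + 1 + 2 * p) * ∫ x in hull K.1, ρ x ^ 2 := by
    have h5 : ∀ x, ((n : ℝ) + 1) * (ρ x * ρ x) + fderiv ℝ (fun x => ρ x * ρ x) x (x - a) =
        2 * (ρ x * (fderiv ℝ ρ x (x - a) - p * ρ x)) + (n + 1 + 2 * p) * ρ x ^ 2 := by
      intro x; rw [hfd]; ring
    simp only [h5]
    rw [integral_add, integral_const_mul, integral_const_mul, h3, mul_zero, zero_add]
    · exact (integrableOn_hull (hcont.mul hEc) K).const_mul _
    · exact (integrableOn_hull (hcont.pow 2) K).const_mul _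
  rw [h4, hF, mul_zero] at h1
  have h6 : (0 : ℝ) < n + 1 + 2 * p := by positivity
  exact eq_zero_of_integral_sq_hull hρ K ((mul_eq_zero.1 h1).resolve_left h6.ne')

end Mesh

namespace Mesh
variable {n : ℕ} {Ω : Set (Sp (n + 1))} {M : Mesh Ω} {p : ℕ}

/-! ### The equations of the projections -/

lemma sum_iFacetsOf_comm (G : M.Elem → M.IFacet → ℝ) :
    ∑ K : M.Elem, ∑ F ∈ M.iFacetsOf K, G K F = ∑ F : M.IFacet, ∑ K ∈ M.elemsOf F, G K F := by
  refine Finset.sum_comm' fun K F => ?_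
  simp [mem_iFacetsOf, mem_elemsOf]

lemma sum_facetsOf_split (K : M.Elem) (G : M.Facet → ℝ) :
    ∑ F ∈ M.facetsOf K, G F = ∑ F ∈ M.iFacetsOf K, G F.1 + ∑ F ∈ M.bFacetsOf K, G F := by
  classical
  rw [← Finset.sum_filter_add_sum_filter_not (M.facetsOf K) (fun F => M.IsInternal F)]
  congr 1
  · symm
    refine Finset.sum_bij (fun F _ => F.1) ?_ ?_ ?_ ?_
    · intro F hF
      exact Finset.mem_filter.2 ⟨mem_facetsOf.2 (mem_iFacetsOf.1 hF), F.2⟩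
    · intro F _ F' _ h
      exact Subtype.ext h
    · intro F hF
      rw [Finset.mem_filter] at hF
      exact ⟨⟨F, hF.2⟩, mem_iFacetsOf.2 (mem_facetsOf.1 hF.1), rfl⟩
    · intro F _; rfl
  · refine Finset.sum_congr ?_ fun _ _ => rfl
    ext F
    rw [Finset.mem_filter, mem_facetsOf, mem_bFacetsOf]

lemma elemsOf_card_pos (F : M.IFacet) : 0 < (M.elemsOf F).card := by
  obtain ⟨K, -, -, hK, -⟩ := F.2
  exact Finset.card_pos.2 ⟨K, mem_elemsOf.2 hK⟩

open Classical in
/-- The element of `M_p` which is equal to a given polynomial on one facet and zero elsewhere. -/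
def mSingle (F : M.IFacet) (g : Sp (n + 1) → ℝ) (hg : g ∈ polySpace (n + 1) (p + 1)) :
    M.MSpace p :=
  Pi.single F ⟨restrictTo (hull F.1.1) g, Submodule.mem_map_of_mem hg⟩

lemma mFun_mSingle_self (F : M.IFacet) {g : Sp (n + 1) → ℝ} (hg : g ∈ polySpace (n + 1) (p + 1))
    {x : Sp (n + 1)} (hx : x ∈ hull F.1.1) : mFun (mSingle F g hg) F x = g x := by
  classical
  have h1 : mSingle F g hg F = ⟨restrictTo (hull F.1.1) g, Submodule.mem_map_of_mem hg⟩ :=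
    Pi.single_eq_same F _
  have h2 : mFun (mSingle F g hg) F = (hull F.1.1).indicator g := congrArg Subtype.val h1
  rw [h2, indicator_of_mem hx]

lemma mFun_mSingle_of_ne {F F' : M.IFacet} (h : F' ≠ F) {g : Sp (n + 1) → ℝ}
    (hg : g ∈ polySpace (n + 1) (p + 1)) (x : Sp (n + 1)) : mFun (mSingle F g hg) F' x = 0 := by
  classical
  have h1 : mSingle F g hg F' = 0 := Pi.single_eq_of_ne h _
  have h2 : mFun (mSingle F g hg) F' = 0 := congrArg Subtype.val h1
  rw [h2, Pi.zero_apply]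

section Projection
variable {τ : M.Elem → M.Facet → ℝ} {ψ : L2 Ω ℝ} {v : L2 Ω (Sp (n + 1))} {D : L2 Ω ℝ}
  {ρ : M.SSpace p} {q : M.QSpace p} {m : M.MSpace p}

lemma integrable_trace_mul {u γ : Sp (n + 1) → ℝ} {K : M.Elem} (h : HasTrace K u γ) {F : M.Facet}
    (hF : F.1 ⊆ K.1) {g : Sp (n + 1) → ℝ} (hg : Continuous g) :
    Integrable (fun x => γ x * g x) (facetMeasure F) := by
  have : Integrable (fun x => ⟪γ x, g x⟫) (facetMeasure F) :=
    integrable_inner_of_memLp (h.2.1 F (mem_facetsOf.2 hF)) (memLp_facet hg F 2)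
  simpa only [inner_eq_mul] using this

lemma integrable_mFun_mul (l : M.MSpace p) (F : M.IFacet) {g : Sp (n + 1) → ℝ}
    (hg : Continuous g) : Integrable (fun x => mFun l F x * g x) (facetMeasure F.1) := by
  have : Integrable (fun x => ⟪mFun l F x, g x⟫) (facetMeasure F.1) :=
    integrable_inner_of_memLp (memLp_mFun l F) (memLp_facet hg F.1 2)
  simpa only [inner_eq_mul] using this

/-- Since the traces of a function in `H¹₀(Ω)` from the two sides of an internal facet agree, the
projection on the skeleton is the projection of each of them. -/
lemma skeleton_moment (hΩr : interior (closure Ω) = Ω) (hgrad : MemH10 Ω ψ v)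
    (hm : IsSkeletonProjection ψ m) {K : M.Elem} {F : M.IFacet} (hFK : F.1.1 ⊆ K.1)
    {γ : Sp (n + 1) → ℝ} (hγ : HasTrace K ψ γ) {g : Sp (n + 1) → ℝ}
    (hg : g ∈ polySpace (n + 1) (p + 1)) :
    facetIntegral F.1.1 (fun x => mFun m F x * g x) =
      facetIntegral F.1.1 fun x => γ x * g x := by
  classical
  obtain ⟨γ', hγ', h⟩ := hm
  have hgc := contDiff_of_mem_polySpace hg
  have h1 := h (mSingle F g hg)
  rw [sum_iFacetsOf_comm, Finset.sum_eq_single F] at h1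
  · have h2 : ∀ K' ∈ M.elemsOf F, facetIntegral F.1.1
        (fun x => (mFun m F x - γ' K' x) * mFun (mSingle F g hg) F x) =
        facetIntegral F.1.1 (fun x => mFun m F x * g x) -
          facetIntegral F.1.1 (fun x => γ x * g x) := by
      intro K' hK'
      have hFK' := mem_elemsOf.1 hK'
      rw [facetIntegral_congr (g' := fun x => mFun m F x * g x - γ' K' x * g x) fun x hx => by
        rw [mFun_mSingle_self F hg hx]; ring]
      rw [HasTrace.facet_moment_eq hΩr hgrad hγ (hγ' K') hFK hFK' hgc]
      exact integral_sub (integrable_mFun_mul m F hgc.continuous)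
        (integrable_trace_mul (hγ' K') hFK' hgc.continuous)
    rw [Finset.sum_congr rfl h2, Finset.sum_const, smul_eq_zero] at h1
    exact sub_eq_zero.1 (h1.resolve_left (elemsOf_card_pos F).ne')
  · intro F' _ hF'
    refine Finset.sum_eq_zero fun K' _ => ?_
    simp only [mFun_mSingle_of_ne hF' hg, mul_zero]
    simp [facetIntegral]
  · simp

lemma sFun_moment (hπ : IsHDGProjection τ ψ v ρ q) (K : M.Elem) {r : Sp (n + 1) → ℝ}
    (hr : r ∈ polySpace (n + 1) p) (hΩr : interior (closure Ω) = Ω) :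
    ∫ x in hull K.1, sFun ρ K x * r x = ∫ x in hull K.1, ψ x * r x := by
  obtain ⟨-, -, -, -, -, -, -, h, -⟩ := hπ K
  have h1 := h r hr
  have hrc := continuous_of_mem_polySpace hr
  have hψ : MemLp ψ 2 (volume.restrict (hull K.1)) :=
    (Lp.memLp ψ).mono_measure (restrict_hull_le hΩr K)
  have h2 := integrable_inner_of_memLp hψ (memLp_hull hrc K.1 2)
  simp only [inner_eq_mul] at h2
  simp only [sub_mul] at h1
  rw [integral_sub (integrableOn_hull (f := fun x => sFun ρ K x * r x)
    ((continuous_sFun ρ K).mul hrc) K) h2] at h1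
  exact sub_eq_zero.1 h1

/-- The projections satisfy the equation of the method for the flux, up to the projection error
`Π_Q v - v`: since `∇·r` has degree less than `p`, `ψ` may be replaced by `Π_S ψ` in the integration
by parts formula. -/
lemma flux_projection_eq (hΩ : IsOpen Ω) (hΩr : interior (closure Ω) = Ω) (hgrad : MemH10 Ω ψ v)
    (hπ : IsHDGProjection τ ψ v ρ q) (hm : IsSkeletonProjection ψ m) (r : M.QSpace p) :
    mvB M p q r + bB M p ρ r + eB M p m r = ⟪tQ hΩr q - v, tQ hΩr r⟫ := by
  have hγ : ∀ K : M.Elem, ∃ γ, HasTrace K ψ γ := fun K => by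
    obtain ⟨γ, -, -, h, -⟩ := hπ K
    exact ⟨γ, h⟩
  choose γ hγ using hγ
  have hrc := fun K => contDiff_qFun r K
  have hle := fun K : M.Elem => restrict_hull_le hΩr K
  have h1 := fun K => HasTrace.integral_by_parts hΩr hgrad (hγ K) (hrc K)
  have hdiv := fun K => continuous_of_mem_polySpace (divergence_qFun_mem r K)
  have i1 : ∀ K : M.Elem, IntegrableOn (fun x => ψ x * divergence (qFun r K) x) (hull K.1) :=
    fun K => by
      have := integrable_inner_of_memLp
        ((Lp.memLp ψ).mono_measure (hle K)) (memLp_hull (hdiv K) K.1 2)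
      simp only [inner_eq_mul] at this
      exact this
  have i2 : ∀ K : M.Elem, IntegrableOn (fun x => ⟪v x, qFun r K x⟫) (hull K.1) := fun K =>
    integrable_inner_of_memLp ((Lp.memLp v).mono_measure (hle K)) (memLp_qFun r K)
  -- the boundary terms
  have h2 : ∀ K, ∑ F ∈ M.facetsOf K, facetIntegral F.1
      (fun x => γ K x * ⟪qFun r K x, outwardNormal K.1 F.1⟫) =
      ∑ F ∈ M.iFacetsOf K, facetIntegral F.1.1
        (fun x => mFun m F x * normalLin K F.1 r x) := by
    intro K
    rw [sum_facetsOf_split, Finset.sum_eq_zero (s := M.bFacetsOf K), add_zero]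
    · refine Finset.sum_congr rfl fun F hF => ?_
      exact (skeleton_moment hΩr hgrad hm (mem_iFacetsOf.1 hF) (hγ K) (normalLin_mem r K F.1)).symm
    · intro F hF
      rw [mem_bFacetsOf] at hF
      exact HasTrace.facet_moment_boundary hΩ hΩr hgrad (hγ K) hF.1 hF.2
        (contDiff_of_mem_polySpace (normalLin_mem r K F))
  have h3 : eB M p m r = -∑ K : M.Elem, ∑ F ∈ M.iFacetsOf K, facetIntegral F.1.1
        (fun x => mFun m F x * normalLin K F.1 r x) := by
    rw [eB_apply, eForm, sum_iFacetsOf_comm]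
    congr 1
    refine Finset.sum_congr rfl fun F _ => ?_
    simp only [jump, Finset.mul_sum, facetIntegral]
    rw [integral_finsetSum]
    · rfl
    · intro K _
      exact integrable_mFun_mul m F (continuous_of_mem_polySpace (normalLin_mem r K F.1))
  rw [inner_sub_left, inner_tQ_tQ, inner_tQ, h3, bB_apply, bForm]
  have h4 : ∑ K : M.Elem, ∑ F ∈ M.iFacetsOf K, facetIntegral F.1.1
        (fun x => mFun m F x * normalLin K F.1 r x) =
      (∑ K : M.Elem, ∫ x in hull K.1, sFun ρ K x * divergence (qFun r K) x) +
      ∑ K : M.Elem, ∫ x in hull K.1, ⟪v x, qFun r K x⟫ := by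
    rw [← Finset.sum_add_distrib]
    refine Finset.sum_congr rfl fun K _ => ?_
    rw [← h2, ← h1, integral_add (i1 K) (i2 K),
      sFun_moment hπ K (divergence_qFun_mem r K) hΩr]
  rw [h4]
  ring

lemma integrable_normal_trace_mul {γ : Sp (n + 1) → Sp (n + 1)} {u : Sp (n + 1) → Sp (n + 1)}
    {K : M.Elem} (h : ∀ i, HasTrace K (fun x => u x i) (fun x => γ x i)) {F : M.Facet}
    (hF : F.1 ⊆ K.1) {g : Sp (n + 1) → ℝ} (hg : Continuous g) :
    Integrable (fun x => ⟪γ x, outwardNormal K.1 F.1⟫ * g x) (facetMeasure F) := by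
  have : (fun x => ⟪γ x, outwardNormal K.1 F.1⟫ * g x) =
      fun x => ∑ i, outwardNormal K.1 F.1 i * (γ x i * g x) := by
    ext x
    simp only [PiLp.inner_apply, Finset.sum_mul, inner_eq_mul]
    exact Finset.sum_congr rfl fun i _ => by ring
  rw [this]
  exact integrable_finsetSum _ fun i _ => (integrable_trace_mul (h i) hF hg).const_mul _

/-- The facet condition of the projection, with the integrals separated. On an internal facet the
projection of the trace is the given function on the skeleton, on a boundary facet it vanishes. -/
lemma exists_facet_condition (hΩ : IsOpen Ω) (hΩr : interior (closure Ω) = Ω)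
    (hgrad : MemH10 Ω ψ v) (hπ : IsHDGProjection τ ψ v ρ q) (hm : IsSkeletonProjection ψ m)
    (K : M.Elem) : ∃ γv : Sp (n + 1) → Sp (n + 1),
      (∀ i, HasTrace K (fun x => v x i) (fun x => γv x i)) ∧
      (∀ F ∈ M.iFacetsOf K, ∀ g ∈ polySpace (n + 1) (p + 1),
        facetIntegral F.1.1 (fun x => normalLin K F.1 q x * g x)
          - τ K F.1 * facetIntegral F.1.1 (fun x => sFun ρ K x * g x)
          + τ K F.1 * facetIntegral F.1.1 (fun x => mFun m F x * g x)
        = facetIntegral F.1.1 (fun x => ⟪γv x, outwardNormal K.1 F.1.1⟫ * g x)) ∧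
      ∀ F ∈ M.bFacetsOf K, ∀ g ∈ polySpace (n + 1) (p + 1),
        facetIntegral F.1 (fun x => normalLin K F q x * g x)
          - τ K F * facetIntegral F.1 (fun x => sFun ρ K x * g x)
        = facetIntegral F.1 (fun x => ⟪γv x, outwardNormal K.1 F.1⟫ * g x) := by
  obtain ⟨γψ, γv, m', hγψ, hγv, hm', -, -, hF⟩ := hπ K
  have key : ∀ F ∈ M.facetsOf K, ∀ g ∈ polySpace (n + 1) (p + 1),
      facetIntegral F.1 (fun x => normalLin K F q x * g x)
          - τ K F * facetIntegral F.1 (fun x => sFun ρ K x * g x)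
          + τ K F * facetIntegral F.1 (fun x => γψ x * g x)
        = facetIntegral F.1 (fun x => ⟪γv x, outwardNormal K.1 F.1⟫ * g x) := by
    intro F hFK g hg
    have hFK' := mem_facetsOf.1 hFK
    have hgc := continuous_of_mem_polySpace hg
    have hmc := continuous_of_mem_polySpace (hm' F hFK).1
    have e1 := (hm' F hFK).2 g hg
    have e2 := hF F hFK g hg
    have i1 : Integrable (fun x => normalLin K F q x * g x) (facetMeasure F) :=
      integrable_facet ((continuous_of_mem_polySpace (normalLin_mem q K F)).mul hgc) F
    have i2 : Integrable (fun x => sFun ρ K x * g x) (facetMeasure F) :=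
      integrable_facet ((continuous_sFun ρ K).mul hgc) F
    have i3 : Integrable (fun x => m' F x * g x) (facetMeasure F) :=
      integrable_facet (hmc.mul hgc) F
    have i4 := integrable_trace_mul hγψ hFK' hgc
    have i5 := integrable_normal_trace_mul hγv hFK' hgc
    have e3 : facetIntegral F.1 (fun x => m' F x * g x) =
        facetIntegral F.1 (fun x => γψ x * g x) := by
      simp only [sub_mul] at e1
      rw [facetIntegral_eq, integral_sub i3 i4] at e1
      exact sub_eq_zero.1 e1
    have e4 : (fun x => (⟪qFun q K x, outwardNormal K.1 F.1⟫ - τ K F * (sFun ρ K x - m' F x)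
          - ⟪γv x, outwardNormal K.1 F.1⟫) * g x) =
        fun x => normalLin K F q x * g x - τ K F * (sFun ρ K x * g x) + τ K F * (m' F x * g x)
          - ⟪γv x, outwardNormal K.1 F.1⟫ * g x := by
      ext x
      change _ = ⟪qFun q K x, outwardNormal K.1 F.1⟫ * g x - _ + _ - _
      ring
    have i6 : Integrable (fun x => normalLin K F q x * g x - τ K F * (sFun ρ K x * g x))
        (facetMeasure F) := i1.sub (i2.const_mul _)
    have i7 : Integrable (fun x => normalLin K F q x * g x - τ K F * (sFun ρ K x * g x)
        + τ K F * (m' F x * g x)) (facetMeasure F) := i6.add (i3.const_mul _)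
    rw [e4, facetIntegral_eq, integral_sub i7 i5,
      integral_add i6 (i3.const_mul _), integral_sub i1 (i2.const_mul _),
      integral_const_mul, integral_const_mul, ← facetIntegral_eq, ← facetIntegral_eq,
      ← facetIntegral_eq, ← facetIntegral_eq, e3] at e2
    exact sub_eq_zero.1 e2
  refine ⟨γv, hγv, fun F hFK g hg => ?_, fun F hFK g hg => ?_⟩
  · rw [skeleton_moment hΩr hgrad hm (mem_iFacetsOf.1 hFK) hγψ hg]
    exact key F.1 (mem_facetsOf.2 (mem_iFacetsOf.1 hFK)) g hg
  · rw [mem_bFacetsOf] at hFK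
    have := key F (mem_facetsOf.2 hFK.1) g hg
    rwa [HasTrace.facet_moment_boundary hΩ hΩr hgrad hγψ hFK.1 hFK.2
      (contDiff_of_mem_polySpace hg), mul_zero, add_zero] at this

/-- The projections satisfy the equation of the method on the skeleton exactly: by the facet
condition the numerical normal fluxes have the moments of `v·n`, which cancel. -/
lemma skeleton_projection_eq (hΩ : IsOpen Ω) (hΩr : interior (closure Ω) = Ω)
    (hgrad : MemH10 Ω ψ v) (hdiv : HasWeakDiv Ω v D) (hπ : IsHDGProjection τ ψ v ρ q)
    (hm : IsSkeletonProjection ψ m) (μ : M.MSpace p) :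
    - eB M p μ q + fB p τ μ ρ + gB p τ m μ = 0 := by
  choose γv hγv hi hb using exists_facet_condition hΩ hΩr hgrad hπ hm
  rw [eB_apply, fB_apply, gB_apply, eForm, fForm, gForm, neg_neg, sum_iFacetsOf_comm,
    sum_iFacetsOf_comm, ← Finset.sum_neg_distrib, ← Finset.sum_add_distrib,
    ← Finset.sum_add_distrib]
  refine Finset.sum_eq_zero fun F _ => ?_
  obtain ⟨g, hg, hμ⟩ := exists_mFun_eq μ F
  have hgc := continuous_of_mem_polySpace hg
  have hμx : ∀ x ∈ hull F.1.1, mFun μ F x = g x := fun x hx => by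
    rw [hμ, indicator_of_mem hx]
  have e1 : facetIntegral F.1.1 (fun x => mFun μ F x * jump (qFun q) F x) =
      ∑ K ∈ M.elemsOf F, facetIntegral F.1.1 (fun x => normalLin K F.1 q x * g x) := by
    rw [facetIntegral_congr (g' := fun x => ∑ K ∈ M.elemsOf F, normalLin K F.1 q x * g x)
      fun x hx => by rw [hμx x hx, jump, ← Finset.sum_mul, mul_comm]; rfl]
    exact integral_finsetSum _ fun K _ =>
      integrable_facet ((continuous_of_mem_polySpace (normalLin_mem q K F.1)).mul hgc) F.1
  have e2 : ∀ K, facetIntegral F.1.1 (fun x => τ K F.1 * mFun μ F x * sFun ρ K x) =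
      τ K F.1 * facetIntegral F.1.1 (fun x => sFun ρ K x * g x) := fun K => by
    rw [← facetIntegral_const_mul]
    exact facetIntegral_congr fun x hx => by rw [hμx x hx]; ring
  have e3 : ∀ K, facetIntegral F.1.1 (fun x => τ K F.1 * mFun m F x * mFun μ F x) =
      τ K F.1 * facetIntegral F.1.1 (fun x => mFun m F x * g x) := fun K => by
    rw [← facetIntegral_const_mul]
    exact facetIntegral_congr fun x hx => by rw [hμx x hx]; ring
  simp only [e1, e2, e3]
  rw [← sub_eq_add_neg, ← Finset.sum_sub_distrib, ← Finset.sum_add_distrib]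
  rw [Finset.sum_congr rfl fun K hK => hi K F (mem_iFacetsOf.2 (mem_elemsOf.1 hK)) g hg]
  exact sum_normal_trace_eq_zero hΩ hΩr (Lp.memLp v) (Lp.memLp D) hdiv hγv F hgc

lemma gradient_mem_polySpace {w : Sp (n + 1) → ℝ} {k : ℕ} (hw : w ∈ polySpace (n + 1) (k + 1))
    (i : Fin (n + 1)) : (fun x => gradient w x i) ∈ polySpace (n + 1) k := by
  have : (fun x => gradient w x i) = fun x => fderiv ℝ w x (EuclideanSpace.single i 1) := by
    ext x
    have := inner_gradient_left (𝕜 := ℝ) (f := w) (x := x) (y := EuclideanSpace.single i (1 : ℝ))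
    rw [← this, EuclideanSpace.inner_single_right]; simp
  rw [this]
  exact fderiv_mem_polySpace hw _

lemma qFun_moment_gradient (hπ : IsHDGProjection τ ψ v ρ q) (hΩr : interior (closure Ω) = Ω)
    (K : M.Elem) {w : Sp (n + 1) → ℝ} (hw : w ∈ polySpace (n + 1) (p + 1)) :
    ∫ x in hull K.1, ⟪gradient w x, qFun q K x⟫ = ∫ x in hull K.1, ⟪v x, gradient w x⟫ := by
  obtain ⟨-, -, -, -, -, -, h, -⟩ := hπ K
  have hwc : ContDiff ℝ 1 w := (contDiff_of_mem_polySpace hw).of_le (by exact_mod_cast le_top)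
  have hgc := continuous_gradient hwc
  have hv : MemLp v 2 (volume.restrict (hull K.1)) :=
    (Lp.memLp v).mono_measure (restrict_hull_le hΩr K)
  have i1 := integrable_inner_of_memLp (memLp_hull hgc K.1 2) (memLp_qFun q K)
  have i2 := integrable_inner_of_memLp hv (memLp_hull hgc K.1 2)
  rw [← sub_eq_zero, ← integral_sub i1 i2]
  have h1 : ∀ x, ⟪gradient w x, qFun q K x⟫ - ⟪v x, gradient w x⟫ =
      ∑ i, (qFun q K x i - v x i) * gradient w x i := by
    intro x
    simp only [PiLp.inner_apply, inner_eq_mul, ← Finset.sum_sub_distrib]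
    exact Finset.sum_congr rfl fun i _ => by ring
  simp only [h1]
  rw [integral_finsetSum]
  · exact Finset.sum_eq_zero fun i _ => h i _ (gradient_mem_polySpace hw i)
  · intro i _
    have hvi : MemLp (fun x => v x i) 2 (volume.restrict (hull K.1)) :=
      (EuclideanSpace.proj i : Sp (n + 1) →L[ℝ] ℝ).comp_memLp' hv
    have hqi : MemLp (fun x => qFun q K x i) 2 (volume.restrict (hull K.1)) :=
      memLp_hull (continuous_of_mem_polySpace (qFun_comp_mem q K i)) _ _
    have := integrable_inner_of_memLp (hqi.sub hvi) (memLp_hull (f := fun x => gradient w x i)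
      (by fun_prop) K.1 2)
    simpa only [inner_eq_mul, Pi.sub_apply] using this

/-- The divergence of `v`, tested with broken polynomials, is the discrete divergence of the
projections with its stabilization. -/
lemma divergence_projection_eq (hΩ : IsOpen Ω) (hΩr : interior (closure Ω) = Ω)
    (hgrad : MemH10 Ω ψ v) (hdiv : HasWeakDiv Ω v D) (hπ : IsHDGProjection τ ψ v ρ q)
    (hm : IsSkeletonProjection ψ m) (w : M.SSpace p) :
    bB M p w q - sB p τ ρ w - fB p τ m w = ⟪D, tS hΩr w⟫ := by
  choose γv hγv hi hb using exists_facet_condition hΩ hΩr hgrad hπ hm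
  rw [bB_apply, sB_apply, fB_apply, inner_tS, bForm, sForm, fForm, sub_neg_eq_add,
    ← Finset.sum_sub_distrib, ← Finset.sum_add_distrib]
  refine Finset.sum_congr rfl fun K _ => ?_
  have hw := sFun_mem w K
  have hwc := contDiff_sFun w K
  have hw1 : ContDiff ℝ 1 (sFun w K) := hwc.of_le (by exact_mod_cast le_top)
  have hq1 : ContDiff ℝ 1 (qFun q K) := (contDiff_qFun q K).of_le (by exact_mod_cast le_top)
  have hgc := continuous_gradient hw1
  have hdc := continuous_of_mem_polySpace (divergence_qFun_mem q K)
  have e1 := integral_by_parts K hw1 hq1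
  rw [integral_add (integrableOn_hull (f := fun x => sFun w K x * divergence (qFun q K) x)
    (hwc.continuous.mul hdc) K)
    (integrable_inner_of_memLp (memLp_hull hgc K.1 2) (memLp_qFun q K)),
    qFun_moment_gradient hπ hΩr K hw, sum_facetsOf_split] at e1
  have e2 := integral_by_parts_of_hasWeakDiv hΩr (Lp.memLp v) (Lp.memLp D) hdiv (hγv K) hwc
  have i1 := integrable_inner_of_memLp ((Lp.memLp v).mono_measure (restrict_hull_le hΩr K))
    (memLp_hull hgc K.1 2)
  have i2 := integrable_inner_of_memLp ((Lp.memLp D).mono_measure (restrict_hull_le hΩr K))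
    (memLp_sFun w K)
  simp only [inner_eq_mul] at i2
  rw [integral_add i1 i2, sum_facetsOf_split] at e2
  have c1 : ∀ F : M.Facet, facetIntegral F.1
      (fun x => sFun w K x * ⟪qFun q K x, outwardNormal K.1 F.1⟫) =
      facetIntegral F.1 (fun x => normalLin K F q x * sFun w K x) := fun F =>
    facetIntegral_congr fun x _ => mul_comm _ _
  have c2 : ∀ F : M.Facet, facetIntegral F.1
      (fun x => sFun w K x * ⟪γv K x, outwardNormal K.1 F.1⟫) =
      facetIntegral F.1 (fun x => ⟪γv K x, outwardNormal K.1 F.1⟫ * sFun w K x) := fun F =>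
    facetIntegral_congr fun x _ => mul_comm _ _
  simp only [c1] at e1
  simp only [c2] at e2
  rw [← Finset.sum_congr rfl fun F hF => hi K F hF _ hw,
    ← Finset.sum_congr rfl fun F hF => hb K F hF _ hw] at e2
  simp only [Finset.sum_add_distrib, Finset.sum_sub_distrib] at e2
  rw [sum_facetsOf_split]
  simp only [mul_assoc, facetIntegral_const_mul]
  linarith

end Projection
end Mesh

/-! ### Time derivatives of broken polynomials -/

section LinearMaps
variable {V : Type} [AddCommGroup V] [Module ℝ V] [FiniteDimensional ℝ V]
variable {X : Type} [NormedAddCommGroup X] [NormedSpace ℝ X]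
variable {q : ℝ≥0∞} {T : ℝ} {k : ℕ} {u : ℝ → V}

lemma linearMap_eq_sum (L : V →ₗ[ℝ] X) (x : V) :
    L x = ∑ i, (Module.finBasis ℝ V).repr x i • L (Module.finBasis ℝ V i) := by
  conv_lhs => rw [← (Module.finBasis ℝ V).sum_repr x]
  simp only [map_sum, map_smul]

lemma HasFinDerivAt.linearMap (L : V →ₗ[ℝ] X) {u' : V} {s : Set ℝ} {t : ℝ}
    (h : HasFinDerivAt u u' s t) : HasDerivWithinAt (fun r => L (u r)) (L u') s t := by
  rw [linearMap_eq_sum L u', funext fun r => linearMap_eq_sum L (u r)]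
  exact HasDerivWithinAt.fun_sum fun i _ =>
    (h ((Module.finBasis ℝ V).coord i)).smul_const _

lemma HasFinDerivAt.timeDeriv (L : V →ₗ[ℝ] X) {u' : V} {t : ℝ} (hT : 0 < T) (ht : t ∈ Icc 0 T)
    (h : HasFinDerivAt u u' (Icc 0 T) t) : timeDeriv T (fun r => L (u r)) t = L u' :=
  (h.linearMap L).derivWithin (uniqueDiffOn_Icc hT t ht)

lemma HasFinDerivAt.mono {u' : V} {s s' : Set ℝ} {t : ℝ} (h : HasFinDerivAt u u' s t)
    (hs : s' ⊆ s) : HasFinDerivAt u u' s' t := fun l => (h l).mono hs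

lemma MemWFin.linearMap [CompleteSpace X] (hq : 1 ≤ q) (hT : 0 < T) (L : V →ₗ[ℝ] X)
    (h : MemWFin q T k u) : MemW q T k (fun t => L (u t)) := by
  rw [funext fun r => linearMap_eq_sum L (u r)]
  exact MemW.sum hq hT _ fun i _ => (h.coord i).clm hq hT
    (ContinuousLinearMap.toSpanSingleton ℝ (L (Module.finBasis ℝ V i)))

/-- Two functions which agree on an open interval have the same derivative there. -/
lemma deriv_eq_of_eqOn_Ioo {f g : ℝ → ℝ} {f' g' t : ℝ} (ht : t ∈ Ioo 0 T)
    (hfg : ∀ s ∈ Ioo 0 T, f s = g s) (hf : HasDerivWithinAt f f' (Icc 0 T) t)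
    (hg : HasDerivWithinAt g g' (Icc 0 T) t) : f' = g' := by
  have h1 := hf.hasDerivAt (Icc_mem_nhds ht.1 ht.2)
  have h2 := hg.hasDerivAt (Icc_mem_nhds ht.1 ht.2)
  refine h1.unique (h2.congr_of_eventuallyEq ?_)
  filter_upwards [isOpen_Ioo.mem_nhds ht] with s hs using hfg s hs

end LinearMaps

namespace Mesh
variable {n : ℕ} {Ω : Set (Sp (n + 1))} {M : Mesh Ω} {p : ℕ}

section TimeDerivatives
variable {T : ℝ} {t : ℝ}

instance : FiniteDimensional ℝ (M.MSpace p) := by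
  have (F : M.IFacet) : FiniteDimensional ℝ
      ((polySpace (n + 1) (p + 1)).map (restrictTo (hull F.1.1))) :=
    inferInstance
  infer_instance

lemma pwTimeDeriv_sFun (hT : 0 < T) (ht : t ∈ Icc 0 T) {u : ℝ → M.SSpace p} {u' : M.SSpace p}
    (h : HasFinDerivAt u u' (Icc 0 T) t) : pwTimeDeriv T (fun s => sFun (u s)) t = sFun u' := by
  funext K x
  exact h.timeDeriv ((LinearMap.proj x).comp (sLin K)) hT ht

lemma pwTimeDeriv_qFun (hT : 0 < T) (ht : t ∈ Icc 0 T) {u : ℝ → M.QSpace p} {u' : M.QSpace p}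
    (h : HasFinDerivAt u u' (Icc 0 T) t) : pwTimeDeriv T (fun s => qFun (u s)) t = qFun u' := by
  funext K x
  exact h.timeDeriv ((LinearMap.proj x).comp (qLin K)) hT ht

lemma pwTimeDeriv_mFun (hT : 0 < T) (ht : t ∈ Icc 0 T) {u : ℝ → M.MSpace p} {u' : M.MSpace p}
    (h : HasFinDerivAt u u' (Icc 0 T) t) : pwTimeDeriv T (fun s => mFun (u s)) t = mFun u' := by
  funext F x
  exact h.timeDeriv ((LinearMap.proj x).comp (mLin F)) hT ht

lemma pwTimeDeriv_congr {I A X : Type} [NormedAddCommGroup X] [NormedSpace ℝ X]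
    {u v : ℝ → I → A → X} (h : ∀ s ∈ Icc 0 T, u s = v s) (ht : t ∈ Icc 0 T) :
    pwTimeDeriv T u t = pwTimeDeriv T v t := by
  funext i x
  exact derivWithin_congr (fun s hs => by rw [h s hs]) (by rw [h t ht])

lemma timeDeriv_congr {X : Type} [NormedAddCommGroup X] [NormedSpace ℝ X]
    {u v : ℝ → X} (h : ∀ s ∈ Icc 0 T, u s = v s) (ht : t ∈ Icc 0 T) :
    timeDeriv T u t = timeDeriv T v t :=
  derivWithin_congr h (h t ht)

end TimeDerivatives

/-! ### Regularity of the projections in time -/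

open Classical in
/-- The element of `S_p` which is equal to a given polynomial on one element and zero elsewhere. -/
def sSingle (K : M.Elem) (g : Sp (n + 1) → ℝ) (hg : g ∈ polySpace (n + 1) (p + 1)) :
    M.SSpace p :=
  Pi.single K ⟨g, hg⟩

lemma sFun_sSingle_self (K : M.Elem) {g : Sp (n + 1) → ℝ} (hg : g ∈ polySpace (n + 1) (p + 1)) :
    sFun (sSingle K g hg) K = g := by
  classical
  have h1 : sSingle K g hg K = ⟨g, hg⟩ := Pi.single_eq_same K _
  exact congrArg Subtype.val h1

lemma sFun_sSingle_of_ne {K K' : M.Elem} (h : K' ≠ K) {g : Sp (n + 1) → ℝ}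
    (hg : g ∈ polySpace (n + 1) (p + 1)) : sFun (sSingle K g hg) K' = 0 := by
  classical
  have h1 : sSingle K g hg K' = 0 := Pi.single_eq_of_ne h _
  exact congrArg Subtype.val h1

lemma mB_sSingle (ρ : M.SSpace p) (K : M.Elem) {g : Sp (n + 1) → ℝ}
    (hg : g ∈ polySpace (n + 1) (p + 1)) :
    mB M p ρ (sSingle K g hg) = ∫ x in hull K.1, sFun ρ K x * g x := by
  rw [mB_apply, mForm, Finset.sum_eq_single K]
  · rw [sFun_sSingle_self]
  · intro K' _ h
    simp only [sFun_sSingle_of_ne h hg, Pi.zero_apply, mul_zero, integral_zero]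
  · simp

lemma sB_sSingle (τ : M.Elem → M.Facet → ℝ) (ρ : M.SSpace p) (K : M.Elem) {g : Sp (n + 1) → ℝ}
    (hg : g ∈ polySpace (n + 1) (p + 1)) : sB p τ ρ (sSingle K g hg) =
      ∑ F ∈ M.facetsOf K, τ K F * facetIntegral F.1 fun x => sFun ρ K x * g x := by
  rw [sB_apply, sForm, Finset.sum_eq_single K]
  · rw [sFun_sSingle_self]
    simp only [mul_assoc, facetIntegral_const_mul]
  · intro K' _ h
    simp only [sFun_sSingle_of_ne h hg, Pi.zero_apply, mul_zero, facetIntegral, integral_zero,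
      Finset.sum_const_zero]
  · simp

lemma inner_tS_sSingle (hΩr : interior (closure Ω) = Ω) (f : L2 Ω ℝ) (K : M.Elem)
    {g : Sp (n + 1) → ℝ} (hg : g ∈ polySpace (n + 1) (p + 1)) :
    ⟪f, tS hΩr (sSingle K g hg)⟫ = ∫ x in hull K.1, f x * g x := by
  rw [inner_tS, Finset.sum_eq_single K]
  · rw [sFun_sSingle_self]
  · intro K' _ h
    simp only [sFun_sSingle_of_ne h hg, Pi.zero_apply, mul_zero, integral_zero]
  · simp

/-- Moments over an element are continuous functionals on `L²(Ω)`. -/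
lemma exists_clm_eq_integral (hΩr : interior (closure Ω) = Ω) (K : M.Elem) {X : Type}
    [NormedAddCommGroup X] [InnerProductSpace ℝ X] {g : Sp (n + 1) → X} (hg : Continuous g) :
    ∃ ℓ : L2 Ω X →L[ℝ] ℝ, ∀ f : L2 Ω X, ℓ f = ∫ x in hull K.1, ⟪f x, g x⟫ := by
  classical
  set u : M.Elem → Sp (n + 1) → X := fun K' => if K' = K then g else 0 with hu
  have hm : ∀ K' : M.Elem, MemLp (u K') 2 (volume.restrict (hull K'.1)) := by
    intro K'
    refine memLp_hull ?_ _ _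
    simp only [hu]
    split_ifs
    · exact hg
    · exact continuous_zero
  refine ⟨innerSL ℝ (toL2 u), fun f => ?_⟩
  rw [innerSL_apply_apply, real_inner_comm, inner_toL2 hΩr f hm, Finset.sum_eq_single K]
  · simp [hu]
  · intro K' _ h
    simp [hu, h]
  · simp

lemma eq_zero_of_mvB {q : M.QSpace p} (h : mvB M p q q = 0) : q = 0 := by
  rw [mvB_apply, mvForm, Finset.sum_eq_zero_iff_of_nonneg
    (fun K _ => integral_nonneg fun x => real_inner_self_nonneg)] at h
  funext K i
  refine Subtype.ext (eq_zero_of_integral_sq_hull (q K i).2 K ?_)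
  have h1 := h K (Finset.mem_univ _)
  have hq := continuous_of_mem_polySpace (q K i).2
  refine le_antisymm ?_ (integral_nonneg fun x => sq_nonneg _)
  rw [← h1]
  refine integral_mono (integrableOn_hull (hq.pow 2) K)
    (integrable_inner_of_memLp (memLp_qFun q K) (memLp_qFun q K)) fun x => ?_
  simp only [PiLp.inner_apply, inner_eq_mul]
  have h2 := Finset.single_le_sum (f := fun i => qFun q K x i * qFun q K x i)
    (fun i _ => mul_self_nonneg _) (Finset.mem_univ i)
  refine le_trans (le_of_eq ?_) h2
  exact pow_two _

lemma exists_elem (F : M.Facet) : ∃ K : M.Elem, F.1 ⊆ K.1 := by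
  obtain ⟨K, hK, hFK, hc⟩ := M.pure F.1 F.2.1
  exact ⟨⟨K, hK, hc⟩, hFK⟩

section Regularity
variable {T : ℝ} {τ : M.Elem → M.Facet → ℝ} {ψ : ℝ → L2 Ω ℝ} {v : ℝ → L2 Ω (Sp (n + 1))}
  {D : ℝ → L2 Ω ℝ} {πS : ℝ → M.SSpace p} {πQ : ℝ → M.QSpace p} {πM : ℝ → M.MSpace p}

/-- `Π_Q v` inherits the regularity of `v` and of the projection error. -/
lemma memWFin_flux_projection (hΩr : interior (closure Ω) = Ω) (hT : 0 < T) (hv : MemW 1 T 3 v)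
    (hδv : MemW 1 T 3 (fun t => tQ hΩr (πQ t) - v t)) : MemWFin 1 T 3 πQ := by
  refine MemWFin.of_separating le_rfl hT (range (mvB M p)) ?_ ?_
  · intro q hq
    exact eq_zero_of_mvB (hq _ ⟨q, rfl⟩)
  · rintro _ ⟨r, rfl⟩
    refine ((hδv.add le_rfl hT hv).clm le_rfl hT (innerSL ℝ (tQ hΩr r))).congr hT fun t _ => ?_
    simp only [sub_add_cancel, innerSL_apply_apply]
    rw [inner_tQ_tQ]

/-- The facet moments of `ψ` are continuous functionals of the pair `(ψ, ∇ψ)`, so that `Π_M ψ` has the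
regularity of this pair. -/
lemma memWFin_skeleton_projection (hΩr : interior (closure Ω) = Ω) (hT : 0 < T)
    (hψ : MemW 1 T 3 ψ) (hv : MemW 1 T 3 v) (hgrad : ∀ t ∈ Icc 0 T, MemH10 Ω (ψ t) (v t))
    (hm : ∀ t ∈ Icc 0 T, IsSkeletonProjection (ψ t) (πM t)) : MemWFin 1 T 3 πM := by
  refine MemWFin.of_separating le_rfl hT {l | ∃ (F : M.IFacet) (μ : M.MSpace p),
    l = (pairing (facetMeasure F.1) (mLin F) (mLin F)
      (fun w => memLp_mFun w F) (fun w => memLp_mFun w F)).flip μ} ?_ ?_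
  · intro l hl
    funext F
    have h1 := hl _ ⟨F, l, rfl⟩
    obtain ⟨P, hP, hlP⟩ := exists_mFun_eq l F
    obtain ⟨K, hFK⟩ := exists_elem F.1
    have h2 : facetIntegral F.1.1 (fun x => P x ^ 2) = 0 := by
      rw [← h1]
      refine facetIntegral_congr fun x hx => ?_
      change P x ^ 2 = ⟪mFun l F x, mFun l F x⟫
      rw [hlP, indicator_of_mem hx, inner_eq_mul, pow_two]
    have h3 := eqOn_zero_of_facetIntegral_sq (continuous_of_mem_polySpace hP) hFK h2
    refine Subtype.ext ?_
    change mFun l F = 0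
    rw [hlP]
    ext x
    by_cases hx : x ∈ hull F.1.1
    · rw [indicator_of_mem hx, h3 x hx]; rfl
    · rw [indicator_of_notMem hx]; rfl
  · rintro _ ⟨F, μ, rfl⟩
    obtain ⟨K, hFK⟩ := exists_elem F.1
    obtain ⟨a, ha, hFa⟩ := exists_eq_erase hFK
    obtain ⟨-, η, hη, hh⟩ := outwardNormal_spec K.indep K.card_eq ha
    obtain ⟨g, hg, hμ⟩ := exists_mFun_eq μ F
    have hgs := contDiff_of_mem_polySpace hg
    have hφ := contDiff_smul_sub hgs a
    have hφ1 : ContDiff ℝ 1 fun x => g x • (x - a) := hφ.of_le (by exact_mod_cast le_top)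
    have hdc := continuous_divergence hφ1
    obtain ⟨ℓ₁, h1⟩ := exists_clm_eq_integral hΩr K hdc
    obtain ⟨ℓ₂, h2⟩ := exists_clm_eq_integral hΩr K hφ.continuous
    have h3 := ((hψ.clm le_rfl hT ℓ₁).add le_rfl hT (hv.clm le_rfl hT ℓ₂)).const_mul le_rfl hT η⁻¹
    refine h3.congr hT fun t ht => ?_
    obtain ⟨γ, hγ, -⟩ := hm t ht
    have h4 := (hγ K).facet_moment hΩr (hgrad t ht) hFK ha hFa hh hgs
    have h5 : (pairing (facetMeasure F.1) (mLin F) (mLin F)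
      (fun w => memLp_mFun w F) (fun w => memLp_mFun w F)).flip μ (πM t) =
        facetIntegral F.1.1 fun x => mFun (πM t) F x * g x := by
      refine facetIntegral_congr fun x hx => ?_
      change ⟪mFun (πM t) F x, mFun μ F x⟫ = _
      rw [hμ, indicator_of_mem hx, inner_eq_mul]
    rw [h5, skeleton_moment hΩr (hgrad t ht) (hm t ht) hFK (hγ K) hg, inv_mul_eq_iff_eq_mul₀ hη.ne',
      ← h4, coneFunctional, h1, h2]
    have hle := restrict_hull_le hΩr K
    have i1 := integrable_inner_of_memLp ((Lp.memLp (ψ t)).mono_measure hle)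
      (memLp_hull hdc K.1 2)
    have i2 := integrable_inner_of_memLp ((Lp.memLp (v t)).mono_measure hle)
      (memLp_hull hφ.continuous K.1 2)
    rw [← integral_add i1 i2]
    simp only [inner_eq_mul]

/-- `Π_S ψ` is determined by its moments of degree less than `p`, which are those of `ψ`, and by its
values on the stabilized facets, that is, by `s_h(Π_S ψ, ·)`. The latter is a combination of `Π_Q v`,
`Π_M ψ` and `∇·v`. -/
lemma memWFin_potential_projection (hΩ : IsOpen Ω) (hΩr : interior (closure Ω) = Ω) (hT : 0 < T)
    (hτ : ∀ K F, 0 ≤ τ K F) {Fτ : M.Elem → M.Facet} (hFτ : ∀ K, Fτ K ∈ M.facetsOf K)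
    (hτF : ∀ K, 0 < τ K (Fτ K))
    (hψ : MemW 1 T 3 ψ) (hD : MemW 1 T 3 D)
    (hgrad : ∀ t ∈ Icc 0 T, MemH10 Ω (ψ t) (v t))
    (hdiv : ∀ t ∈ Icc 0 T, HasWeakDiv Ω (v t) (D t))
    (hπ : ∀ t ∈ Icc 0 T, IsHDGProjection τ (ψ t) (v t) (πS t) (πQ t))
    (hm : ∀ t ∈ Icc 0 T, IsSkeletonProjection (ψ t) (πM t))
    (hQ : MemWFin 1 T 3 πQ) (hM : MemWFin 1 T 3 πM) : MemWFin 1 T 3 πS := by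
  refine MemWFin.of_separating le_rfl hT
    ({l | ∃ (K : M.Elem) (r : Sp (n + 1) → ℝ) (hr : r ∈ polySpace (n + 1) p),
      l = (mB M p).flip (sSingle K r (polySpace_mono p.le_succ hr))} ∪
      range (sB p τ).flip) ?_ ?_
  · intro ρ hρ
    funext K
    refine Subtype.ext ?_
    refine eq_zero_of_moments (K := K) (ρ K).2 (mem_facetsOf.1 (hFτ K)) (fun r hr => ?_) ?_
    · have := hρ _ (Or.inl ⟨K, r, hr, rfl⟩)
      rwa [LinearMap.flip_apply, mB_sSingle] at this
    · have h1 := hρ _ (Or.inr ⟨sSingle K (sFun ρ K) (sFun_mem ρ K), rfl⟩)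
      rw [LinearMap.flip_apply, sB_sSingle, Finset.sum_eq_zero_iff_of_nonneg] at h1
      · exact (mul_eq_zero.1 (h1 _ (hFτ K))).resolve_left (hτF K).ne'
      · intro F _
        exact mul_nonneg (hτ K F) (integral_nonneg fun x => mul_self_nonneg _)
  · rintro _ (⟨K, r, hr, rfl⟩ | ⟨w, rfl⟩)
    · refine (hψ.clm le_rfl hT (innerSL ℝ (tS hΩr
        (sSingle K r (polySpace_mono p.le_succ hr))))).congr hT fun t ht => ?_
      rw [innerSL_apply_apply, real_inner_comm, inner_tS_sSingle, LinearMap.flip_apply, mB_sSingle,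
        sFun_moment (hπ t ht) K hr hΩr]
    · have h1 := (((hQ (bB M p w)).add le_rfl hT ((hM ((fB p τ).flip w)).const_mul le_rfl hT (-1)))).add
        le_rfl hT ((hD.clm le_rfl hT (innerSL ℝ (tS hΩr w))).const_mul le_rfl hT (-1))
      refine h1.congr hT fun t ht => ?_
      have h2 := divergence_projection_eq hΩ hΩr (hgrad t ht) (hdiv t ht) (hπ t ht) (hm t ht) w
      rw [innerSL_apply_apply, real_inner_comm, LinearMap.flip_apply, LinearMap.flip_apply]
      linarith

end Regularity
end Mesh

namespace Mesh
variable {n : ℕ} {Ω : Set (Sp (n + 1))} {M : Mesh Ω} {p : ℕ}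

/-! ### The energy estimate -/

lemma mB_self (z : M.SSpace p) : mB M p z z = ∑ K : M.Elem, ∫ x in hull K.1, sFun z K x ^ 2 := by
  simp only [mB_apply, mForm, pow_two]

lemma mB_self_nonneg (z : M.SSpace p) : 0 ≤ mB M p z z := by
  rw [mB_self]
  exact Finset.sum_nonneg fun K _ => integral_nonneg fun x => sq_nonneg _

lemma mvB_self_nonneg (q : M.QSpace p) : 0 ≤ mvB M p q q := by
  rw [mvB_apply, mvForm]
  exact Finset.sum_nonneg fun K _ => integral_nonneg fun x => real_inner_self_nonneg

lemma mul_mB_le_wB {k a₀ : ℝ} {α : M.SSpace p}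
    (h : ∀ K : M.Elem, ∀ x ∈ hull K.1, a₀ ≤ 1 + 2 * k * sFun α K x) (z : M.SSpace p) :
    a₀ * mB M p z z ≤ wB k α z z := by
  rw [mB_self, wB_apply, Finset.mul_sum]
  refine Finset.sum_le_sum fun K _ => ?_
  rw [← integral_const_mul]
  have h1 := continuous_sFun z K
  have h2 := continuous_sFun α K
  refine setIntegral_mono_on (integrableOn_hull (by fun_prop) K)
    (integrableOn_hull (by fun_prop) K) (isCompact_hull K.1).measurableSet fun x hx => ?_
  have := mul_le_mul_of_nonneg_right (h K x hx) (sq_nonneg (sFun z K x))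
  linarith

/-- The embedding of `S_p` into `L^∞(Ω)`. -/
def tInf : M.SSpace p →ₗ[ℝ] Lp ℝ ⊤ (volume.restrict Ω) where
  toFun w := MemLp.toLp (glue (sFun w)) (memLp_glue fun K => memLp_hull (continuous_sFun w K) _ _)
  map_add' z w := by
    rw [← MemLp.toLp_add]
    refine MemLp.toLp_congr _ _ (Filter.Eventually.of_forall fun x => ?_)
    rw [Pi.add_apply]
    simp only [glue]
    rw [← Finset.sum_add_distrib]
    refine Finset.sum_congr rfl fun K _ => ?_
    have : sFun (z + w) K = sFun z K + sFun w K := (sLin K).map_add z w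
    rw [this, indicator_add']; rfl
  map_smul' a w := by
    rw [RingHom.id_apply, ← MemLp.toLp_const_smul]
    refine MemLp.toLp_congr _ _ (Filter.Eventually.of_forall fun x => ?_)
    rw [Pi.smul_apply]
    simp only [glue]
    rw [Finset.smul_sum]
    refine Finset.sum_congr rfl fun K _ => ?_
    have : sFun (a • w) K = a • sFun w K := (sLin K).map_smul a w
    rw [this]; exact congrFun (indicator_const_smul _ a (sFun w K)) x

lemma norm_tInf (α : M.SSpace p) :
    ‖tInf α‖ = (eLpNorm (glue (sFun α)) ⊤ (volume.restrict Ω)).toReal :=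
  Lp.norm_toLp _ (memLp_glue fun K => memLp_hull (continuous_sFun α K) _ _)

lemma abs_mC_le (hΩr : interior (closure Ω) = Ω) (α z : M.SSpace p) :
    |mC M p α z z| ≤ ‖tInf α‖ * mB M p z z := by
  have hα : ∀ K : M.Elem, ∀ᵐ x ∂(volume.restrict (hull K.1)), |sFun α K x| ≤ ‖tInf α‖ := by
    intro K
    have hm : MemLp (glue (sFun α)) ⊤ (volume.restrict Ω) :=
      memLp_glue fun K => memLp_hull (continuous_sFun α K) _ _
    have h1 := ae_mono (restrict_hull_le hΩr K)
      (ae_le_eLpNormEssSup (f := glue (sFun α)) (μ := volume.restrict Ω))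
    filter_upwards [h1, glue_ae_eq (sFun α) K] with x h1 h3
    rw [norm_tInf, ← h3, ← Real.norm_eq_abs, ← toReal_enorm, eLpNorm_exponent_top]
    refine ENNReal.toReal_mono ?_ h1
    rw [← eLpNorm_exponent_top]
    exact hm.2.ne
  rw [mC_apply, mB_self, Finset.mul_sum]
  refine (Finset.abs_sum_le_sum_abs _ _).trans (Finset.sum_le_sum fun K _ => ?_)
  rw [← integral_const_mul]
  refine (abs_integral_le_integral_abs).trans ?_
  have h1 := continuous_sFun z K
  have h2 := continuous_sFun α K
  refine integral_mono_ae (integrableOn_hull (by fun_prop) K)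
    (integrableOn_hull (by fun_prop) K) ?_
  filter_upwards [hα K] with x hx
  rw [mul_assoc, abs_mul, ← pow_two, abs_of_nonneg (sq_nonneg (sFun z K x))]
  exact mul_le_mul_of_nonneg_right hx (sq_nonneg _)

lemma facetIntegral_sqrt_sq {a : ℝ} (ha : 0 ≤ a) (F : M.Facet) (u : Sp (n + 1) → ℝ) :
    facetIntegral F.1 (fun x => (√a * u x) ^ 2) = a * facetIntegral F.1 fun x => u x * u x := by
  rw [← facetIntegral_const_mul]
  refine facetIntegral_congr fun x _ => ?_
  rw [mul_pow, Real.sq_sqrt ha, pow_two (u x)]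

/-- The stabilization terms are a sum of squares. -/
lemma stabilization_eq {τ : M.Elem → M.Facet → ℝ} (hτ : ∀ K F, 0 ≤ τ K F) (ψ : M.SSpace p)
    (l : M.MSpace p) :
    sB p τ ψ ψ + 2 * fB p τ l ψ + gB p τ l l =
      (∑ K : M.Elem, ∑ F ∈ M.iFacetsOf K,
          facetIntegral F.1.1 fun x => (√(τ K F.1) * (mFun l F x - sFun ψ K x)) ^ 2)
      + ∑ K : M.Elem, ∑ F ∈ M.bFacetsOf K,
          facetIntegral F.1 fun x => (√(τ K F) * sFun ψ K x) ^ 2 := by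
  rw [sB_apply, fB_apply, gB_apply, sForm, fForm, gForm, mul_neg, Finset.mul_sum,
    ← sub_eq_add_neg, ← Finset.sum_sub_distrib, ← Finset.sum_add_distrib,
    ← Finset.sum_add_distrib]
  refine Finset.sum_congr rfl fun K _ => ?_
  rw [sum_facetsOf_split]
  have hψ := continuous_sFun ψ K
  have e1 : ∀ F : M.Facet, facetIntegral F.1 (fun x => τ K F * sFun ψ K x * sFun ψ K x) =
      facetIntegral F.1 fun x => (√(τ K F) * sFun ψ K x) ^ 2 := by
    intro F
    rw [facetIntegral_sqrt_sq (hτ K F)]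
    simp only [mul_assoc, facetIntegral_const_mul]
  have e2 : ∀ F : M.IFacet,
      facetIntegral F.1.1 (fun x => (√(τ K F.1) * (mFun l F x - sFun ψ K x)) ^ 2) =
      facetIntegral F.1.1 (fun x => τ K F.1 * sFun ψ K x * sFun ψ K x)
        - 2 * facetIntegral F.1.1 (fun x => τ K F.1 * mFun l F x * sFun ψ K x)
        + facetIntegral F.1.1 (fun x => τ K F.1 * mFun l F x * mFun l F x) := by
    intro F
    rw [facetIntegral_sqrt_sq (hτ K F.1)]
    simp only [mul_assoc, facetIntegral_const_mul]
    have i1 : Integrable (fun x => sFun ψ K x * sFun ψ K x) (facetMeasure F.1) :=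
      integrable_facet (hψ.mul hψ) F.1
    have i2 : Integrable (fun x => mFun l F x * sFun ψ K x) (facetMeasure F.1) :=
      integrable_mFun_mul l F hψ
    have i3 : Integrable (fun x => mFun l F x * mFun l F x) (facetMeasure F.1) := by
      have : Integrable (fun x => ⟪mFun l F x, mFun l F x⟫) (facetMeasure F.1) :=
        integrable_inner_of_memLp (memLp_mFun l F) (memLp_mFun l F)
      simpa only [inner_eq_mul] using this
    have e3 : ∀ x, (mFun l F x - sFun ψ K x) * (mFun l F x - sFun ψ K x) =
        sFun ψ K x * sFun ψ K x - 2 * (mFun l F x * sFun ψ K x) + mFun l F x * mFun l F x :=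
      fun x => by ring
    have i4 : Integrable (fun x => sFun ψ K x * sFun ψ K x - 2 * (mFun l F x * sFun ψ K x))
        (facetMeasure F.1) := i1.sub (i2.const_mul 2)
    simp only [e3]
    rw [facetIntegral_eq, integral_add i4 i3, integral_sub i1 (i2.const_mul 2),
      integral_const_mul, ← facetIntegral_eq, ← facetIntegral_eq, ← facetIntegral_eq]
    ring
  simp only [e2, ← e1, Finset.sum_add_distrib, Finset.sum_sub_distrib, ← Finset.mul_sum]
  ring

lemma stabilization_nonneg {τ : M.Elem → M.Facet → ℝ} (hτ : ∀ K F, 0 ≤ τ K F) (ψ : M.SSpace p)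
    (l : M.MSpace p) : 0 ≤ sB p τ ψ ψ + 2 * fB p τ l ψ + gB p τ l l := by
  rw [stabilization_eq hτ]
  exact add_nonneg
    (Finset.sum_nonneg fun K _ => Finset.sum_nonneg fun F _ => integral_nonneg fun x => sq_nonneg _)
    (Finset.sum_nonneg fun K _ => Finset.sum_nonneg fun F _ => integral_nonneg fun x => sq_nonneg _)

/-- The discrete energy, written with the bilinear forms. -/
def discreteEnergy (τ : M.Elem → M.Facet → ℝ) (k c : ℝ) (α z ψ : M.SSpace p) (V : M.QSpace p)
    (l : M.MSpace p) : ℝ :=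
  1 / 2 * wB k α z z
    + c ^ 2 / 2 * (mvB M p V V + (sB p τ ψ ψ + 2 * fB p τ l ψ + gB p τ l l))

lemma energy_eq_discreteEnergy {τ : M.Elem → M.Facet → ℝ} (hτ : ∀ K F, 0 ≤ τ K F) {k c : ℝ}
    {α : M.SSpace p} (hα : ∀ K : M.Elem, ∀ x ∈ hull K.1, 0 ≤ 1 + 2 * k * sFun α K x)
    (z ψ : M.SSpace p) (V : M.QSpace p) (l : M.MSpace p) :
    energy τ k c (sFun α) (sFun z) (sFun ψ) (qFun V) (mFun l) = discreteEnergy τ k c α z ψ V l := by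
  rw [energy, discreteEnergy, stabilization_eq hτ, wB_apply, mvB_apply, mvForm, ← add_assoc]
  simp only [real_inner_self_eq_norm_sq]
  congr 2
  refine Finset.sum_congr rfl fun K _ => ?_
  refine setIntegral_congr_fun (isCompact_hull K.1).measurableSet fun x hx => ?_
  change (√(1 + 2 * k * sFun α K x) * sFun z K x) ^ 2 = _
  rw [mul_pow, Real.sq_sqrt (hα K x hx)]
  ring

/-- The bound of the discrete energy by its initial value and the data, for solutions of the error
equations. -/
theorem discreteEnergy_le (hΩr : interior (closure Ω) = Ω) {T : ℝ} (hT : 0 < T)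
    {τ : M.Elem → M.Facet → ℝ} (hτ : ∀ K F, 0 ≤ τ K F) {k c δ γ σ a₀ θ : ℝ} (hc : 0 < c)
    (hδ : 0 ≤ δ) (hγ : 0 < γ) (hσ : σ < 1) (ha₀ : 0 < a₀) (hθ : θ = 0 ∨ θ = 1)
    {α : ℝ → M.SSpace p} (hα : MemWFin 2 T 1 α)
    (hlow : ∀ t ∈ Icc 0 T, ∀ K : M.Elem, ∀ x ∈ hull K.1, a₀ ≤ 1 + 2 * k * sFun (α t) K x)
    (hsmall : ∫ t in (0 : ℝ)..T, (2 * |k| / a₀ * ‖tInf (finDeriv T α t)‖ + γ / T) ≤ σ)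
    {j : ℕ} {ψ : ℝ → M.SSpace p} {V : ℝ → M.QSpace p} {l : ℝ → M.MSpace p}
    (hψ : MemWFin 1 T (j + 2) ψ) (hV : MemWFin 1 T (j + 2) V) (hl : MemWFin 1 T (j + 2) l)
    {G : ℝ → L2 Ω (Sp (n + 1))} {Φ : ℝ → L2 Ω ℝ}
    (hG : IntervalIntegrable (fun t => ‖G t‖ ^ 2) volume 0 T)
    (hΦ : IntervalIntegrable (fun t => ‖Φ t‖ ^ 2) volume 0 T)
    (h₁ : ∀ t ∈ Ioo 0 T, ∀ r : M.QSpace p, mvB M p (finDeriv T V t) r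
      + bB M p (finDeriv T ψ t) r + eB M p (finDeriv T l t) r = ⟪G t, tQ hΩr r⟫)
    (h₂ : ∀ᵐ t, t ∈ Ioo 0 T → ∀ w : M.SSpace p, wB k (α t) (finDeriv T (finDeriv T ψ) t) w
      + θ * (2 * k * mC M p (finDeriv T α t) (finDeriv T ψ t) w)
      - c ^ 2 * bB M p w (V t + (δ / c ^ 2) • finDeriv T V t)
      + c ^ 2 * sB p τ (ψ t + (δ / c ^ 2) • finDeriv T ψ t) w
      + c ^ 2 * fB p τ (l t + (δ / c ^ 2) • finDeriv T l t) w = ⟪Φ t, tS hΩr w⟫)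
    (h₃ : ∀ t ∈ Ioo 0 T, ∀ μ : M.MSpace p,
      - eB M p μ (V t) + fB p τ μ (ψ t) + gB p τ (l t) μ = 0)
    (h₃' : ∀ t ∈ Ioo 0 T, ∀ μ : M.MSpace p, - eB M p μ (finDeriv T V t)
      + fB p τ μ (finDeriv T ψ t) + gB p τ (finDeriv T l t) μ = 0)
    {t : ℝ} (ht : t ∈ Icc 0 T) :
    discreteEnergy τ k c (α t) (finDeriv T ψ t) (ψ t) (V t) (l t) ≤ (1 - σ)⁻¹ *
      (discreteEnergy τ k c (α 0) (finDeriv T ψ 0) (ψ 0) (V 0) (l 0)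
        + (T / (2 * γ * a₀) * (∫ t in (0 : ℝ)..T, ‖Φ t‖ ^ 2)
          + (δ / 4 + c ^ 2 * T / (2 * γ)) * ∫ t in (0 : ℝ)..T, ‖G t‖ ^ 2)) := by
  have hz : MemWFin 1 T (j + 1) (finDeriv T ψ) := hψ.finDeriv le_rfl hT
  have h2 : (1 : ℝ≥0∞) ≤ 2 := by norm_num
  set z := finDeriv T ψ with hzdef
  -- absolute continuity of the energy
  have acα := hα.isFinAC h2 hT
  have acz := hz.isFinAC le_rfl hT
  have acψ := hψ.isFinAC le_rfl hT
  have acV := hV.isFinAC le_rfl hT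
  have acl := hl.isFinAC le_rfl hT
  have hE : AbsolutelyContinuousOnInterval
      (fun t => discreteEnergy τ k c (α t) (z t) (ψ t) (V t) (l t)) 0 T := by
    have h1 := (((IsFinAC.bilinear (mB M p) acz acz).fun_add
      ((IsFinAC.trilinear (mC M p) acα acz acz).const_mul (2 * k))).const_mul (1 / 2)).fun_add
      (((IsFinAC.bilinear (mvB M p) acV acV).fun_add
        (((IsFinAC.bilinear (sB p τ) acψ acψ).fun_add
          ((IsFinAC.bilinear (fB p τ) acl acψ).const_mul 2)).fun_add
          (IsFinAC.bilinear (gB p τ) acl acl))).const_mul (c ^ 2 / 2))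
    exact h1
  -- its derivative
  have hd : ∀ᵐ t, t ∈ Ioo 0 T → HasDerivAt
      (fun t => discreteEnergy τ k c (α t) (z t) (ψ t) (V t) (l t))
      (wB k (α t) (finDeriv T z t) (z t)
        + 1 / 2 * (2 * k * mC M p (finDeriv T α t) (z t) (z t))
        + c ^ 2 * (mvB M p (finDeriv T V t) (V t) + (sB p τ (ψ t) (z t) + fB p τ (l t) (z t)
          + fB p τ (finDeriv T l t) (ψ t) + gB p τ (l t) (finDeriv T l t)))) t := by
    filter_upwards [hα.ae_hasFinDerivAt h2 hT, hz.ae_hasFinDerivAt le_rfl hT,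
      hψ.ae_hasFinDerivAt le_rfl hT, hV.ae_hasFinDerivAt le_rfl hT,
      hl.ae_hasFinDerivAt le_rfl hT] with t dα dz dψ dV dl ht
    have dα := dα ht
    have dz := dz ht
    have dψ := dψ ht
    have dV := dV ht
    have dl := dl ht
    rw [← hzdef] at dψ
    have h1 := (((HasFinDerivAt.bilinear (mB M p) dz dz).fun_add
      ((HasFinDerivAt.trilinear (mC M p) dα dz dz).const_mul (2 * k))).const_mul (1 / 2)).fun_add
      (((HasFinDerivAt.bilinear (mvB M p) dV dV).fun_add
        (((HasFinDerivAt.bilinear (sB p τ) dψ dψ).fun_add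
          ((HasFinDerivAt.bilinear (fB p τ) dl dψ).const_mul 2)).fun_add
          (HasFinDerivAt.bilinear (gB p τ) dl dl))).const_mul (c ^ 2 / 2))
    rw [hasDerivWithinAt_univ] at h1
    refine HasDerivAt.congr_deriv h1 ?_
    rw [mB_comm (z t), mC_comm (α t) (z t), mvB_comm (V t), sB_comm τ (z t),
      gB_comm τ (finDeriv T l t)]
    simp only [wB, LinearMap.add_apply, LinearMap.smul_apply, smul_eq_mul]
    ring
  have hE0 : ∀ t ∈ Icc 0 T, 0 ≤ discreteEnergy τ k c (α t) (z t) (ψ t) (V t) (l t) := by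
    intro t ht
    have e1 := mul_mB_le_wB (hlow t ht) (z t)
    have e2 := mul_nonneg ha₀.le (mB_self_nonneg (z t))
    have e3 := mvB_self_nonneg (V t)
    have e4 := stabilization_nonneg hτ (ψ t) (l t)
    have e5 : 0 ≤ wB k (α t) (z t) (z t) := e2.trans e1
    rw [discreteEnergy]
    positivity
  have hβi : IntervalIntegrable (fun t => 2 * |k| / a₀ * ‖tInf (finDeriv T α t)‖ + γ / T)
      volume 0 T := by
    have h3 : MemWFin 2 T 0 (finDeriv T α) := hα.finDeriv h2 hT
    have h4 := (MemWFin.linearMap h2 hT (tInf (M := M) (p := p)) h3).intervalIntegrable h2 hT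
    exact (h4.norm.const_mul _).add intervalIntegrable_const
  have hmain := le_of_ae_deriv_le (σ := σ) hT hσ hE hE0 hd
    (β := fun t => 2 * |k| / a₀ * ‖tInf (finDeriv T α t)‖ + γ / T)
    (H := fun t => T / (2 * γ * a₀) * ‖Φ t‖ ^ 2 + (δ / 4 + c ^ 2 * T / (2 * γ)) * ‖G t‖ ^ 2)
    ?_ hβi (fun t => by positivity) ((hΦ.const_mul _).add (hG.const_mul _))
    (fun t => by positivity) hsmall ht
  · rw [intervalIntegral.integral_add (hΦ.const_mul _) (hG.const_mul _),
      intervalIntegral.integral_const_mul, intervalIntegral.integral_const_mul] at hmain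
    exact hmain
  · filter_upwards [h₂] with t h₂ ht
    have htI := Ioo_subset_Icc_self ht
    refine energy_rate_le (wB k (α t)) ((2 * k) • mC M p (finDeriv T α t)) (mB M p) (sB p τ)
      (mvB M p) (bB M p) (eB M p) (fB p τ) (gB p τ) (fun r => ⟪G t, tQ hΩr r⟫)
      (fun w => ⟪Φ t, tS hΩr w⟫) hc hδ ha₀ (norm_nonneg _) hγ hT hθ (ψ t) (z t)
      (finDeriv T z t) (V t) (finDeriv T V t) (l t) (finDeriv T l t) (h₁ t ht) (h₂ ht) (h₃ t ht)
      (h₃' t ht) (fun r => ?_) (fun r r' => ?_) (fun a r => ?_) ?_ ?_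
      (mul_mB_le_wB (hlow t htI) _) (mB_self_nonneg _) mvB_self_nonneg
      (stabilization_nonneg hτ _ _) (stabilization_nonneg hτ _ _)
    · rw [← inner_tQ_tQ hΩr, real_inner_self_eq_norm_sq, Real.sqrt_sq (norm_nonneg _)]
      exact abs_real_inner_le_norm _ _
    · beta_reduce
      rw [map_add, inner_add_right]
    · beta_reduce
      rw [map_smul, inner_smul_right]
    · rw [← inner_tS_tS hΩr, real_inner_self_eq_norm_sq, Real.sqrt_sq (norm_nonneg _)]
      exact abs_real_inner_le_norm _ _
    · simp only [LinearMap.smul_apply, smul_eq_mul]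
      rw [abs_mul, abs_mul, abs_two, mul_assoc (2 * |k|)]
      exact mul_le_mul_of_nonneg_left (abs_mC_le hΩr _ _) (by positivity)

end Mesh

section FinDeriv
variable {V : Type} [AddCommGroup V] [Module ℝ V] [FiniteDimensional ℝ V]
variable {q : ℝ≥0∞} {T : ℝ} {k : ℕ} {u w : ℝ → V} {t : ℝ}

lemma finDeriv_congr (h : ∀ s ∈ Icc 0 T, u s = w s) (ht : t ∈ Icc 0 T) :
    finDeriv T u t = finDeriv T w t := by
  refine Finset.sum_congr rfl fun i _ => ?_
  rw [Mesh.timeDeriv_congr (fun s hs => by rw [h s hs]) ht]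

lemma finDeriv_sub (hq : 1 ≤ q) (hT : 0 < T) (hu : MemWFin q T (k + 2) u)
    (hw : MemWFin q T (k + 2) w) (ht : t ∈ Icc 0 T) :
    finDeriv T (fun s => u s - w s) t = finDeriv T u t - finDeriv T w t :=
  ((hu.sub hq hT hw).hasFinDerivAt hq hT ht).unique (uniqueDiffOn_Icc hT t ht)
    ((hu.hasFinDerivAt hq hT ht).sub (hw.hasFinDerivAt hq hT ht))

lemma finDeriv_finDeriv_sub (hq : 1 ≤ q) (hT : 0 < T) (hu : MemWFin q T (k + 3) u)
    (hw : MemWFin q T (k + 3) w) (ht : t ∈ Icc 0 T) :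
    finDeriv T (finDeriv T fun s => u s - w s) t =
      finDeriv T (finDeriv T u) t - finDeriv T (finDeriv T w) t := by
  rw [finDeriv_congr (fun s hs => finDeriv_sub hq hT hu hw hs) ht]
  exact finDeriv_sub hq hT (hu.finDeriv hq hT) (hw.finDeriv hq hT) ht

end FinDeriv

namespace Mesh
variable {n : ℕ} {Ω : Set (Sp (n + 1))} {M : Mesh Ω} {p : ℕ}

/-! ### The weighted norm -/

section Weighted
variable {k a C : ℝ} {α : M.SSpace p}

lemma weight_ae (hΩr : interior (closure Ω) = Ω) {P : ℝ → Prop}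
    (h : ∀ K : M.Elem, ∀ x ∈ hull K.1, P (1 + 2 * k * sFun α K x)) :
    ∀ᵐ x ∂(volume.restrict Ω), P (1 + 2 * k * glue (sFun α) x) := by
  refine ae_of_forall_elem (M := M) hΩr fun K => ?_
  filter_upwards [glue_ae_eq (sFun α) K, ae_restrict_mem (isCompact_hull K.1).measurableSet]
    with x h1 h2
  rw [h1]
  exact h K x h2

lemma weightedSq_eq (hΩr : interior (closure Ω) = Ω)
    (h0 : ∀ K : M.Elem, ∀ x ∈ hull K.1, 0 ≤ 1 + 2 * k * sFun α K x) (g : L2 Ω ℝ) :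
    weightedSq k (sFun α) g = ∫ x in Ω, (1 + 2 * k * glue (sFun α) x) * g x ^ 2 := by
  refine integral_congr_ae ?_
  filter_upwards [weight_ae hΩr h0] with x hx
  rw [mul_pow, Real.sq_sqrt hx]

lemma integrable_weight (hΩr : interior (closure Ω) = Ω)
    (h0 : ∀ K : M.Elem, ∀ x ∈ hull K.1, 0 ≤ 1 + 2 * k * sFun α K x)
    (hC : ∀ K : M.Elem, ∀ x ∈ hull K.1, 1 + 2 * k * sFun α K x ≤ C) (g : L2 Ω ℝ) :
    IntegrableOn (fun x => (1 + 2 * k * glue (sFun α) x) * g x ^ 2) Ω := by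
  have h1 : IntegrableOn (fun x => g x ^ 2) Ω := by
    have := L2.integrable_inner (𝕜 := ℝ) g g
    simp only [inner_eq_mul, ← pow_two] at this
    exact this
  have h2 : MemLp (glue (sFun α)) 2 (volume.restrict Ω) := memLp_glue (memLp_sFun α)
  refine Integrable.bdd_mul h1 ((h2.1.const_mul (2 * k)).const_add 1) (c := C) ?_
  filter_upwards [weight_ae hΩr h0, weight_ae (P := fun y => y ≤ C) hΩr hC] with x a1 a2
  rw [Real.norm_eq_abs, abs_of_nonneg a1]
  exact a2

lemma weightedSq_le (hΩr : interior (closure Ω) = Ω)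
    (h0 : ∀ K : M.Elem, ∀ x ∈ hull K.1, 0 ≤ 1 + 2 * k * sFun α K x)
    (hC : ∀ K : M.Elem, ∀ x ∈ hull K.1, 1 + 2 * k * sFun α K x ≤ C) (g : L2 Ω ℝ) :
    weightedSq k (sFun α) g ≤ C * ‖g‖ ^ 2 := by
  have h1 : IntegrableOn (fun x => g x ^ 2) Ω := by
    have := L2.integrable_inner (𝕜 := ℝ) g g
    simp only [inner_eq_mul, ← pow_two] at this
    exact this
  have h2 : ‖g‖ ^ 2 = ∫ x in Ω, g x ^ 2 := by
    rw [← real_inner_self_eq_norm_sq, L2.inner_def]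
    simp only [inner_eq_mul, ← pow_two]
  rw [weightedSq_eq hΩr h0, h2, ← integral_const_mul]
  refine integral_mono_ae (integrable_weight hΩr h0 hC g) (h1.const_mul C) ?_
  filter_upwards [weight_ae (P := fun y => y ≤ C) hΩr hC] with x hx
  exact mul_le_mul_of_nonneg_right hx (sq_nonneg _)

lemma weightedSq_sub_le (hΩr : interior (closure Ω) = Ω)
    (h0 : ∀ K : M.Elem, ∀ x ∈ hull K.1, 0 ≤ 1 + 2 * k * sFun α K x)
    (hC : ∀ K : M.Elem, ∀ x ∈ hull K.1, 1 + 2 * k * sFun α K x ≤ C) (f g : L2 Ω ℝ) :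
    weightedSq k (sFun α) (f - g) ≤ 2 * weightedSq k (sFun α) f + 2 * weightedSq k (sFun α) g := by
  simp only [weightedSq_eq hΩr h0]
  rw [← integral_const_mul, ← integral_const_mul,
    ← integral_add ((integrable_weight hΩr h0 hC f).const_mul 2)
      ((integrable_weight hΩr h0 hC g).const_mul 2)]
  refine integral_mono_ae (integrable_weight hΩr h0 hC (f - g))
    (((integrable_weight hΩr h0 hC f).const_mul 2).add
      ((integrable_weight hΩr h0 hC g).const_mul 2)) ?_
  filter_upwards [weight_ae hΩr h0, Lp.coeFn_sub f g] with x h1 h2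
  rw [h2, Pi.sub_apply]
  have := mul_nonneg h1 (sq_nonneg (f x + g x))
  nlinarith

lemma weightedSq_tS (hΩr : interior (closure Ω) = Ω)
    (h0 : ∀ K : M.Elem, ∀ x ∈ hull K.1, 0 ≤ 1 + 2 * k * sFun α K x)
    (hC : ∀ K : M.Elem, ∀ x ∈ hull K.1, 1 + 2 * k * sFun α K x ≤ C) (z : M.SSpace p) :
    weightedSq k (sFun α) (tS hΩr z) = wB k α z z := by
  rw [weightedSq_eq hΩr h0, integral_eq_sum hΩr (integrable_weight hΩr h0 hC _), wB_apply]
  refine Finset.sum_congr rfl fun K _ => integral_congr_ae ?_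
  filter_upwards [glue_ae_eq (sFun α) K, toL2_ae hΩr (memLp_sFun z) K] with x h1 h2
  rw [h1, tS_apply, h2]
  ring

/-- The total error is the discrete error minus the projection error. -/
lemma error_le (hΩr : interior (closure Ω) = Ω) {τ : M.Elem → M.Facet → ℝ}
    (hτ : ∀ K F, 0 ≤ τ K F) {c : ℝ}
    (h0 : ∀ K : M.Elem, ∀ x ∈ hull K.1, 0 ≤ 1 + 2 * k * sFun α K x)
    (hC : ∀ K : M.Elem, ∀ x ∈ hull K.1, 1 + 2 * k * sFun α K x ≤ C) (z ψ : M.SSpace p)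
    (V : M.QSpace p) (l : M.MSpace p) (f : L2 Ω (Sp (n + 1))) (g : L2 Ω ℝ) :
    c ^ 2 / 2 * ‖tQ hΩr V - f‖ ^ 2 + 1 / 2 * weightedSq k (sFun α) (tS hΩr z - g) ≤
      c ^ 2 * ‖f‖ ^ 2 + weightedSq k (sFun α) g + 2 * discreteEnergy τ k c α z ψ V l := by
  have h1 := weightedSq_sub_le hΩr h0 hC (tS hΩr z) g
  rw [weightedSq_tS hΩr h0 hC] at h1
  have h2 : ‖tQ hΩr V - f‖ ^ 2 ≤ 2 * mvB M p V V + 2 * ‖f‖ ^ 2 := by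
    rw [← inner_tQ_tQ hΩr, real_inner_self_eq_norm_sq]
    have h3 := norm_sub_le (tQ hΩr V) f
    have h4 := norm_nonneg (tQ hΩr V - f)
    nlinarith [sq_nonneg (‖tQ hΩr V‖ - ‖f‖)]
  have h5 := stabilization_nonneg hτ ψ l
  have h6 := mul_le_mul_of_nonneg_left h2 (show 0 ≤ c ^ 2 / 2 by positivity)
  have h7 := mul_nonneg (sq_nonneg c) h5
  rw [discreteEnergy]
  linarith

end Weighted

lemma sSup_image_le_add {T : ℝ} (hT : 0 < T) {L R : ℝ → ℝ} {B C : ℝ}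
    (hL : ∀ t ∈ Ioo 0 T, L t ≤ R t + B) (hR : ∀ t ∈ Ioo 0 T, R t ≤ C) :
    BddAbove (L '' Ioo 0 T) ∧ BddAbove (R '' Ioo 0 T) ∧
      sSup (L '' Ioo 0 T) ≤ sSup (R '' Ioo 0 T) + B := by
  have hRb : BddAbove (R '' Ioo 0 T) := ⟨C, by rintro _ ⟨t, ht, rfl⟩; exact hR t ht⟩
  have hle : ∀ y ∈ L '' Ioo 0 T, y ≤ sSup (R '' Ioo 0 T) + B := by
    rintro _ ⟨t, ht, rfl⟩
    have := le_csSup hRb (mem_image_of_mem R ht)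
    linarith [hL t ht]
  exact ⟨⟨_, hle⟩, hRb, csSup_le ((nonempty_Ioo.2 hT).image L) hle⟩

/-! ### The error equations in time -/

section ErrorEquations
variable {T : ℝ} {t : ℝ}

lemma pwTimeDeriv_pwTimeDeriv_sFun {q : ℝ≥0∞} (hq : 1 ≤ q) (hT : 0 < T) (ht : t ∈ Icc 0 T) {j : ℕ}
    {u : ℝ → M.SSpace p} (h : MemWFin q T (j + 3) u) :
    pwTimeDeriv T (pwTimeDeriv T fun s => sFun (u s)) t = sFun (finDeriv T (finDeriv T u) t) := by
  rw [pwTimeDeriv_congr (fun s hs => pwTimeDeriv_sFun hT hs (h.hasFinDerivAt hq hT hs)) ht]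
  exact pwTimeDeriv_sFun hT ht ((h.finDeriv hq hT).hasFinDerivAt hq hT ht)

lemma timeDeriv_sub_tS (hΩr : interior (closure Ω) = Ω) (hT : 0 < T) (ht : t ∈ Icc 0 T) {j : ℕ}
    {u : ℝ → M.SSpace p} (hu : MemWFin 1 T (j + 2) u) {ψ : ℝ → L2 Ω ℝ} (hψ : MemW 1 T (j + 2) ψ) :
    timeDeriv T (fun s => tS hΩr (u s) - ψ s) t = tS hΩr (finDeriv T u t) - timeDeriv T ψ t :=
  (((hu.hasFinDerivAt le_rfl hT ht).linearMap (tS hΩr)).fun_sub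
    (hψ.hasDerivWithinAt le_rfl hT ht)).derivWithin (uniqueDiffOn_Icc hT t ht)

lemma timeDeriv_timeDeriv_sub_tS (hΩr : interior (closure Ω) = Ω) (hT : 0 < T)
    (ht : t ∈ Icc 0 T) {j : ℕ} {u : ℝ → M.SSpace p} (hu : MemWFin 1 T (j + 3) u) {ψ : ℝ → L2 Ω ℝ}
    (hψ : MemW 1 T (j + 3) ψ) :
    timeDeriv T (timeDeriv T fun s => tS hΩr (u s) - ψ s) t =
      tS hΩr (finDeriv T (finDeriv T u) t) - timeDeriv T (timeDeriv T ψ) t := by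
  rw [timeDeriv_congr (fun s hs => timeDeriv_sub_tS hΩr hT hs hu hψ) ht]
  exact timeDeriv_sub_tS hΩr hT ht (hu.finDeriv le_rfl hT) (hψ.timeDeriv le_rfl hT)

lemma timeDeriv_sub_tQ (hΩr : interior (closure Ω) = Ω) (hT : 0 < T) (ht : t ∈ Icc 0 T) {j : ℕ}
    {u : ℝ → M.QSpace p} (hu : MemWFin 1 T (j + 2) u) {v : ℝ → L2 Ω (Sp (n + 1))}
    (hv : MemW 1 T (j + 2) v) :
    timeDeriv T (fun s => tQ hΩr (u s) - v s) t = tQ hΩr (finDeriv T u t) - timeDeriv T v t :=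
  (((hu.hasFinDerivAt le_rfl hT ht).linearMap (tQ hΩr)).fun_sub
    (hv.hasDerivWithinAt le_rfl hT ht)).derivWithin (uniqueDiffOn_Icc hT t ht)

/-- The wave equation of the semidiscrete problem, written with the bilinear forms. -/
lemma IsSemidiscreteSolution.wave_eq {τ : M.Elem → M.Facet → ℝ} {k c δ : ℝ} {α ψh : ℝ → M.SSpace p}
    {vh : ℝ → M.QSpace p} {lh : ℝ → M.MSpace p} (hT : 0 < T)
    (h : IsSemidiscreteSolution τ k c δ T α ψh vh lh) (ht : t ∈ Ioc 0 T) (w : M.SSpace p) :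
    wB k (α t) (finDeriv T (finDeriv T ψh) t) w
      - c ^ 2 * bB M p w (vh t + (δ / c ^ 2) • finDeriv T vh t)
      + c ^ 2 * sB p τ (ψh t + (δ / c ^ 2) • finDeriv T ψh t) w
      + c ^ 2 * fB p τ (lh t + (δ / c ^ 2) • finDeriv T lh t) w = 0 := by
  have htI := Ioc_subset_Icc_self ht
  have h2 := h.eq₂ t ht w
  rw [pwTimeDeriv_pwTimeDeriv_sFun le_rfl hT htI (j := 0) h.reg_psi,
    pwTimeDeriv_qFun hT htI (h.reg_v.hasFinDerivAt le_rfl hT htI),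
    pwTimeDeriv_sFun hT htI (h.reg_psi.hasFinDerivAt le_rfl hT htI),
    pwTimeDeriv_mFun hT htI (h.reg_l.hasFinDerivAt le_rfl hT htI)] at h2
  rw [wB_apply, bB_apply, sB_apply, fB_apply]
  exact h2

/-- The differential equation and the definition of the lifted forcing, tested with broken
polynomials. -/
lemma forcing_eq (hΩr : interior (closure Ω) = Ω) (hT : 0 < T) {k c δ : ℝ}
    {ψ : ℝ → L2 Ω ℝ} {D : ℝ → L2 Ω ℝ} {α πS φ : ℝ → M.SSpace p} (hψ : MemW 1 T 3 ψ)
    (hπS : MemWFin 1 T 3 πS) (ht : t ∈ Ioo 0 T)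
    (hpde : ∀ᵐ x ∂(volume.restrict Ω),
      (1 + 2 * k * timeDeriv T ψ t x) * timeDeriv T (timeDeriv T ψ) t x
        - c ^ 2 * D t x - δ * timeDeriv T D t x = 0)
    (hφ : IsL2Projection (fun x => (1 + 2 * k * glue (sFun (α t)) x)
        * timeDeriv T (timeDeriv T fun s => tS hΩr (πS s) - ψ s) t x
        - 2 * k * (timeDeriv T ψ t x - glue (sFun (α t)) x)
          * timeDeriv T (timeDeriv T ψ) t x) (φ t)) (w : M.SSpace p) :
    ⟪tS hΩr (φ t), tS hΩr w⟫ = wB k (α t) (finDeriv T (finDeriv T πS) t) w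
      - c ^ 2 * ⟪D t, tS hΩr w⟫ - δ * ⟪timeDeriv T D t, tS hΩr w⟫ := by
  have htI := Ioo_subset_Icc_self ht
  rw [inner_tS_tS, mB_apply, hφ w, wB_apply, inner_tS, inner_tS, Finset.mul_sum, Finset.mul_sum,
    ← Finset.sum_sub_distrib, ← Finset.sum_sub_distrib,
    timeDeriv_timeDeriv_sub_tS hΩr hT htI (j := 0) hπS hψ]
  refine Finset.sum_congr rfl fun K _ => ?_
  have hle := restrict_hull_le hΩr K
  have i0 : ∀ f : L2 Ω ℝ, IntegrableOn (fun x => f x * sFun w K x) (hull K.1) := fun f => by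
    have := integrable_inner_of_memLp ((Lp.memLp f).mono_measure hle) (memLp_sFun w K)
    simp only [inner_eq_mul] at this
    exact this
  set z := finDeriv T (finDeriv T πS) t
  have c1 := continuous_sFun (α t) K
  have c2 := continuous_sFun z K
  have c3 := continuous_sFun w K
  have i1 : IntegrableOn (fun x => (1 + 2 * k * sFun (α t) K x) * sFun z K x * sFun w K x)
      (hull K.1) := integrableOn_hull (by fun_prop) K
  have i2 := (i0 (D t)).const_mul (c ^ 2)
  have i3 := (i0 (timeDeriv T D t)).const_mul δ
  have i4 : IntegrableOn (fun x => (1 + 2 * k * sFun (α t) K x) * sFun z K x * sFun w K x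
      - c ^ 2 * (D t x * sFun w K x)) (hull K.1) := i1.sub i2
  rw [← integral_const_mul, ← integral_const_mul, ← integral_sub i1 i2, ← integral_sub i4 i3]
  refine integral_congr_ae ?_
  filter_upwards [ae_mono hle hpde, glue_ae_eq (sFun (α t)) K, toL2_ae hΩr (memLp_sFun z) K,
    ae_mono hle (Lp.coeFn_sub (tS hΩr z) (timeDeriv T (timeDeriv T ψ) t))] with x h1 h2 h3 h4
  rw [h4, h2, Pi.sub_apply, tS_apply, h3]
  linear_combination (-sFun w K x) * h1

end ErrorEquations
end Mesh

namespace Mesh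
variable {n : ℕ} {Ω : Set (Sp (n + 1))} {M : Mesh Ω} {p : ℕ}

section Differentiation
variable {T : ℝ} {j : ℕ} {τ : M.Elem → M.Facet → ℝ} {ψ : ℝ → M.SSpace p} {V : ℝ → M.QSpace p}
  {l : ℝ → M.MSpace p} {G : ℝ → L2 Ω (Sp (n + 1))} {t : ℝ}

lemma flux_eq_deriv (hΩr : interior (closure Ω) = Ω) (hT : 0 < T)
    (hψ : MemWFin 1 T (j + 2) ψ) (hV : MemWFin 1 T (j + 2) V) (hl : MemWFin 1 T (j + 2) l)
    (hG : MemW 1 T (j + 2) G) (r : M.QSpace p)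
    (h : ∀ t ∈ Ioo 0 T, mvB M p (V t) r + bB M p (ψ t) r + eB M p (l t) r = ⟪G t, tQ hΩr r⟫)
    (ht : t ∈ Ioo 0 T) :
    mvB M p (finDeriv T V t) r + bB M p (finDeriv T ψ t) r + eB M p (finDeriv T l t) r =
      ⟪timeDeriv T G t, tQ hΩr r⟫ := by
  have htI := Ioo_subset_Icc_self ht
  have d1 := (((hV.hasFinDerivAt le_rfl hT htI) ((mvB M p).flip r)).fun_add
    ((hψ.hasFinDerivAt le_rfl hT htI) ((bB M p).flip r))).fun_add
    ((hl.hasFinDerivAt le_rfl hT htI) ((eB M p).flip r))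
  have d2 := (hG.hasDerivWithinAt le_rfl hT htI).inner ℝ
    (hasDerivWithinAt_const t (Icc 0 T) (tQ hΩr r))
  rw [inner_zero_right, zero_add] at d2
  exact deriv_eq_of_eqOn_Ioo ht h d1 d2

lemma skeleton_eq_deriv (hT : 0 < T) (hψ : MemWFin 1 T (j + 2) ψ) (hV : MemWFin 1 T (j + 2) V)
    (hl : MemWFin 1 T (j + 2) l) (μ : M.MSpace p)
    (h : ∀ t ∈ Ioo 0 T, - eB M p μ (V t) + fB p τ μ (ψ t) + gB p τ (l t) μ = 0)
    (ht : t ∈ Ioo 0 T) :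
    - eB M p μ (finDeriv T V t) + fB p τ μ (finDeriv T ψ t) + gB p τ (finDeriv T l t) μ = 0 := by
  have htI := Ioo_subset_Icc_self ht
  have d1 := (((hV.hasFinDerivAt le_rfl hT htI) (eB M p μ)).fun_neg.fun_add
    ((hψ.hasFinDerivAt le_rfl hT htI) (fB p τ μ))).fun_add
    ((hl.hasFinDerivAt le_rfl hT htI) ((gB p τ).flip μ))
  exact deriv_eq_of_eqOn_Ioo ht h d1 (hasDerivWithinAt_const t (Icc 0 T) 0)

end Differentiation

/-- The equations of the discrete errors `(ψ, V, l) = (η_ψ, η_v, η_λ)`, with right hand side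
`G = δ_v` in the flux equation and `φ` in the wave equation. -/
structure IsErrorSolution (hΩr : interior (closure Ω) = Ω) (τ : M.Elem → M.Facet → ℝ)
    (k c δ T : ℝ) (α φ : ℝ → M.SSpace p) (G : ℝ → L2 Ω (Sp (n + 1))) (ψ : ℝ → M.SSpace p)
    (V : ℝ → M.QSpace p) (l : ℝ → M.MSpace p) : Prop where
  reg_psi : MemWFin 1 T 3 ψ
  reg_flux : MemWFin 1 T 3 V
  reg_trace : MemWFin 1 T 3 l
  flux : ∀ t ∈ Ioo 0 T, ∀ r : M.QSpace p,
    mvB M p (V t) r + bB M p (ψ t) r + eB M p (l t) r = ⟪G t, tQ hΩr r⟫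
  wave : ∀ t ∈ Ioo 0 T, ∀ w : M.SSpace p, wB k (α t) (finDeriv T (finDeriv T ψ) t) w
    - c ^ 2 * bB M p w (V t + (δ / c ^ 2) • finDeriv T V t)
    + c ^ 2 * sB p τ (ψ t + (δ / c ^ 2) • finDeriv T ψ t) w
    + c ^ 2 * fB p τ (l t + (δ / c ^ 2) • finDeriv T l t) w = ⟪tS hΩr (φ t), tS hΩr w⟫
  skeleton : ∀ t ∈ Ioo 0 T, ∀ μ : M.MSpace p,
    - eB M p μ (V t) + fB p τ μ (ψ t) + gB p τ (l t) μ = 0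

namespace IsErrorSolution
variable {hΩr : interior (closure Ω) = Ω} {τ : M.Elem → M.Facet → ℝ} {k c δ T : ℝ}
  {α φ : ℝ → M.SSpace p} {G : ℝ → L2 Ω (Sp (n + 1))} {ψ : ℝ → M.SSpace p}
  {V : ℝ → M.QSpace p} {l : ℝ → M.MSpace p}

lemma flux_deriv (h : IsErrorSolution hΩr τ k c δ T α φ G ψ V l) (hT : 0 < T) (hG : MemW 1 T 3 G) :
    ∀ t ∈ Ioo 0 T, ∀ r : M.QSpace p, mvB M p (finDeriv T V t) r + bB M p (finDeriv T ψ t) r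
      + eB M p (finDeriv T l t) r = ⟪timeDeriv T G t, tQ hΩr r⟫ := fun _ ht r =>
  flux_eq_deriv (j := 1) hΩr hT h.reg_psi h.reg_flux h.reg_trace hG r (fun s hs => h.flux s hs r) ht

lemma skeleton_deriv (h : IsErrorSolution hΩr τ k c δ T α φ G ψ V l) (hT : 0 < T) :
    ∀ t ∈ Ioo 0 T, ∀ μ : M.MSpace p, - eB M p μ (finDeriv T V t) + fB p τ μ (finDeriv T ψ t)
      + gB p τ (finDeriv T l t) μ = 0 := fun _ ht μ =>
  skeleton_eq_deriv (j := 1) hT h.reg_psi h.reg_flux h.reg_trace μ (fun s hs => h.skeleton s hs μ) ht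

/-- The time derivative of the wave equation. The coefficient is differentiable only almost
everywhere. -/
lemma wave_deriv (h : IsErrorSolution hΩr τ k c δ T α φ G ψ V l) (hT : 0 < T)
    (hα : MemWFin 2 T 1 α) (hφ : MemWFin 2 T 1 φ) :
    ∀ᵐ t, t ∈ Ioo 0 T → ∀ w : M.SSpace p,
      wB k (α t) (finDeriv T (finDeriv T (finDeriv T ψ)) t) w
      + 1 * (2 * k * mC M p (finDeriv T α t) (finDeriv T (finDeriv T ψ) t) w)
      - c ^ 2 * bB M p w (finDeriv T V t + (δ / c ^ 2) • finDeriv T (finDeriv T V) t)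
      + c ^ 2 * sB p τ (finDeriv T ψ t + (δ / c ^ 2) • finDeriv T (finDeriv T ψ) t) w
      + c ^ 2 * fB p τ (finDeriv T l t + (δ / c ^ 2) • finDeriv T (finDeriv T l) t) w =
        ⟪tS hΩr (finDeriv T φ t), tS hΩr w⟫ := by
  have h2 : (1 : ℝ≥0∞) ≤ 2 := by norm_num
  have hψ' := h.reg_psi.finDeriv le_rfl hT
  have hψ'' := hψ'.finDeriv le_rfl hT
  have hV' := h.reg_flux.finDeriv le_rfl hT
  have hl' := h.reg_trace.finDeriv le_rfl hT
  filter_upwards [hα.ae_hasFinDerivAt h2 hT, hφ.ae_hasFinDerivAt h2 hT,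
    hψ''.ae_hasFinDerivAt le_rfl hT] with t dα dφ dψ'' ht w
  have htI := Ioo_subset_Icc_self ht
  have dα := (dα ht).mono (subset_univ (Icc 0 T))
  have dφ := (dφ ht).mono (subset_univ (Icc 0 T))
  have dψ'' := (dψ'' ht).mono (subset_univ (Icc 0 T))
  have dψ := h.reg_psi.hasFinDerivAt le_rfl hT htI
  have dψ' := hψ'.hasFinDerivAt le_rfl hT htI
  have dV := h.reg_flux.hasFinDerivAt le_rfl hT htI
  have dV' := hV'.hasFinDerivAt le_rfl hT htI
  have dl := h.reg_trace.hasFinDerivAt le_rfl hT htI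
  have dl' := hl'.hasFinDerivAt le_rfl hT htI
  have dw : HasFinDerivAt (fun _ : ℝ => w) 0 (Icc 0 T) t := fun f => by
    rw [map_zero]
    exact hasDerivWithinAt_const t (Icc 0 T) (f w)
  have d1 := (((((dψ'' ((mB M p).flip w)).fun_add
    ((HasFinDerivAt.trilinear (mC M p) dα dψ'' dw).const_mul (2 * k))).fun_sub
    (((dV (bB M p w)).fun_add ((dV' (bB M p w)).const_mul (δ / c ^ 2))).const_mul (c ^ 2))).fun_add
    (((dψ ((sB p τ).flip w)).fun_add
      ((dψ' ((sB p τ).flip w)).const_mul (δ / c ^ 2))).const_mul (c ^ 2))).fun_add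
    (((dl ((fB p τ).flip w)).fun_add
      ((dl' ((fB p τ).flip w)).const_mul (δ / c ^ 2))).const_mul (c ^ 2)))
  have d2 := dφ ((mB M p).flip w)
  have key := deriv_eq_of_eqOn_Ioo ht (fun s hs => ?_) d1 d2
  · rw [inner_tS_tS]
    simp only [LinearMap.flip_apply, map_zero, add_zero] at key
    simp only [wB, map_add, map_smul, LinearMap.add_apply, LinearMap.smul_apply, smul_eq_mul]
    linarith
  · have := h.wave s hs w
    rw [inner_tS_tS] at this
    simp only [wB, map_add, map_smul, LinearMap.add_apply, LinearMap.smul_apply, smul_eq_mul] at this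
    simp only [LinearMap.flip_apply]
    linarith

end IsErrorSolution

end Mesh

section Norms
variable {X : Type} [NormedAddCommGroup X] [NormedSpace ℝ X] {q : ℝ≥0∞} {T : ℝ} {k : ℕ} {u : ℝ → X}

lemma MemW.intervalIntegrable_norm_sq (hq : 1 ≤ q) (hT : 0 < T) (h : MemW q T (k + 1) u) :
    IntervalIntegrable (fun t => ‖u t‖ ^ 2) volume 0 T := by
  refine ContinuousOn.intervalIntegrable ?_
  rw [uIcc_of_le hT.le]
  exact (h.continuousOn hq hT).norm.pow 2

lemma MemW.intervalIntegrable_norm_sq_of_two (hT : 0 < T) (h : MemW 2 T k u) :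
    IntervalIntegrable (fun t => ‖u t‖ ^ 2) volume 0 T := by
  rw [intervalIntegrable_iff_integrableOn_Ioc_of_le hT.le]
  exact h.memLp.integrable_norm_pow two_ne_zero

lemma MemW.exists_norm_le (hq : 1 ≤ q) (hT : 0 < T) (h : MemW q T (k + 1) u) :
    ∃ B : ℝ, ∀ t ∈ Icc 0 T, ‖u t‖ ≤ B :=
  isCompact_Icc.exists_bound_of_continuousOn (h.continuousOn hq hT)

end Norms

/-! ### Energy estimates for the discrete errors -/

namespace Mesh
variable {n : ℕ} {Ω : Set (Sp (n + 1))} {M : Mesh Ω} {p : ℕ}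

namespace IsErrorSolution
variable {hΩr : interior (closure Ω) = Ω} {τ : M.Elem → M.Facet → ℝ} {k c δ T : ℝ}
  {α φ : ℝ → M.SSpace p} {G : ℝ → L2 Ω (Sp (n + 1))} {ψ : ℝ → M.SSpace p}
  {V : ℝ → M.QSpace p} {l : ℝ → M.MSpace p} {γ σ a₀ : ℝ}

/-- The energy estimate of low order. -/
lemma energy_le (h : IsErrorSolution hΩr τ k c δ T α φ G ψ V l) (hT : 0 < T)
    (hτ : ∀ K F, 0 ≤ τ K F) (hc : 0 < c)
    (hδ : 0 ≤ δ) (hγ : 0 < γ) (hσ : σ < 1) (ha₀ : 0 < a₀)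
    (hα : MemWFin 2 T 1 α) (hφ : MemWFin 2 T 1 φ) (hG : MemW 1 T 3 G)
    (hlow : ∀ t ∈ Icc 0 T, ∀ K : M.Elem, ∀ x ∈ hull K.1, a₀ ≤ 1 + 2 * k * sFun (α t) K x)
    (hsmall : ∫ t in (0 : ℝ)..T, (2 * |k| / a₀ * ‖tInf (finDeriv T α t)‖ + γ / T) ≤ σ)
    {t : ℝ} (ht : t ∈ Icc 0 T) :
    discreteEnergy τ k c (α t) (finDeriv T ψ t) (ψ t) (V t) (l t) ≤ (1 - σ)⁻¹ *
      (discreteEnergy τ k c (α 0) (finDeriv T ψ 0) (ψ 0) (V 0) (l 0)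
        + (T / (2 * γ * a₀) * (∫ t in (0 : ℝ)..T, ‖tS hΩr (φ t)‖ ^ 2)
          + (δ / 4 + c ^ 2 * T / (2 * γ)) * ∫ t in (0 : ℝ)..T, ‖timeDeriv T G t‖ ^ 2)) := by
  have h2 : (1 : ℝ≥0∞) ≤ 2 := by norm_num
  refine discreteEnergy_le hΩr hT hτ hc hδ hγ hσ ha₀ (Or.inl rfl) hα hlow hsmall (j := 1)
    h.reg_psi h.reg_flux h.reg_trace ((hG.timeDeriv le_rfl hT).intervalIntegrable_norm_sq le_rfl hT)
    ((hφ.linearMap h2 hT (tS hΩr)).intervalIntegrable_norm_sq h2 hT) (h.flux_deriv hT hG)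
    (Filter.Eventually.of_forall fun t ht w => ?_) h.skeleton (h.skeleton_deriv hT) ht
  rw [zero_mul, add_zero]
  exact h.wave t ht w

/-- The energy estimate of high order, for the equations differentiated in time. -/
lemma deriv_energy_le (h : IsErrorSolution hΩr τ k c δ T α φ G ψ V l) (hT : 0 < T)
    (hτ : ∀ K F, 0 ≤ τ K F) (hc : 0 < c)
    (hδ : 0 ≤ δ) (hγ : 0 < γ) (hσ : σ < 1) (ha₀ : 0 < a₀)
    (hα : MemWFin 2 T 1 α) (hφ : MemWFin 2 T 1 φ) (hG : MemW 1 T 3 G)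
    (hlow : ∀ t ∈ Icc 0 T, ∀ K : M.Elem, ∀ x ∈ hull K.1, a₀ ≤ 1 + 2 * k * sFun (α t) K x)
    (hsmall : ∫ t in (0 : ℝ)..T, (2 * |k| / a₀ * ‖tInf (finDeriv T α t)‖ + γ / T) ≤ σ)
    {t : ℝ} (ht : t ∈ Icc 0 T) :
    discreteEnergy τ k c (α t) (finDeriv T (finDeriv T ψ) t) (finDeriv T ψ t) (finDeriv T V t)
      (finDeriv T l t) ≤ (1 - σ)⁻¹ *
      (discreteEnergy τ k c (α 0) (finDeriv T (finDeriv T ψ) 0) (finDeriv T ψ 0) (finDeriv T V 0)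
          (finDeriv T l 0)
        + (T / (2 * γ * a₀) * (∫ t in (0 : ℝ)..T, ‖timeDeriv T (fun s => tS hΩr (φ s)) t‖ ^ 2)
          + (δ / 4 + c ^ 2 * T / (2 * γ)) *
            ∫ t in (0 : ℝ)..T, ‖timeDeriv T (timeDeriv T G) t‖ ^ 2)) := by
  have h2 : (1 : ℝ≥0∞) ≤ 2 := by norm_num
  have hψ' := h.reg_psi.finDeriv le_rfl hT
  have hV' := h.reg_flux.finDeriv le_rfl hT
  have hl' := h.reg_trace.finDeriv le_rfl hT
  have hG' := hG.timeDeriv le_rfl hT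
  refine discreteEnergy_le hΩr hT hτ hc hδ hγ hσ ha₀ (Or.inr rfl) hα hlow hsmall (j := 0)
    hψ' hV' hl' ((hG'.timeDeriv le_rfl hT).intervalIntegrable_norm_sq le_rfl hT)
    (((hφ.linearMap h2 hT (tS hΩr)).timeDeriv h2 hT).intervalIntegrable_norm_sq_of_two hT)
    (fun t ht r => flux_eq_deriv (j := 0) hΩr hT hψ' hV' hl' hG' r
      (fun s hs => h.flux_deriv hT hG s hs r) ht) ?_ (h.skeleton_deriv hT)
    (fun t ht μ => skeleton_eq_deriv (j := 0) hT hψ' hV' hl' μ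
      (fun s hs => h.skeleton_deriv hT s hs μ) ht) ht
  filter_upwards [h.wave_deriv hT hα hφ, hφ.ae_hasFinDerivAt h2 hT] with t ht₁ ht₂ ht w
  have htI := Ioo_subset_Icc_self ht
  rw [((ht₂ ht).mono (subset_univ _)).timeDeriv (tS hΩr) hT htI]
  exact ht₁ ht w

end IsErrorSolution

/-- The differences of the projections and of the semidiscrete solution solve the error equations:
the projections satisfy the equations of the method up to `δ_v` in the flux equation. -/
lemma isErrorSolution (hΩ : IsOpen Ω) (hΩr : interior (closure Ω) = Ω) {k c δ T : ℝ} (hT : 0 < T)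
    (hc : 0 < c) {τ : M.Elem → M.Facet → ℝ} (hτ : ∀ K F, 0 ≤ τ K F) {Fτ : M.Elem → M.Facet}
    (hFτ : ∀ K, Fτ K ∈ M.facetsOf K) (hτF : ∀ K, 0 < τ K (Fτ K))
    {ψ₀ ψ₁ : L2 Ω ℝ} {ψ : ℝ → L2 Ω ℝ} {v : ℝ → L2 Ω (Sp (n + 1))}
    (hψ : IsWesterveltSolution Ω k c δ T ψ₀ ψ₁ ψ v)
    {πS : ℝ → M.SSpace p} {πQ : ℝ → M.QSpace p} {πM : ℝ → M.MSpace p}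
    (hπ : ∀ t ∈ Icc 0 T, IsHDGProjection τ (ψ t) (v t) (πS t) (πQ t))
    (hπM : ∀ t ∈ Icc 0 T, IsSkeletonProjection (ψ t) (πM t))
    {αh ψh φh : ℝ → M.SSpace p} {vh : ℝ → M.QSpace p} {lh : ℝ → M.MSpace p}
    (hψh : IsSemidiscreteSolution τ k c δ T αh ψh vh lh)
    (hδv : MemW 1 T 3 (fun t => tQ hΩr (πQ t) - v t))
    (hφ : ∀ t ∈ Icc 0 T, IsL2Projection (fun x =>
      (1 + 2 * k * glue (sFun (αh t)) x)
          * timeDeriv T (timeDeriv T fun s => tS hΩr (πS s) - ψ s) t x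
        - 2 * k * (timeDeriv T ψ t x - glue (sFun (αh t)) x)
          * timeDeriv T (timeDeriv T ψ) t x) (φh t)) :
    MemWFin 1 T 3 πS ∧ IsErrorSolution hΩr τ k c δ T αh φh (fun t => tQ hΩr (πQ t) - v t)
      (fun t => πS t - ψh t) (fun t => πQ t - vh t) (fun t => πM t - lh t) := by
  obtain ⟨D, hD, hdiv, hpde⟩ := hψ.eqn
  have hgrad := hψ.grad
  have rQ := memWFin_flux_projection hΩr hT hψ.reg_v hδv
  have rM := memWFin_skeleton_projection hΩr hT hψ.reg_psi hψ.reg_v hgrad hπM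
  have rS := memWFin_potential_projection hΩ hΩr hT hτ hFτ hτF hψ.reg_psi hD hgrad hdiv hπ hπM rQ rM
  refine ⟨rS, ⟨rS.sub le_rfl hT hψh.reg_psi, rQ.sub le_rfl hT hψh.reg_v,
    rM.sub le_rfl hT hψh.reg_l, fun t ht r => ?_, fun t ht w => ?_, fun t ht μ => ?_⟩⟩
  · have htI := Ioo_subset_Icc_self ht
    have h1 := flux_projection_eq hΩ hΩr (hgrad t htI) (hπ t htI) (hπM t htI) r
    have h2 := hψh.eq₁ t (Ioo_subset_Ioc_self ht) r
    rw [← mvB_apply, ← bB_apply, ← eB_apply] at h2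
    change mvB M p (πQ t - vh t) r + bB M p (πS t - ψh t) r + eB M p (πM t - lh t) r = _
    simp only [map_sub, LinearMap.sub_apply] at h1 ⊢
    linarith
  · have htI := Ioo_subset_Icc_self ht
    have h1 := fun s (hs : s ∈ Icc 0 T) =>
      divergence_projection_eq hΩ hΩr (hgrad s hs) (hdiv s hs) (hπ s hs) (hπM s hs) w
    have dQ := rQ.hasFinDerivAt le_rfl hT htI
    have dS := rS.hasFinDerivAt le_rfl hT htI
    have dM := rM.hasFinDerivAt le_rfl hT htI
    have d1 := ((dQ (bB M p w)).fun_sub (dS ((sB p τ).flip w))).fun_sub (dM ((fB p τ).flip w))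
    have d2 := (hD.hasDerivWithinAt le_rfl hT htI).inner ℝ
      (hasDerivWithinAt_const t (Icc 0 T) (tS hΩr w))
    rw [inner_zero_right, zero_add] at d2
    have h2 := deriv_eq_of_eqOn_Ioo ht (fun s hs => h1 s (Ioo_subset_Icc_self hs)) d1 d2
    have h3 := hψh.wave_eq hT (Ioo_subset_Ioc_self ht) w
    have h4 := forcing_eq hΩr hT hψ.reg_psi rS ht (hpde t ht) (hφ t htI) w
    rw [h4, finDeriv_finDeriv_sub le_rfl hT rS hψh.reg_psi htI (k := 0),
      finDeriv_sub le_rfl hT rS hψh.reg_psi htI, finDeriv_sub le_rfl hT rQ hψh.reg_v htI,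
      finDeriv_sub le_rfl hT rM hψh.reg_l htI]
    have h5 : c ^ 2 * (δ / c ^ 2) = δ := by field_simp
    rw [← h1 t htI, ← h2]
    simp only [LinearMap.flip_apply] at *
    simp only [map_sub, map_add, map_smul, LinearMap.sub_apply, LinearMap.add_apply,
      LinearMap.smul_apply, smul_eq_mul] at h3 ⊢
    linear_combination -h3 + (-(bB M p w (finDeriv T πQ t)) + sB p τ (finDeriv T πS t) w
      + fB p τ (finDeriv T πM t) w) * h5
  · have htI := Ioo_subset_Icc_self ht
    have h1 := skeleton_projection_eq hΩ hΩr (hgrad t htI) (hdiv t htI) (hπ t htI) (hπM t htI) μ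
    have h2 := hψh.eq₃ t (Ioo_subset_Ioc_self ht) μ
    rw [← eB_apply, ← fB_apply, ← gB_apply] at h2
    simp only [map_sub, LinearMap.sub_apply]
    linarith

section Coefficient
variable {T k a C : ℝ} {α : ℝ → M.SSpace p}

/-- Bounds of the coefficient extend to the closed time interval. -/
lemma coefficient_bounds_Icc (hT : 0 < T) (hα : MemWFin 2 T 1 α)
    (h : ∀ t ∈ Ioo 0 T, ∀ K : M.Elem, ∀ x ∈ hull K.1,
      a ≤ 1 + 2 * k * sFun (α t) K x ∧ 1 + 2 * k * sFun (α t) K x ≤ C) :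
    ∀ t ∈ Icc 0 T, ∀ K : M.Elem, ∀ x ∈ hull K.1,
      a ≤ 1 + 2 * k * sFun (α t) K x ∧ 1 + 2 * k * sFun (α t) K x ≤ C := by
  intro t ht K x hx
  have h2 : (1 : ℝ≥0∞) ≤ 2 := by norm_num
  have hc : ContinuousOn (fun t => 1 + 2 * k * sFun (α t) K x) (Icc 0 T) := by
    have h3 : ContinuousOn (fun t => sFun (α t) K x) (Icc 0 T) :=
      (hα ((LinearMap.proj x).comp (sLin K))).continuousOn h2 hT
    exact continuousOn_const.add (continuousOn_const.mul h3)
  have hcl : closure (Ioo 0 T) = Icc 0 T := closure_Ioo hT.ne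
  rw [← hcl] at hc ht
  exact ⟨le_on_closure (fun s hs => (h s hs K x hx).1) continuousOn_const hc ht,
    le_on_closure (fun s hs => (h s hs K x hx).2) hc continuousOn_const ht⟩

/-- The smallness assumption, as the bound of the growth factor in the energy estimate. -/
lemma integral_coefficient_le {γ σ : ℝ} (hT : 0 < T) (hα : MemWFin 2 T 1 α)
    (hsmall : |k| / a * (∫ t in (0 : ℝ)..T, (eLpNorm (glue (pwTimeDeriv T (fun s => sFun (α s)) t)) ⊤
          (volume.restrict Ω)).toReal) + γ / 2 ≤ σ / 2) :
    ∫ t in (0 : ℝ)..T, (2 * |k| / a * ‖tInf (finDeriv T α t)‖ + γ / T) ≤ σ := by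
  have h2 : (1 : ℝ≥0∞) ≤ 2 := by norm_num
  have h3 : MemWFin 2 T 0 (finDeriv T α) := hα.finDeriv h2 hT
  have h4 := (MemWFin.linearMap h2 hT (tInf (M := M) (p := p)) h3).intervalIntegrable h2 hT
  have h5 : ∫ t in (0 : ℝ)..T, (eLpNorm (glue (pwTimeDeriv T (fun s => sFun (α s)) t)) ⊤
      (volume.restrict Ω)).toReal = ∫ t in (0 : ℝ)..T, ‖tInf (finDeriv T α t)‖ := by
    rw [intervalIntegral.integral_of_le hT.le, intervalIntegral.integral_of_le hT.le]
    refine integral_congr_ae (ae_restrict_Ioc_of_Ioo ?_)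
    filter_upwards [hα.ae_hasFinDerivAt h2 hT] with t h ht
    rw [norm_tInf, pwTimeDeriv_sFun hT (Ioo_subset_Icc_self ht) ((h ht).mono (subset_univ _))]
  rw [h5] at hsmall
  rw [intervalIntegral.integral_add (h4.norm.const_mul _) intervalIntegrable_const,
    intervalIntegral.integral_const_mul, intervalIntegral.integral_const, smul_eq_mul, sub_zero,
    mul_div_cancel₀ _ hT.ne', mul_div_assoc, mul_assoc]
  linarith

end Coefficient

lemma singleFacet_nonneg {τbar : ℝ} (h : 0 < τbar) (Fτ : M.Elem → M.Facet) (K : M.Elem)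
    (F : M.Facet) : 0 ≤ M.singleFacet τbar Fτ K F := by
  rw [singleFacet]
  split_ifs
  exacts [h.le, le_rfl]

lemma singleFacet_self (τbar : ℝ) (Fτ : M.Elem → M.Facet) (K : M.Elem) :
    M.singleFacet τbar Fτ K (Fτ K) = τbar := if_pos rfl

end Mesh

end HDG

end

open HDG HDG.Mesh in
theorem mainTheorem5
    (d : ℕ) (hd : d = 2 ∨ d = 3) (Ω : Set (Sp d)) (hΩ : IsOpen Ω) (hΩb : Bornology.IsBounded Ω)
    (hΩr : interior (closure Ω) = Ω) (M : Mesh Ω) (p : ℕ)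
    (τbar : ℝ) (hτ : 0 < τbar) (Fτ : M.Elem → M.Facet) (hFτ : ∀ K, Fτ K ∈ M.facetsOf K)
    (k c δ T : ℝ) (hc : 0 < c) (hδ : 0 ≤ δ) (hT : 0 < T)
    -- the solution of the Westervelt equation and its projections
    (ψ₀ ψ₁ : L2 Ω ℝ) (ψ : ℝ → L2 Ω ℝ) (v : ℝ → L2 Ω (Sp d))
    (hψ : IsWesterveltSolution Ω k c δ T ψ₀ ψ₁ ψ v)
    (πS : ℝ → M.SSpace p) (πQ : ℝ → M.QSpace p) (πM : ℝ → M.MSpace p)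
    (hπ : ∀ t ∈ Icc 0 T, IsHDGProjection (M.singleFacet τbar Fτ) (ψ t) (v t) (πS t) (πQ t))
    (hπM : ∀ t ∈ Icc 0 T, IsSkeletonProjection (ψ t) (πM t))
    -- the coefficient: non-degeneracy and smallness
    (αh : ℝ → M.SSpace p) (hα : MemWFin 2 T 1 αh)
    (αlow αup : ℝ) (hαlow : 0 < αlow) (hαup : 0 < αup) (hnd : 0 < 1 - 2 * |k| * αlow)
    (hbd : ∀ t ∈ Ioo 0 T, ∀ K : M.Elem, ∀ x ∈ hull K.1,
      1 - 2 * |k| * αlow ≤ 1 + 2 * k * sFun (αh t) K x ∧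
        1 + 2 * k * sFun (αh t) K x ≤ 1 + 2 * |k| * αup)
    (γ₀ σ₀ : ℝ) (hγ : 0 < γ₀) (hγσ : γ₀ < σ₀) (hσ : σ₀ < 1)
    (hsmall : |k| / (1 - 2 * |k| * αlow) *
        (∫ t in (0 : ℝ)..T, (eLpNorm (glue (pwTimeDeriv T (fun s => sFun (αh s)) t)) ⊤
          (volume.restrict Ω)).toReal) + γ₀ / 2 ≤ σ₀ / 2)
    -- the semidiscrete solution
    (ψh : ℝ → M.SSpace p) (vh : ℝ → M.QSpace p) (lh : ℝ → M.MSpace p)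
    (hψh : IsSemidiscreteSolution (M.singleFacet τbar Fτ) k c δ T αh ψh vh lh)
    -- the projection errors and the errors
    (δψ eψ : ℝ → L2 Ω ℝ) (δv ev : ℝ → L2 Ω (Sp d))
    (hδψ : δψ = fun t => toL2 (sFun (πS t)) - ψ t) (hδv : δv = fun t => toL2 (qFun (πQ t)) - v t)
    (heψ : eψ = fun t => ψ t - toL2 (sFun (ψh t))) (hev : ev = fun t => v t - toL2 (qFun (vh t)))
    (hδv_reg : MemW 1 T 3 δv)
    -- the lifted forcing
    (φh : ℝ → M.SSpace p) (hφ_reg : MemWFin 2 T 1 φh)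
    (hφ : ∀ t ∈ Icc 0 T, IsL2Projection (fun x =>
      (1 + 2 * k * glue (sFun (αh t)) x) * timeDeriv T (timeDeriv T δψ) t x
        - 2 * k * (timeDeriv T ψ t x - glue (sFun (αh t)) x)
          * timeDeriv T (timeDeriv T ψ) t x) (φh t)) :
    (let L : ℝ → ℝ := fun t => c ^ 2 / 2 * ‖ev t‖ ^ 2
        + 1 / 2 * weightedSq k (sFun (αh t)) (timeDeriv T eψ t)
      let R : ℝ → ℝ := fun t => c ^ 2 * ‖δv t‖ ^ 2
        + weightedSq k (sFun (αh t)) (timeDeriv T δψ t)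
      BddAbove (L '' Ioo 0 T) ∧ BddAbove (R '' Ioo 0 T) ∧
      sSup (L '' Ioo 0 T) ≤ sSup (R '' Ioo 0 T) + 2 * (1 - σ₀)⁻¹ *
        (energy₀ (M.singleFacet τbar Fτ) k c T (fun t => sFun (αh t))
            (fun t => sFun (πS t - ψh t)) (fun t => qFun (πQ t - vh t))
            (fun t => mFun (πM t - lh t)) 0
          + T / (2 * γ₀ * (1 - 2 * |k| * αlow)) * (∫ t in (0 : ℝ)..T, ‖toL2 (sFun (φh t))‖ ^ 2)
          + (δ / 4 + c ^ 2 * T / (2 * γ₀)) * ∫ t in (0 : ℝ)..T, ‖timeDeriv T δv t‖ ^ 2)) ∧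
    (let L : ℝ → ℝ := fun t => c ^ 2 / 2 * ‖timeDeriv T ev t‖ ^ 2
        + 1 / 2 * weightedSq k (sFun (αh t)) (timeDeriv T (timeDeriv T eψ) t)
      let R : ℝ → ℝ := fun t => c ^ 2 * ‖timeDeriv T δv t‖ ^ 2
        + weightedSq k (sFun (αh t)) (timeDeriv T (timeDeriv T δψ) t)
      BddAbove (L '' Ioo 0 T) ∧ BddAbove (R '' Ioo 0 T) ∧
      sSup (L '' Ioo 0 T) ≤ sSup (R '' Ioo 0 T) + 2 * (1 - σ₀)⁻¹ *
        (energy₁ (M.singleFacet τbar Fτ) k c T (fun t => sFun (αh t))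
            (fun t => sFun (πS t - ψh t)) (fun t => qFun (πQ t - vh t))
            (fun t => mFun (πM t - lh t)) 0
          + T / (2 * γ₀ * (1 - 2 * |k| * αlow)) *
            (∫ t in (0 : ℝ)..T, ‖timeDeriv T (fun s => toL2 (sFun (φh s))) t‖ ^ 2)
          + (δ / 4 + c ^ 2 * T / (2 * γ₀)) *
            ∫ t in (0 : ℝ)..T, ‖timeDeriv T (timeDeriv T δv) t‖ ^ 2)) := by
  obtain ⟨n, rfl⟩ : ∃ n, d = n + 1 := by
    rcases hd with rfl | rfl
    exacts [⟨1, rfl⟩, ⟨2, rfl⟩]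
  have hτ0 := singleFacet_nonneg hτ Fτ
  -- `tS` and `tQ` are the linear versions of `toL2`
  change δψ = fun t => tS hΩr (πS t) - ψ t at hδψ
  change δv = fun t => tQ hΩr (πQ t) - v t at hδv
  change eψ = fun t => ψ t - tS hΩr (ψh t) at heψ
  change ev = fun t => v t - tQ hΩr (vh t) at hev
  obtain ⟨rS, hsol⟩ := isErrorSolution hΩ hΩr hT hc hτ0 hFτ
    (fun K => by rw [singleFacet_self]; exact hτ) hψ hπ hπM hψh (hδv ▸ hδv_reg) (hδψ ▸ hφ)
  rw [← hδv] at hsol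
  have rδψ : MemW 1 T 3 δψ := by
    rw [hδψ]
    simpa [sub_eq_add_neg] using (rS.linearMap le_rfl hT (tS hΩr)).add le_rfl hT
      (hψ.reg_psi.clm le_rfl hT (-ContinuousLinearMap.id ℝ (L2 Ω ℝ)))
  have hb := coefficient_bounds_Icc hT hα hbd
  have hlow := fun t ht K x hx => (hb t ht K x hx).1
  have hup := fun t ht K x hx => (hb t ht K x hx).2
  have h0 : ∀ t ∈ Icc 0 T, ∀ K : M.Elem, ∀ x ∈ hull K.1, 0 ≤ 1 + 2 * k * sFun (αh t) K x :=
    fun t ht K x hx => hnd.le.trans (hlow t ht K x hx)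
  have hC : 0 ≤ 1 + 2 * |k| * αup := by positivity
  have hsmall' := integral_coefficient_le hT hα hsmall
  have hzero : (0 : ℝ) ∈ Icc 0 T := left_mem_Icc.2 hT.le
  -- the errors are differences of discrete errors and projection errors
  have hev' : ev = fun t => tQ hΩr (πQ t - vh t) - δv t := by
    rw [hev, hδv]
    funext t
    rw [map_sub, sub_sub_sub_cancel_left]
  have heψ' : eψ = fun t => tS hΩr (πS t - ψh t) - δψ t := by
    rw [heψ, hδψ]
    funext t
    rw [map_sub, sub_sub_sub_cancel_left]
  have dS₀ := hsol.reg_psi.hasFinDerivAt le_rfl hT hzero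
  have dQ₀ := hsol.reg_flux.hasFinDerivAt le_rfl hT hzero
  have dM₀ := hsol.reg_trace.hasFinDerivAt le_rfl hT hzero
  obtain ⟨B₀, hB₀⟩ := hδv_reg.exists_norm_le le_rfl hT
  obtain ⟨B₁, hB₁⟩ := (hδv_reg.timeDeriv le_rfl hT).exists_norm_le le_rfl hT
  obtain ⟨C₁, hC₁⟩ := (rδψ.timeDeriv le_rfl hT).exists_norm_le le_rfl hT
  obtain ⟨C₂, hC₂⟩ := ((rδψ.timeDeriv le_rfl hT).timeDeriv le_rfl hT).exists_norm_le le_rfl hT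
  refine ⟨sSup_image_le_add (C := c ^ 2 * B₀ ^ 2 + (1 + 2 * |k| * αup) * C₁ ^ 2) hT
      (fun t ht => ?_) fun t ht => ?_,
    sSup_image_le_add (C := c ^ 2 * B₁ ^ 2 + (1 + 2 * |k| * αup) * C₂ ^ 2) hT
      (fun t ht => ?_) fun t ht => ?_⟩
  · have htI := Ioo_subset_Icc_self ht
    have key := hsol.energy_le hT hτ0 hc hδ hγ hσ hnd hα hφ_reg hδv_reg hlow hsmall' htI
    have e1 := error_le hΩr hτ0 (c := c) (h0 t htI) (hup t htI)
      (finDeriv T (fun s => πS s - ψh s) t) (πS t - ψh t) (πQ t - vh t) (πM t - lh t) (δv t)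
      (timeDeriv T δψ t)
    rw [energy₀, pwTimeDeriv_sFun hT hzero dS₀, energy_eq_discreteEnergy hτ0 (h0 0 hzero)]
    rw [congrFun hev' t, heψ', timeDeriv_sub_tS hΩr hT htI (j := 1) hsol.reg_psi rδψ]
    simp only [tS_apply] at *
    rw [mul_assoc 2, add_assoc (discreteEnergy _ _ _ _ _ _ _ _)]
    linarith
  · have htI := Ioo_subset_Icc_self ht
    exact add_le_add
      (mul_le_mul_of_nonneg_left (pow_le_pow_left₀ (norm_nonneg _) (hB₀ t htI) 2) (sq_nonneg c))
      ((weightedSq_le hΩr (h0 t htI) (hup t htI) _).trans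
        (mul_le_mul_of_nonneg_left (pow_le_pow_left₀ (norm_nonneg _) (hC₁ t htI) 2) hC))
  · have htI := Ioo_subset_Icc_self ht
    have key := hsol.deriv_energy_le hT hτ0 hc hδ hγ hσ hnd hα hφ_reg hδv_reg hlow hsmall' htI
    have e1 := error_le hΩr hτ0 (c := c) (h0 t htI) (hup t htI)
      (finDeriv T (finDeriv T fun s => πS s - ψh s) t) (finDeriv T (fun s => πS s - ψh s) t)
      (finDeriv T (fun s => πQ s - vh s) t) (finDeriv T (fun s => πM s - lh s) t)
      (timeDeriv T δv t) (timeDeriv T (timeDeriv T δψ) t)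
    rw [energy₁, pwTimeDeriv_pwTimeDeriv_sFun le_rfl hT hzero (j := 0) hsol.reg_psi,
      pwTimeDeriv_sFun hT hzero dS₀, pwTimeDeriv_qFun hT hzero dQ₀, pwTimeDeriv_mFun hT hzero dM₀,
      energy_eq_discreteEnergy hτ0 (h0 0 hzero)]
    rw [hev', heψ', timeDeriv_sub_tQ hΩr hT htI (j := 1) hsol.reg_flux hδv_reg,
      timeDeriv_timeDeriv_sub_tS hΩr hT htI (j := 0) hsol.reg_psi rδψ]
    simp only [tS_apply] at *
    rw [mul_assoc 2, add_assoc (discreteEnergy _ _ _ _ _ _ _ _)]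
    linarith
  · have htI := Ioo_subset_Icc_self ht
    exact add_le_add
      (mul_le_mul_of_nonneg_left (pow_le_pow_left₀ (norm_nonneg _) (hB₁ t htI) 2) (sq_nonneg c))
      ((weightedSq_le hΩr (h0 t htI) (hup t htI) _).trans
        (mul_le_mul_of_nonneg_left (pow_le_pow_left₀ (norm_nonneg _) (hC₂ t htI) 2) hC))
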